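/- Let $d\ge 1$. A function $f:\mathbb R^d\to[0,\infty)$ is log-concave if $f=e^{-V}$ with $V:\mathbb R^d\to\mathbb R\cup\{+\infty\}$ convex. For log-concave $f$ with $0<\int f<\infty$ let $\mathrm{Cov}(f)$ be the covariance matrix of the probability density $f/\int f$; $f$ is centered if $\int x f(x)\,dx=0$, isotropic if $\mathrm{Cov}(f)=\sigma^2 I_d$ for some $\sigma>0$, and a density if $\int f=1$. Let $L_f=\big(\sup f/\int f\big)^{1/d}\det(\mathrm{Cov}(f))^{1/(2d)}$ and let $L_d$ be the supremum of $L_f$ over all log-concave $f$ on $\mathbb R^d$ with $0<\int f<\infty$. For $p>0$ let $$K_p(f)=\Big\{x\in\mathbb R^d:\int_0^\infty p\,r^{p-1}f(rx)\,dr\ge f(0)\Big\}.$$ There exist absolute constants $0<c_1<c_2$ such that, for every $d\ge1$ and every centered log-concave $f:\mathbb R^d\to[0,\infty)$ with $0<\int f<\infty$, $$c_1K_{d+1}(f)\subset K_d(f)\subset c_2K_{d+1}(f),\qquad c_1K_{d+2}(f)\subset K_{d+1}(f)\subset c_2K_{d+2}(f).\tag{1}$$ Let $0<c_1<c_2$ be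 any absolute constants for which (1) holds for all such $d$ and $f$. For $d\ge 1$ put $$C_d'=\frac{c_1^{d+2}}{\sqrt{2\pi}\,e^{3/2}},\qquad C_d=(d+1)\,c_2^{d+2}L_d,\qquad c_d=3^{1/d}C_d .$$ (The dimensional constant $c_d$ is not to be confused with the absolute constants $c_1,c_2$ of (1).) Then $L_d<\infty$ and $0<C_d'<C_d$, and for every centered, isotropic, log-concave density $f$ on $\mathbb R^d$: (a) for every unit vector $\theta\in\mathbb S^{d-1}$, the following integral is finite and $$C_d'\le\Big(\int_0^\infty d\,r^{d-1}f(r\theta)\,dr\Big)^{1/d}\le C_d;$$ (b) (Concentration Lemma) $f(0)>0$, and for every $x\in\mathbb R^d$ with $\|x\|_2\ge c_d/f(0)^{1/d}$, $$f(x)\le f(0)\,2^{-\|x\|_2 f(0)^{1/d}/c_d}.$$ -/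

import Mathlib

open MeasureTheory Set
open scoped Pointwise

noncomputable section

/-- `f : ℝ^d → [0, ∞)` is log-concave, i.e. `f = exp (-V)` with `V : ℝ^d → ℝ ∪ {+∞}` convex.
With the convention `0 ^ 0 = 1` for real powers the inequality is trivial when `a` or `b` is `0`. -/
structure IsLogConcave {d : ℕ} (f : EuclideanSpace ℝ (Fin d) → ℝ) : Prop where
  nonneg : ∀ x, 0 ≤ f x
  le_map : ∀ x y : EuclideanSpace ℝ (Fin d), ∀ a b : ℝ, 0 ≤ a → 0 ≤ b → a + b = 1 →
    f x ^ a * f y ^ b ≤ f (a • x + b • y)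

/-- The total mass `∫ f` exists and is positive. -/
def HasPosMass {d : ℕ} (f : EuclideanSpace ℝ (Fin d) → ℝ) : Prop :=
  Integrable f ∧ 0 < ∫ x, f x

/-- `f` is a probability density (nonnegativity is part of log-concavity). -/
def IsDensity {d : ℕ} (f : EuclideanSpace ℝ (Fin d) → ℝ) : Prop :=
  Integrable f ∧ ∫ x, f x = 1

/-- `∫ x f(x) dx = 0`.  The first moments of a log-concave function of positive finite mass are
automatically finite. -/
def IsCentered {d : ℕ} (f : EuclideanSpace ℝ (Fin d) → ℝ) : Prop :=
  ∫ x, f x • x = 0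

/-- The covariance matrix of a function `f : ℝ^d → [0, ∞)`. -/
def covMatrix {d : ℕ} (f : EuclideanSpace ℝ (Fin d) → ℝ) : Matrix (Fin d) (Fin d) ℝ :=
  Matrix.of fun i j =>
    (∫ x, x i * x j * f x) / (∫ x, f x)
      - (∫ x, x i * f x) * (∫ x, x j * f x) / (∫ x, f x) ^ 2

/-- `Cov f = σ² I_d` for some `σ > 0`. -/
def IsIsotropic {d : ℕ} (f : EuclideanSpace ℝ (Fin d) → ℝ) : Prop :=
  ∃ σ : ℝ, 0 < σ ∧ covMatrix f = σ ^ 2 • (1 : Matrix (Fin d) (Fin d) ℝ)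

/-- The isotropic constant `L_f = (sup f / ∫ f)^{1/d} (det Cov f)^{1/(2d)}`. -/
def isotropicConstant {d : ℕ} (f : EuclideanSpace ℝ (Fin d) → ℝ) : ℝ :=
  ((⨆ x, f x) / ∫ x, f x) ^ (1 / (d : ℝ)) * (covMatrix f).det ^ (1 / (2 * (d : ℝ)))

/-- The set of isotropic constants of log-concave functions on `ℝ^d` of positive finite mass. -/
def isotropicConstants (d : ℕ) : Set ℝ :=
  {L | ∃ f : EuclideanSpace ℝ (Fin d) → ℝ,
    IsLogConcave f ∧ HasPosMass f ∧ L = isotropicConstant f}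

/-- `L_d`, the supremum of the isotropic constants of log-concave functions on `ℝ^d`. -/
def maxIsotropicConstant (d : ℕ) : ℝ := sSup (isotropicConstants d)

/-- Ball's body `K_p(f) = {x : ∫_0^∞ p r^{p-1} f(r x) dr ≥ f(0)}`; the integral of the nonnegative
integrand takes values in `[0, ∞]` (at `x = 0` it may be infinite). -/
def ballBody {d : ℕ} (p : ℝ) (f : EuclideanSpace ℝ (Fin d) → ℝ) :
    Set (EuclideanSpace ℝ (Fin d)) :=
  {x | ENNReal.ofReal (f 0) ≤ ∫⁻ r in Ioi (0 : ℝ), ENNReal.ofReal (p * r ^ (p - 1) * f (r • x))}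

/-- `0 < c₁ < c₂` are absolute constants with `c₁ K_{d+1}(f) ⊆ K_d(f) ⊆ c₂ K_{d+1}(f)` and
`c₁ K_{d+2}(f) ⊆ K_{d+1}(f) ⊆ c₂ K_{d+2}(f)` in every dimension `d ≥ 1`, for every centered
log-concave function `f` on `ℝ^d` of positive finite mass. -/
def AreBallBodyConstants (c₁ c₂ : ℝ) : Prop :=
  0 < c₁ ∧ c₁ < c₂ ∧
    ∀ d : ℕ, 1 ≤ d → ∀ f : EuclideanSpace ℝ (Fin d) → ℝ,
      IsLogConcave f → HasPosMass f → IsCentered f →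
        (c₁ • ballBody ((d : ℝ) + 1) f ⊆ ballBody (d : ℝ) f ∧
          ballBody (d : ℝ) f ⊆ c₂ • ballBody ((d : ℝ) + 1) f) ∧
        (c₁ • ballBody ((d : ℝ) + 2) f ⊆ ballBody ((d : ℝ) + 1) f ∧
          ballBody ((d : ℝ) + 1) f ⊆ c₂ • ballBody ((d : ℝ) + 2) f)

/-- `C_d' = c₁^{d+2} / (√(2π) e^{3/2})`. -/
def lowerRadialConstant (c₁ : ℝ) (d : ℕ) : ℝ :=
  c₁ ^ (d + 2) / (√(2 * Real.pi) * Real.exp (3 / 2))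

/-- `C_d = (d+1) c₂^{d+2} L_d`. -/
def upperRadialConstant (c₂ : ℝ) (d : ℕ) : ℝ :=
  ((d : ℝ) + 1) * c₂ ^ (d + 2) * maxIsotropicConstant d

/-- `c_d = 3^{1/d} C_d`. -/
def concentrationConstant (c₂ : ℝ) (d : ℕ) : ℝ :=
  (3 : ℝ) ^ (1 / (d : ℝ)) * upperRadialConstant c₂ d

end

/-! Let ρ be the radial function of K_d(f). The ray moment in (a) equals f(0) ρ(θ)^d, so (a) asks
for two-sided bounds on f(0)^{1/d} ρ(θ). Both factors are compared with σ, where Cov f = σ² I.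

Radius. In polar coordinates, a nonnegative function homogeneous of degree k has the same integral
over K_{d+k}(f) as against f/f(0) (`mul_setIntegral_ballBody`). Hence K_d has volume 1/f(0), K_{d+1}
has barycenter 0, and K_{d+2} has second moments σ²/f(0). Inclusions between consecutive bodies
bring all this onto K_{d+1}, which is convex by Ball's theorem (`convex_ballBody`). For a centered
convex body, volume and second moment bound the norm of its points from above and the distance of
its supporting hyperplanes from below (`Convex.sq_mul_volume_le`, `Convex.second_moment_le`). The
first bound, with c₂, gives the upper estimate. The second loses a factor d, which is absorbed by
using, in place of c₁, the sharp constants `borellConst` from comparison with an exponential: K_d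
contains a ball of radius 2^{-(d+2)/2} σ. Testing the hypothesis on exp(-|x|) on the line gives c₁²
≤ 1/2, so this radius is at least c₁^{d+2} σ.

Height. By definition f(0)^{1/d} σ ≤ L_f ≤ L_d. Conversely, comparing entropy with a Gaussian gives
(sup f)^{1/d} σ ≥ (2πe)^{-1/2}, and sup f ≤ e^d f(0) at the barycenter (`le_exp_mul_apply_zero`)
costs one more factor e.

The same ingredients give the rest. The inner ball and the volume of K_d bound L_f in isotropic
position, the entropy bound for L_d gives C_d' < C_d, and the body inclusions hold with c₁ = 1/2 and
c₂ = e. For (b), a value above f(0)/2 at distance c_d / f(0)^{1/d} would push the ray moment above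
C_d^d; so f has halved there, and log-concavity from the origin turns this into exponential decay.
-/

namespace IsLogConcave

/-! ### Quasi-concavity, rays and affine substitutions. -/

variable {d : ℕ} {f : EuclideanSpace ℝ (Fin d) → ℝ}

theorem min_le_map (hf : IsLogConcave f) (x y : EuclideanSpace ℝ (Fin d)) {a b : ℝ}
    (ha : 0 ≤ a) (hb : 0 ≤ b) (hab : a + b = 1) : min (f x) (f y) ≤ f (a • x + b • y) := by
  refine le_trans ?_ (hf.le_map x y a b ha hb hab)
  have hm : 0 ≤ min (f x) (f y) := le_min (hf.nonneg x) (hf.nonneg y)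
  rcases hm.eq_or_lt with h | h
  · rw [← h]
    exact mul_nonneg (Real.rpow_nonneg (hf.nonneg x) _) (Real.rpow_nonneg (hf.nonneg y) _)
  calc min (f x) (f y) = min (f x) (f y) ^ a * min (f x) (f y) ^ b := by
        rw [← Real.rpow_add h, hab, Real.rpow_one]
    _ ≤ f x ^ a * f y ^ b := by
        exact mul_le_mul (Real.rpow_le_rpow hm (min_le_left _ _) ha)
          (Real.rpow_le_rpow hm (min_le_right _ _) hb) (Real.rpow_nonneg hm _)
          (Real.rpow_nonneg (hf.nonneg x) _)

theorem convex_le (hf : IsLogConcave f) (t : ℝ) : Convex ℝ {x | t ≤ f x} := by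
  intro x hx y hy a b ha hb hab
  exact (le_min hx hy).trans (hf.min_le_map x y ha hb hab)

theorem convex_lt (hf : IsLogConcave f) (t : ℝ) : Convex ℝ {x | t < f x} := by
  intro x hx y hy a b ha hb hab
  exact (lt_min hx hy).trans_le (hf.min_le_map x y ha hb hab)

theorem min_le_ray (hf : IsLogConcave f) (x : EuclideanSpace ℝ (Fin d)) {r s t : ℝ}
    (hrs : r ≤ s) (hst : s ≤ t) : min (f (r • x)) (f (t • x)) ≤ f (s • x) := by
  rcases hrs.eq_or_lt with rfl | hrs
  · exact min_le_left _ _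
  have h0 : 0 < t - r := by linarith
  have := hf.min_le_map (r • x) (t • x) (a := (t - s) / (t - r)) (b := (s - r) / (t - r))
    (div_nonneg (by linarith) h0.le) (div_nonneg (by linarith) h0.le) (by field_simp; ring)
  convert this using 2
  rw [smul_smul, smul_smul, ← add_smul]
  congr 1
  field_simp
  ring

/-- Integrability gives only a.e. measurability in space, which says nothing on a ray, a null set
once d ≥ 2. Superlevel sets along a line are intervals, hence Borel. -/
theorem measurable_ray (hf : IsLogConcave f) (x : EuclideanSpace ℝ (Fin d)) :
    Measurable fun r : ℝ => f (r • x) := by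
  refine measurable_of_Ioi fun t => ?_
  apply Set.OrdConnected.measurableSet
  refine ⟨fun r hr u hu s hs => ?_⟩
  exact (lt_min hr hu).trans_le (hf.min_le_ray x hs.1 hs.2)

theorem comp_affine {e : ℕ} (hf : IsLogConcave f)
    (A : EuclideanSpace ℝ (Fin e) →ₗ[ℝ] EuclideanSpace ℝ (Fin d))
    (v : EuclideanSpace ℝ (Fin d)) : IsLogConcave fun x => f (A x + v) := by
  refine ⟨fun x => hf.nonneg _, fun x y a b ha hb hab => ?_⟩
  refine (hf.le_map _ _ a b ha hb hab).trans_eq ?_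
  congr 1
  rw [map_add, map_smul, map_smul, smul_add, smul_add]
  have : v = a • v + b • v := by rw [← add_smul, hab, one_smul]
  nth_rewrite 3 [this]
  abel

theorem const_mul (hf : IsLogConcave f) {c : ℝ} (hc : 0 < c) : IsLogConcave fun x => c * f x := by
  refine ⟨fun x => mul_nonneg hc.le (hf.nonneg _), fun x y a b ha hb hab => ?_⟩
  rw [Real.mul_rpow hc.le (hf.nonneg _), Real.mul_rpow hc.le (hf.nonneg _),
    mul_mul_mul_comm, ← Real.rpow_add hc, hab, Real.rpow_one]
  exact mul_le_mul_of_nonneg_left (hf.le_map x y a b ha hb hab) hc.le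

end IsLogConcave

/-! ### Convex sets of finite volume and of zero volume. -/

/-- A convex set containing a nonempty ball and having finite volume is bounded. -/
theorem Convex.exists_norm_le_of_volume_lt_top {d : ℕ} {K : Set (EuclideanSpace ℝ (Fin d))}
    (hK : Convex ℝ K) {x₀ : EuclideanSpace ℝ (Fin d)} {ε : ℝ} (hε : 0 < ε)
    (hball : Metric.ball x₀ ε ⊆ K) (hvol : volume K < ⊤) :
    ∃ R : ℝ, 0 < R ∧ ∀ x ∈ K, ‖x - x₀‖ ≤ R := by
  have hm : 0 < volume (Metric.ball (0 : EuclideanSpace ℝ (Fin d)) (ε / 2)) :=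
    Metric.measure_ball_pos _ _ (by positivity)
  obtain ⟨N, hN⟩ := ENNReal.exists_nat_mul_gt hm.ne' hvol.ne
  have hN0 : N ≠ 0 := by rintro rfl; simp at hN
  refine ⟨2 * N * ε, by positivity, fun x hx => ?_⟩
  by_contra! hR
  have hN' : (0 : ℝ) < N := by positivity
  -- On the first half of the segment from `x₀` to `x`, the hull of `x` and the given ball still
  -- contains balls of radius ε/2. If `x` is far away, N of them are disjoint, and by the choice of
  -- N their volumes exceed that of `K`.
  set c : ℕ → EuclideanSpace ℝ (Fin d) := fun i => x₀ + ((i : ℝ) / (2 * N)) • (x - x₀) with hc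
  have hsub : ∀ i < N, Metric.ball (c i) (ε / 2) ⊆ K := by
    intro i hi y hy
    have hi' : (i : ℝ) < N := by exact_mod_cast hi
    set t : ℝ := (i : ℝ) / (2 * N) with ht
    have ht0 : 0 ≤ t := by positivity
    have ht1 : t ≤ 1 / 2 := by rw [ht, div_le_iff₀ (by positivity)]; linarith
    have hw : x₀ + (1 - t)⁻¹ • (y - c i) ∈ K := by
      apply hball
      rw [Metric.mem_ball, dist_eq_norm, add_sub_cancel_left, norm_smul, norm_inv,
        Real.norm_of_nonneg (by linarith), ← dist_eq_norm, inv_mul_lt_iff₀ (by linarith)]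
      have := Metric.mem_ball.1 hy
      nlinarith
    have := hK hw hx (a := 1 - t) (b := t) (by linarith) ht0 (by ring)
    convert this using 1
    rw [smul_add, smul_smul, mul_inv_cancel₀ (by linarith), one_smul, hc]
    simp only [sub_smul, smul_sub, one_smul, ← ht]
    abel
  have hdisj : Set.PairwiseDisjoint (Finset.range N : Set ℕ) fun i => Metric.ball (c i) (ε / 2) := by
    intro i hi j hj hij
    apply Metric.ball_disjoint_ball
    have : c i - c j = (((i : ℝ) - j) / (2 * N)) • (x - x₀) := by
      simp only [hc, sub_div, sub_smul]; abel
    rw [dist_eq_norm, this, norm_smul, Real.norm_eq_abs, abs_div, abs_of_pos (a := 2 * (N : ℝ)) (by positivity)]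
    have h1 : (1 : ℝ) ≤ |(i : ℝ) - j| := by
      have : (1 : ℤ) ≤ |(i : ℤ) - j| := Int.one_le_abs (by omega)
      exact_mod_cast this
    have h2 : ε / 2 + ε / 2 ≤ 1 / (2 * N) * ‖x - x₀‖ := by
      rw [div_mul_eq_mul_div, le_div_iff₀ (by positivity)]; linarith
    exact h2.trans (by gcongr)
  have hle : (N : ENNReal) * volume (Metric.ball (0 : EuclideanSpace ℝ (Fin d)) (ε / 2)) ≤ volume K := by
    calc _ = ∑ i ∈ Finset.range N, volume (Metric.ball (c i) (ε / 2)) := by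
          simp [Measure.addHaar_ball_center]
      _ = volume (⋃ i ∈ Finset.range N, Metric.ball (c i) (ε / 2)) :=
          (measure_biUnion_finset hdisj fun _ _ => measurableSet_ball).symm
      _ ≤ volume K := measure_mono (iUnion₂_subset fun i hi => hsub i (Finset.mem_range.1 hi))
  exact absurd hN hle.not_gt

/-- Without interior the set lies in its frontier, and the frontier of a convex set is null. -/
theorem Convex.volume_eq_zero_of_interior_eq_empty {d : ℕ} {K : Set (EuclideanSpace ℝ (Fin d))}
    (hK : Convex ℝ K) (h : interior K = ∅) : volume K = 0 := by
  refine measure_mono_null ?_ (hK.addHaar_frontier volume)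
  rw [frontier, h, sdiff_empty]
  exact subset_closure

/-! ### Exponential decay, finite moments, position of the barycenter. -/

namespace IsLogConcave

variable {d : ℕ} {f : EuclideanSpace ℝ (Fin d) → ℝ}

theorem volume_support_pos (hf : IsLogConcave f) (hm : HasPosMass f) : 0 < volume {x | 0 < f x} := by
  have := (integral_pos_iff_support_of_nonneg hf.nonneg hm.1).1 hm.2
  convert this using 2
  ext x
  simp [(hf.nonneg x).lt_iff_ne, eq_comm]

/-- Superlevel sets at small positive levels contain a ball. -/
theorem exists_ball_subset (hf : IsLogConcave f) (hm : HasPosMass f) :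
    ∃ x₀ : EuclideanSpace ℝ (Fin d), ∃ ε c : ℝ, 0 < ε ∧ 0 < c ∧ Metric.ball x₀ ε ⊆ {x | c ≤ f x} := by
  have h1 : {x | 0 < f x} = ⋃ n : ℕ, {x | 1 / ((n : ℝ) + 1) ≤ f x} := by
    ext x
    simp only [mem_ofPred_eq, mem_iUnion]
    constructor
    · intro h
      obtain ⟨n, hn⟩ := exists_nat_one_div_lt h
      exact ⟨n, hn.le⟩
    · rintro ⟨n, hn⟩
      exact lt_of_lt_of_le (by positivity) hn
  have h2 : ∃ n : ℕ, (interior {x | 1 / ((n : ℝ) + 1) ≤ f x}).Nonempty := by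
    by_contra! h
    have h3 := hf.volume_support_pos hm
    rw [h1] at h3
    exact h3.ne' (measure_iUnion_null fun n =>
      (hf.convex_le _).volume_eq_zero_of_interior_eq_empty (h n))
  obtain ⟨n, x₀, hx₀⟩ := h2
  obtain ⟨ε, hε, hb⟩ := Metric.isOpen_iff.1 isOpen_interior x₀ hx₀
  exact ⟨x₀, ε, _, hε, by positivity, hb.trans interior_subset⟩

/-- The point `x₀` lies between `x` and `x₀ - η (x - x₀)`, which is in the ball where `f ≥ c`; a
large value at `x` would force a large value at `x₀`. -/
theorem exists_forall_le (hf : IsLogConcave f) {x₀ : EuclideanSpace ℝ (Fin d)} {ε c R : ℝ}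
    (hε : 0 < ε) (hc : 0 < c) (hR : 0 ≤ R) (hb : Metric.ball x₀ ε ⊆ {x | c ≤ f x}) :
    ∃ M : ℝ, 0 ≤ M ∧ ∀ x, ‖x - x₀‖ ≤ R → f x ≤ M := by
  set η : ℝ := ε / (R + 1) with hη
  have hη0 : 0 < η := by positivity
  set b : ℝ := η / (1 + η) with hb'
  have hb0 : 0 < b := by positivity
  have hab : (1 + η)⁻¹ + b = 1 := by rw [hb']; field_simp
  refine ⟨(f x₀ / c ^ (1 + η)⁻¹) ^ b⁻¹, Real.rpow_nonneg (div_nonneg (hf.nonneg _) (by positivity)) _,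
    fun x hx => ?_⟩
  have hw : c ≤ f (x₀ - η • (x - x₀)) := by
    apply hb
    rw [Metric.mem_ball, dist_eq_norm, sub_sub_cancel_left, norm_neg, norm_smul,
      Real.norm_of_nonneg hη0.le, hη, div_mul_eq_mul_div, div_lt_iff₀ (by positivity)]
    nlinarith
  have h := hf.le_map (x₀ - η • (x - x₀)) x (1 + η)⁻¹ b (by positivity) hb0.le hab
  have hpt : (1 + η)⁻¹ • (x₀ - η • (x - x₀)) + b • x = x₀ := by
    have : b = (1 + η)⁻¹ * η := by rw [hb']; field_simp
    rw [this, mul_smul, ← smul_add, inv_smul_eq_iff₀ (by positivity), smul_sub, add_smul, one_smul]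
    abel
  rw [hpt] at h
  have h2 : f x ^ b ≤ f x₀ / c ^ (1 + η)⁻¹ := by
    rw [le_div_iff₀ (by positivity), mul_comm]
    refine le_trans ?_ h
    gcongr
    exact Real.rpow_nonneg (hf.nonneg x) _
  calc f x = (f x ^ b) ^ b⁻¹ := by rw [← Real.rpow_mul (hf.nonneg x), mul_inv_cancel₀ hb0.ne', Real.rpow_one]
    _ ≤ _ := Real.rpow_le_rpow (Real.rpow_nonneg (hf.nonneg x) _) h2 (by positivity)

/-- A log-concave function of finite positive mass decays exponentially. -/
theorem exists_exp_decay (hf : IsLogConcave f) (hm : HasPosMass f) :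
    ∃ A B : ℝ, 0 < A ∧ 0 < B ∧ ∀ x, f x ≤ A * Real.exp (-(B * ‖x‖)) := by
  obtain ⟨x₀, ε, c, hε, hc, hb⟩ := hf.exists_ball_subset hm
  have hx₀ : c ≤ f x₀ := hb (Metric.mem_ball_self hε)
  have hc' : 0 < c * Real.exp (-1) := by positivity
  have hcc : c * Real.exp (-1) ≤ c := by
    have : Real.exp (-1) ≤ 1 := Real.exp_le_one_iff.2 (by norm_num)
    nlinarith
  -- By Markov's inequality this convex superlevel set has finite volume, so it is bounded.
  obtain ⟨R, hR, hbd⟩ := (hf.convex_le (c * Real.exp (-1))).exists_norm_le_of_volume_lt_top hε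
    (hb.trans fun x (hx : c ≤ f x) => hcc.trans hx) (by
      have := hm.1.measure_norm_ge_lt_top hc'
      refine lt_of_le_of_lt (measure_mono fun x hx => ?_) this
      exact le_trans (show c * Real.exp (-1) ≤ f x from hx) (le_abs_self _))
  set R' := R + 1 with hR'
  obtain ⟨M, hM, hfM⟩ := hf.exists_forall_le hε hc (R := R') (by positivity) hb
  -- At distance `R' = R + 1`, strictly outside that set, `f` has lost a factor e compared with
  -- `x₀`; log-concavity from `x₀` extrapolates this loss beyond.
  have hfar : ∀ x, R' ≤ ‖x - x₀‖ → f x ≤ f x₀ * Real.exp (-(‖x - x₀‖ / R')) := by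
    intro x hx
    have hn : 0 < ‖x - x₀‖ := by linarith
    set t := R' / ‖x - x₀‖ with ht
    have ht0 : 0 < t := by positivity
    have ht1 : t ≤ 1 := by rw [ht, div_le_one hn]; exact hx
    have h := hf.le_map x₀ x (1 - t) t (by linarith) ht0.le (by ring)
    have hz : f ((1 - t) • x₀ + t • x) < f x₀ * Real.exp (-1) := by
      have : ¬ (c * Real.exp (-1) ≤ f ((1 - t) • x₀ + t • x)) := by
        intro hmem
        have h5 := hbd _ hmem
        have h6 : (1 - t) • x₀ + t • x - x₀ = t • (x - x₀) := by
          rw [sub_smul, one_smul, smul_sub]; abel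
        rw [h6, norm_smul, Real.norm_of_nonneg ht0.le, ht, div_mul_cancel₀ _ hn.ne'] at h5
        linarith
      refine (not_le.1 this).trans_le ?_
      gcongr
    have hp0 : 0 < f x₀ := hc.trans_le hx₀
    rcases (hf.nonneg x).eq_or_lt with h0 | hpx
    · rw [← h0]; positivity
    have h7 := Real.log_le_log (by positivity) (h.trans hz.le)
    rw [Real.log_mul (by positivity) (by positivity), Real.log_rpow hp0, Real.log_rpow hpx,
      Real.log_mul (by positivity) (by positivity), Real.log_exp] at h7
    rw [← Real.log_le_log_iff hpx (by positivity), Real.log_mul (by positivity) (by positivity),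
      Real.log_exp]
    have h8 : ‖x - x₀‖ / R' = t⁻¹ := by rw [ht, inv_div]
    rw [h8]
    have h9 : t * Real.log (f x) ≤ t * (Real.log (f x₀) + -t⁻¹) := by
      rw [mul_add, mul_neg, mul_inv_cancel₀ ht0.ne']; linarith
    exact le_of_mul_le_mul_left h9 ht0
  have hR'0 : 0 < R' := by positivity
  refine ⟨(f x₀ + M) * Real.exp (1 + ‖x₀‖ / R'), 1 / R', ?_, by positivity, fun x => ?_⟩
  · have : 0 < f x₀ := hc.trans_le hx₀
    positivity
  have hp0 : 0 < f x₀ := hc.trans_le hx₀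
  rw [mul_assoc, ← Real.exp_add]
  rcases le_total R' ‖x - x₀‖ with h | h
  · refine (hfar x h).trans ?_
    gcongr
    · linarith
    · have := norm_sub_norm_le x x₀
      have h2 : (‖x‖ - ‖x₀‖) / R' ≤ ‖x - x₀‖ / R' := by gcongr
      rw [sub_div] at h2
      rw [div_mul_eq_mul_div, one_mul]
      linarith
  · refine (hfM x h).trans ?_
    have h1 : 1 ≤ Real.exp (1 + ‖x₀‖ / R' + -(1 / R' * ‖x‖)) := by
      apply Real.one_le_exp
      have := norm_sub_norm_le x x₀
      have h2 : (‖x‖ - ‖x₀‖) / R' ≤ 1 := by rw [div_le_one hR'0]; linarith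
      rw [sub_div] at h2
      rw [div_mul_eq_mul_div, one_mul]
      linarith
    nlinarith

/-- Exponential decay absorbs k + d + 1 powers of 1 + ‖x‖: k for the weight and d + 1 for an
integrable majorant. -/
theorem integrable_pow_mul (hf : IsLogConcave f) (hm : HasPosMass f) (k : ℕ) :
    Integrable fun x => ‖x‖ ^ k * f x := by
  obtain ⟨A, B, hA, hB, h⟩ := hf.exists_exp_decay hm
  set N : ℕ := k + d + 1 with hN
  have hint : Integrable fun x : EuclideanSpace ℝ (Fin d) => (1 + ‖x‖) ^ (-((d : ℝ) + 1)) :=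
    integrable_one_add_norm (by simp)
  refine (hint.const_mul (A * ((N.factorial : ℝ) / (B ⊓ 1) ^ N * Real.exp (B ⊓ 1)))).mono'
    ((continuous_norm.pow k).aestronglyMeasurable.mul hm.1.1) (Filter.Eventually.of_forall fun x => ?_)
  have hb : 0 < B ⊓ 1 := lt_min hB one_pos
  rw [Real.norm_of_nonneg (mul_nonneg (by positivity) (hf.nonneg x))]
  have hx : 0 ≤ ‖x‖ := norm_nonneg x
  have h1 : ((B ⊓ 1) * (1 + ‖x‖)) ^ N / N.factorial ≤ Real.exp ((B ⊓ 1) * (1 + ‖x‖)) :=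
    Real.pow_div_factorial_le_exp _ (by positivity) N
  have h2 : (1 + ‖x‖) ^ N * Real.exp (-(B * ‖x‖)) ≤
      (N.factorial : ℝ) / (B ⊓ 1) ^ N * Real.exp (B ⊓ 1) := by
    have h3 : Real.exp (-(B * ‖x‖)) ≤ Real.exp (-((B ⊓ 1) * ‖x‖)) := by
      gcongr; exact min_le_left _ _
    have h4 : Real.exp ((B ⊓ 1) * (1 + ‖x‖)) = Real.exp (B ⊓ 1) / Real.exp (-((B ⊓ 1) * ‖x‖)) := by
      rw [← Real.exp_sub]; congr 1; ring
    rw [h4, mul_pow, div_le_div_iff₀ (by positivity) (by positivity)] at h1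
    rw [div_mul_eq_mul_div, le_div_iff₀ (by positivity)]
    calc (1 + ‖x‖) ^ N * Real.exp (-(B * ‖x‖)) * (B ⊓ 1) ^ N
        ≤ (1 + ‖x‖) ^ N * Real.exp (-((B ⊓ 1) * ‖x‖)) * (B ⊓ 1) ^ N := by gcongr
      _ ≤ _ := by linarith
  have h5 : (1 + ‖x‖) ^ (-((d : ℝ) + 1)) = ((1 + ‖x‖) ^ (d + 1))⁻¹ := by
    rw [Real.rpow_neg (by positivity)]; congr 1
    exact_mod_cast Real.rpow_natCast (1 + ‖x‖) (d + 1)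
  rw [h5, ← div_eq_mul_inv, le_div_iff₀ (by positivity)]
  calc ‖x‖ ^ k * f x * (1 + ‖x‖) ^ (d + 1)
      ≤ (1 + ‖x‖) ^ k * (A * Real.exp (-(B * ‖x‖))) * (1 + ‖x‖) ^ (d + 1) := by
        gcongr
        · exact hf.nonneg x
        · linarith
        · exact h x
    _ = A * ((1 + ‖x‖) ^ N * Real.exp (-(B * ‖x‖))) := by rw [hN, add_assoc, pow_add]; ring
    _ ≤ _ := by gcongr

theorem integrable_mul_of_norm_le (hf : IsLogConcave f) (hm : HasPosMass f) (k : ℕ) {C : ℝ}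
    {q : EuclideanSpace ℝ (Fin d) → ℝ} (hq : Continuous q) (h : ∀ x, |q x| ≤ C * ‖x‖ ^ k) :
    Integrable fun x => q x * f x := by
  refine ((hf.integrable_pow_mul hm k).const_mul C).mono' (hq.aestronglyMeasurable.mul hm.1.1)
    (Filter.Eventually.of_forall fun x => ?_)
  rw [norm_mul, Real.norm_eq_abs, Real.norm_of_nonneg (hf.nonneg x), ← mul_assoc]
  exact mul_le_mul_of_nonneg_right (h x) (hf.nonneg x)

theorem integrable_smul_self (hf : IsLogConcave f) (hm : HasPosMass f) :
    Integrable fun x => f x • x := by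
  refine (hf.integrable_pow_mul hm 1).mono' (hm.1.1.smul continuous_id.aestronglyMeasurable)
    (Filter.Eventually.of_forall fun x => ?_)
  rw [norm_smul, Real.norm_of_nonneg (hf.nonneg x), pow_one, mul_comm]

theorem integral_linear_mul (hf : IsLogConcave f) (hm : HasPosMass f)
    (l : EuclideanSpace ℝ (Fin d) →L[ℝ] ℝ) : ∫ x, l x * f x = l (∫ x, f x • x) := by
  rw [← l.integral_comp_comm (hf.integrable_smul_self hm)]
  simp [mul_comm]

theorem bddAbove_range (hf : IsLogConcave f) (hm : HasPosMass f) : BddAbove (range f) := by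
  obtain ⟨A, B, hA, hB, h⟩ := hf.exists_exp_decay hm
  refine ⟨A, ?_⟩
  rintro _ ⟨x, rfl⟩
  refine (h x).trans ?_
  have : Real.exp (-(B * ‖x‖)) ≤ 1 := Real.exp_le_one_iff.2 (by
    have := norm_nonneg x
    have : 0 ≤ B * ‖x‖ := by positivity
    linarith)
  nlinarith

/-- The barycenter of a log-concave function is interior to its support. -/
theorem zero_mem_interior_support (hf : IsLogConcave f) (hm : HasPosMass f) (hc : IsCentered f) :
    (0 : EuclideanSpace ℝ (Fin d)) ∈ interior {x | 0 < f x} := by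
  by_contra h0
  have hconv := hf.convex_lt 0
  -- Otherwise a hyperplane through 0 has the interior of the support strictly on one side. The
  -- first moment of `f` along its normal vanishes, so `f` would vanish a.e.
  obtain ⟨l, hl⟩ := geometric_hahn_banach_open_point hconv.interior isOpen_interior h0
  rw [map_zero] at hl
  have hae : ∀ᵐ x, x ∈ {x | 0 < f x} → x ∈ interior {x | 0 < f x} := by
    have := hconv.addHaar_frontier volume
    filter_upwards [measure_eq_zero_iff_ae_notMem.1 this] with x hx hpos
    by_contra hcon
    exact hx ⟨subset_closure hpos, hcon⟩
  have hzero : ∫ x, -l x * f x = 0 := by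
    simp_rw [neg_mul]
    rw [integral_neg, hf.integral_linear_mul hm l, show ∫ x, f x • x = 0 from hc, map_zero, neg_zero]
  have hint : Integrable fun x => -l x * f x :=
    hf.integrable_mul_of_norm_le hm 1 (C := ‖l‖) (by fun_prop) fun x => by
      rw [abs_neg, pow_one]; exact l.le_opNorm x
  have hnn : 0 ≤ᵐ[volume] fun x => -l x * f x := by
    filter_upwards [hae] with x hx
    rcases (hf.nonneg x).eq_or_lt with h | h
    · simp [← h]
    · exact mul_nonneg (by linarith [hl x (hx h)]) h.le
  have := (integral_eq_zero_iff_of_nonneg_ae hnn hint).1 hzero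
  have hsupp := hf.volume_support_pos hm
  refine hsupp.ne' (measure_mono_null (t := {x | ¬ (-l x * f x = (0 : EuclideanSpace ℝ (Fin d) → ℝ) x)} ∪ {x | ¬ (x ∈ {x | 0 < f x} → x ∈ interior {x | 0 < f x})}) ?_ (measure_union_null this hae))
  intro x hx
  by_cases h : x ∈ interior {x | 0 < f x}
  · left
    have h1 := hl x h
    exact (mul_pos (by linarith) hx).ne'
  · right
    exact fun hcon => h (hcon hx)

end IsLogConcave

/-! ### Tangent exponentials and the value at the barycenter. -/

namespace IsLogConcave

variable {d : ℕ} {f : EuclideanSpace ℝ (Fin d) → ℝ}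

/-- A log-concave function lies below an exponential which is tight at the origin. -/
theorem exists_le_exp (hf : IsLogConcave f)
    (h0 : (0 : EuclideanSpace ℝ (Fin d)) ∈ interior {x | 0 < f x}) :
    ∃ l : EuclideanSpace ℝ (Fin d) →L[ℝ] ℝ, ∀ x, f x ≤ f 0 * Real.exp (l x) := by
  set U := interior {x | 0 < f x} with hU
  have hUpos : ∀ x ∈ U, 0 < f x := fun x hx => show x ∈ {x | 0 < f x} from interior_subset hx
  have hf0 : 0 < f 0 := hUpos 0 h0
  have hUc : Convex ℝ U := (hf.convex_lt 0).interior
  have hUo : IsOpen U := isOpen_interior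
  have hlogmap : ∀ x y, 0 < f x → 0 < f y → ∀ a b : ℝ, 0 ≤ a → 0 ≤ b → a + b = 1 →
      a * Real.log (f x) + b * Real.log (f y) ≤ Real.log (f (a • x + b • y)) := by
    intro x y hx hy a b ha hb hab
    rw [← Real.log_rpow hx, ← Real.log_rpow hy, ← Real.log_mul (by positivity) (by positivity)]
    exact Real.log_le_log (by positivity) (hf.le_map x y a b ha hb hab)
  have hconc : ConcaveOn ℝ U fun x => Real.log (f x) :=
    ⟨hUc, fun x hx y hy a b ha hb hab => hlogmap x y (hUpos x hx) (hUpos y hy) a b ha hb hab⟩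
  have hcont : ContinuousOn (fun x => Real.log (f x)) U := hconc.continuousOn hUo
  have hopen : IsOpen {p : EuclideanSpace ℝ (Fin d) × ℝ | p.1 ∈ U ∧ p.2 < Real.log (f p.1)} := by
    have hc2 : ContinuousOn (fun p : EuclideanSpace ℝ (Fin d) × ℝ => Real.log (f p.1) - p.2)
        (U ×ˢ univ) :=
      (hcont.comp continuousOn_fst fun p hp => hp.1).sub continuousOn_snd
    have := hc2.isOpen_inter_preimage (hUo.prod isOpen_univ) isOpen_Ioi (t := Ioi 0)
    convert this using 1
    ext p
    simp
  have hdisj : ((0 : EuclideanSpace ℝ (Fin d)), Real.log (f 0)) ∉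
      {p : EuclideanSpace ℝ (Fin d) × ℝ | p.1 ∈ U ∧ p.2 < Real.log (f p.1)} := by
    rintro ⟨-, h⟩
    exact lt_irrefl _ h
  -- A hyperplane supporting the hypograph of log f at (0, log f(0)). It is not vertical because 0
  -- is interior to the support, and its slope gives the exponent.
  obtain ⟨g, hg⟩ := geometric_hahn_banach_open_point hconc.convex_strict_hypograph hopen hdisj
  set c := g (0, 1) with hc
  have hsplit : ∀ (x : EuclideanSpace ℝ (Fin d)) (t : ℝ), g (x, t) = g (x, 0) + t * c := by
    intro x t
    have : (x, t) = (x, (0 : ℝ)) + t • ((0 : EuclideanSpace ℝ (Fin d)), (1 : ℝ)) := by simp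
    rw [this, map_add, map_smul, smul_eq_mul]
  have hg0 : g ((0 : EuclideanSpace ℝ (Fin d)), (0 : ℝ)) = 0 := map_zero g
  have hcpos : 0 < c := by
    have := hg (0, Real.log (f 0) - 1) ⟨h0, by simp⟩
    rw [hsplit, hsplit 0 (Real.log (f 0)), hg0] at this
    linarith
  have hle : ∀ x ∈ U, g (x, 0) + Real.log (f x) * c ≤ Real.log (f 0) * c := by
    intro x hx
    refine le_of_forall_pos_lt_add fun ε hε => ?_
    have := hg (x, Real.log (f x) - ε / c) ⟨hx, by simp; positivity⟩
    rw [hsplit, hsplit 0 (Real.log (f 0)), hg0, sub_mul, div_mul_cancel₀ _ hcpos.ne'] at this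
    linarith
  refine ⟨-(c⁻¹ • (g.comp (ContinuousLinearMap.inl ℝ _ ℝ))), fun x => ?_⟩
  rcases (hf.nonneg x).eq_or_lt with hx | hx
  · rw [← hx]; positivity
  -- Points of the support outside its interior are reached through their midpoint with 0, which is
  -- in `U`.
  have hhalf : (1 / 2 : ℝ) • (0 : EuclideanSpace ℝ (Fin d)) + (1 / 2 : ℝ) • x ∈ U :=
    (hf.convex_lt 0).combo_interior_self_mem_interior h0 hx (by norm_num) (by norm_num) (by norm_num)
  have h1 := hle _ hhalf
  have h2 := hlogmap 0 x hf0 hx (1 / 2) (1 / 2) (by norm_num) (by norm_num) (by norm_num)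
  have h3 : g ((1 / 2 : ℝ) • (0 : EuclideanSpace ℝ (Fin d)) + (1 / 2 : ℝ) • x, 0) = 1 / 2 * g (x, 0) := by
    rw [← smul_eq_mul, ← map_smul]; simp
  rw [h3] at h1
  have h4 : Real.log (f x) * c ≤ Real.log (f 0) * c - g (x, 0) := by nlinarith
  rw [← Real.log_le_log_iff hx (by positivity), Real.log_mul hf0.ne' (Real.exp_pos _).ne', Real.log_exp]
  have h5 : Real.log (f x) ≤ (Real.log (f 0) * c - g (x, 0)) / c := by rwa [le_div_iff₀ hcpos]
  rw [sub_div, mul_div_cancel_right₀ _ hcpos.ne'] at h5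
  simpa [sub_eq_add_neg, div_eq_inv_mul] using h5

theorem integral_smul_comp (F : EuclideanSpace ℝ (Fin d) → ℝ) (v : EuclideanSpace ℝ (Fin d)) {s : ℝ}
    (hs : 0 < s) : s ^ d * ∫ y, F (v + s • y) = ∫ y, F y := by
  have h := Measure.integral_comp_smul (volume : Measure (EuclideanSpace ℝ (Fin d)))
    (fun y => F (v + y)) s
  rw [h, integral_add_left_eq_self F v, finrank_euclideanSpace_fin, abs_of_pos (by positivity),
    smul_eq_mul, mul_inv_cancel_left₀ (by positivity)]

/-- The value of a log-concave function at its barycenter is at least `e^{-d}` times its supremum. -/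
theorem le_exp_mul_apply_zero (hf : IsLogConcave f) (hm : HasPosMass f) (hc : IsCentered f)
    (x : EuclideanSpace ℝ (Fin d)) : f x ≤ Real.exp d * f 0 := by
  have h0 := hf.zero_mem_interior_support hm hc
  have hf0 : 0 < f 0 := show (0 : EuclideanSpace ℝ (Fin d)) ∈ {x | 0 < f x} from interior_subset h0
  obtain ⟨l, hl⟩ := hf.exists_le_exp h0
  rcases (hf.nonneg x).eq_or_lt with hx | hx
  · rw [← hx]; positivity
  have hint1 : Integrable fun y => l y * f y :=
    hf.integrable_mul_of_norm_le hm 1 (C := ‖l‖) l.continuous fun x => by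
      rw [pow_one]; exact l.le_opNorm x
  -- Integrate f(x)^{1-s} f(y)^s ≤ f((1-s)x + sy) over y. Here f(y)^s = f(y) f(y)^{-(1-s)}, and the
  -- last factor is bounded below by the tangent exponential and e^{-u} ≥ 1 - u. The term linear in
  -- `l` integrates to 0 by centering. Letting s → 1 gives the constant e^d.
  have key : ∀ s : ℝ, 0 < s → s < 1 → s ^ d * (f x / f 0) ^ (1 - s) ≤ 1 := by
    intro s hs hs1
    have hpt : ∀ y, (f x / f 0) ^ (1 - s) * (f y * (1 - (1 - s) * l y)) ≤
        f ((1 - s) • x + s • y) := by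
      intro y
      refine le_trans ?_ (hf.le_map x y (1 - s) s (by linarith) hs.le (by ring))
      rcases (hf.nonneg y).eq_or_lt with hy | hy
      · rw [← hy, zero_mul, mul_zero, Real.zero_rpow hs.ne', mul_zero]
      have h1 : 1 - (1 - s) * l y ≤ Real.exp (-((1 - s) * l y)) := by
        have := Real.add_one_le_exp (-((1 - s) * l y)); linarith
      have h2 : f y ^ (1 - s) ≤ f 0 ^ (1 - s) * Real.exp ((1 - s) * l y) := by
        refine (Real.rpow_le_rpow hy.le (hl y) (by linarith)).trans_eq ?_
        rw [Real.mul_rpow hf0.le (Real.exp_pos _).le, ← Real.exp_mul, mul_comm (l y)]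
      have h3 : f y = f y ^ s * f y ^ (1 - s) := by
        rw [← Real.rpow_add hy]; simp
      rw [Real.div_rpow hx.le hf0.le, div_mul_eq_mul_div, div_le_iff₀ (by positivity)]
      calc f x ^ (1 - s) * (f y * (1 - (1 - s) * l y))
          ≤ f x ^ (1 - s) * (f y * Real.exp (-((1 - s) * l y))) := by gcongr
        _ = f x ^ (1 - s) * (f y ^ s * f y ^ (1 - s) * Real.exp (-((1 - s) * l y))) := by rw [← h3]
        _ ≤ f x ^ (1 - s) * (f y ^ s * (f 0 ^ (1 - s) * Real.exp ((1 - s) * l y)) *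
              Real.exp (-((1 - s) * l y))) := by gcongr
        _ = f x ^ (1 - s) * f y ^ s * f 0 ^ (1 - s) *
              (Real.exp ((1 - s) * l y) * Real.exp (-((1 - s) * l y))) := by ring
        _ = _ := by rw [← Real.exp_add, add_neg_cancel, Real.exp_zero, mul_one]
    have hI2 : Integrable fun y => f ((1 - s) • x + s • y) :=
      (hm.1.comp_add_left ((1 - s) • x)).comp_smul hs.ne'
    have heq : (fun y => (f x / f 0) ^ (1 - s) * (f y * (1 - (1 - s) * l y))) =
        fun y => (f x / f 0) ^ (1 - s) * (f y - (1 - s) * (l y * f y)) := by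
      ext y; ring
    have hI1 : Integrable fun y => (f x / f 0) ^ (1 - s) * (f y * (1 - (1 - s) * l y)) := by
      rw [heq]
      exact (hm.1.sub (hint1.const_mul _)).const_mul _
    have h4 := integral_mono hI1 hI2 hpt
    rw [heq, integral_const_mul, integral_sub hm.1 (hint1.const_mul _), integral_const_mul,
      hf.integral_linear_mul hm l, show ∫ x, f x • x = 0 from hc, map_zero, mul_zero, sub_zero] at h4
    have h5 := integral_smul_comp f ((1 - s) • x) hs
    have h6 : s ^ d * ((f x / f 0) ^ (1 - s) * ∫ y, f y) ≤ 1 * ∫ y, f y := by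
      rw [one_mul]; nth_rewrite 2 [← h5]; gcongr
    rw [← mul_assoc] at h6
    exact le_of_mul_le_mul_right h6 hm.2
  have hq : 0 < f x / f 0 := by positivity
  have key2 : ∀ s : ℝ, 0 < s → s < 1 → Real.log (f x / f 0) ≤ d / s := by
    intro s hs hs1
    have h := Real.log_le_log (by positivity) (key s hs hs1)
    rw [Real.log_mul (by positivity) (by positivity), Real.log_rpow hq, Real.log_pow, Real.log_one] at h
    have h2 : 1 - s⁻¹ ≤ Real.log s := Real.one_sub_inv_le_log_of_pos hs
    have h3 : (1 - s) * Real.log (f x / f 0) ≤ (1 - s) * (d / s) := by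
      have : (d : ℝ) * (1 - s⁻¹) ≤ d * Real.log s := by gcongr
      have h4 : (1 - s) * ((d : ℝ) / s) = - (d * (1 - s⁻¹)) := by field_simp; ring
      rw [h4]; linarith
    exact le_of_mul_le_mul_left h3 (by linarith)
  have hlim : Real.log (f x / f 0) ≤ d := by
    have ht : Filter.Tendsto (fun s : ℝ => (d : ℝ) / s) (nhdsWithin 1 (Iio 1)) (nhds d) := by
      have : ContinuousAt (fun s : ℝ => (d : ℝ) / s) 1 :=
        continuousAt_const.div continuousAt_id one_ne_zero
      have h2 := this.tendsto.mono_left (nhdsWithin_le_nhds (s := Iio 1))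
      simpa using h2
    refine ge_of_tendsto ht ?_
    filter_upwards [Ioo_mem_nhdsLT (show (0 : ℝ) < 1 by norm_num)] with s hs
    exact key2 s hs.1 hs.2
  rw [Real.log_le_iff_le_exp hq, div_le_iff₀ hf0] at hlim
  exact hlim

end IsLogConcave

/-! ### Ray moments and inclusions between consecutive Ball bodies. -/

/-- The `n`-th moment of `f` along the ray through `x`. -/
noncomputable def rayMoment {d : ℕ} (f : EuclideanSpace ℝ (Fin d) → ℝ) (n : ℕ)
    (x : EuclideanSpace ℝ (Fin d)) : ℝ :=
  ∫ r in Ioi (0 : ℝ), n * r ^ (n - 1) * f (r • x)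

theorem integrableOn_pow_mul_exp_neg (k : ℕ) {b : ℝ} (hb : 0 < b) :
    IntegrableOn (fun r : ℝ => r ^ k * Real.exp (-(b * r))) (Ioi 0) := by
  have h := integrableOn_rpow_mul_exp_neg_mul_rpow (p := 1) (s := k) (b := b)
    (by have : (0 : ℝ) ≤ k := by positivity
        linarith) one_pos hb
  simpa using h

theorem integral_pow_mul_exp_neg (k : ℕ) {b : ℝ} (hb : 0 < b) :
    ∫ r in Ioi (0 : ℝ), r ^ k * Real.exp (-(b * r)) = k.factorial / b ^ (k + 1) := by
  have h := Real.integral_rpow_mul_exp_neg_mul_Ioi (a := (k : ℝ) + 1) (r := b) (by positivity) hb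
  rw [add_sub_cancel_right, Real.Gamma_nat_eq_factorial] at h
  have h2 : (1 / b) ^ ((k : ℝ) + 1) = (1 / b) ^ (k + 1) := by
    exact_mod_cast Real.rpow_natCast (1 / b) (k + 1)
  rw [h2] at h
  simp only [Real.rpow_natCast] at h
  rw [h, one_div, inv_pow, mul_comm, ← div_eq_mul_inv]

/-- `k_n = (n!)^{1/n} / ((n+1)!)^{1/(n+1)}`. -/
noncomputable def borellConst (n : ℕ) : ℝ :=
  (n.factorial : ℝ) ^ ((n : ℝ)⁻¹) / ((n + 1).factorial : ℝ) ^ (((n + 1 : ℕ) : ℝ)⁻¹)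

theorem borellConst_pos (n : ℕ) : 0 < borellConst n := by
  unfold borellConst; positivity

namespace IsLogConcave

variable {d : ℕ} {f : EuclideanSpace ℝ (Fin d) → ℝ} {x : EuclideanSpace ℝ (Fin d)}

theorem integrableOn_ray (hf : IsLogConcave f) (hm : HasPosMass f) (hx : x ≠ 0) (k : ℕ) :
    IntegrableOn (fun r : ℝ => r ^ k * f (r • x)) (Ioi 0) := by
  obtain ⟨A, B, hA, hB, h⟩ := hf.exists_exp_decay hm
  have hx' : 0 < ‖x‖ := norm_pos_iff.2 hx
  refine ((integrableOn_pow_mul_exp_neg k (mul_pos hB hx')).const_mul A).mono'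
    (((measurable_id.pow_const k).mul (hf.measurable_ray x)).aestronglyMeasurable) ?_
  filter_upwards [ae_restrict_mem measurableSet_Ioi] with r hr
  have hr' : (0 : ℝ) < r := hr
  have h1 := h (r • x)
  rw [norm_smul, Real.norm_of_nonneg hr'.le] at h1
  rw [norm_mul, Real.norm_of_nonneg (pow_nonneg hr'.le k), Real.norm_of_nonneg (hf.nonneg _)]
  calc r ^ k * f (r • x) ≤ r ^ k * (A * Real.exp (-(B * (r * ‖x‖)))) := by gcongr
    _ = A * (r ^ k * Real.exp (-(B * ‖x‖ * r))) := by
      rw [show B * (r * ‖x‖) = B * ‖x‖ * r by ring]; ring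

theorem integrableOn_rayMoment (hf : IsLogConcave f) (hm : HasPosMass f) (hx : x ≠ 0) (n : ℕ) :
    IntegrableOn (fun r : ℝ => n * r ^ (n - 1) * f (r • x)) (Ioi 0) := by
  simp_rw [mul_assoc]
  exact (hf.integrableOn_ray hm hx (n - 1)).const_mul _

theorem rayMoment_eq (f : EuclideanSpace ℝ (Fin d) → ℝ) (n : ℕ) (x : EuclideanSpace ℝ (Fin d)) :
    rayMoment f n x = n * ∫ r in Ioi (0 : ℝ), r ^ (n - 1) * f (r • x) := by
  unfold rayMoment
  simp_rw [mul_assoc]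
  rw [integral_const_mul]

theorem rayMoment_nonneg (hf : IsLogConcave f) (n : ℕ) (x : EuclideanSpace ℝ (Fin d)) :
    0 ≤ rayMoment f n x := by
  refine setIntegral_nonneg measurableSet_Ioi fun r hr => ?_
  have hr' : (0 : ℝ) < r := hr
  exact mul_nonneg (by positivity) (hf.nonneg _)

theorem rayMoment_smul (f : EuclideanSpace ℝ (Fin d) → ℝ) {n : ℕ} (hn : n ≠ 0)
    (x : EuclideanSpace ℝ (Fin d)) {c : ℝ} (hc : 0 < c) :
    rayMoment f n (c • x) = rayMoment f n x / c ^ n := by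
  have h := integral_comp_mul_left_Ioi (fun r : ℝ => n * r ^ (n - 1) * f (r • x)) 0 hc
  rw [mul_zero] at h
  have h2 : ∀ r : ℝ, (n : ℝ) * (c * r) ^ (n - 1) * f ((c * r) • x) =
      c ^ (n - 1) * (n * r ^ (n - 1) * f (r • c • x)) := by
    intro r
    rw [smul_smul, mul_comm r c, mul_pow]; ring
  simp_rw [h2] at h
  rw [integral_const_mul] at h
  change c ^ (n - 1) * rayMoment f n (c • x) = c⁻¹ • rayMoment f n x at h
  rw [smul_eq_mul] at h
  obtain ⟨m, rfl⟩ := Nat.exists_eq_succ_of_ne_zero hn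
  rw [Nat.succ_eq_add_one, Nat.add_sub_cancel] at h
  rw [eq_div_iff (by positivity), Nat.succ_eq_add_one, pow_succ, ← mul_assoc,
    mul_comm (rayMoment _ _ _), h]
  field_simp

/-- Away from the origin the moment is finite, so the `[0, ∞]`-valued integral can be traded for a
real one. -/
theorem mem_ballBody_iff (hf : IsLogConcave f) (hm : HasPosMass f) {n : ℕ} (hn : n ≠ 0) (hx : x ≠ 0) :
    x ∈ ballBody (n : ℝ) f ↔ f 0 ≤ rayMoment f n x := by
  have hcongr : ∫⁻ r in Ioi (0 : ℝ), ENNReal.ofReal (n * r ^ ((n : ℝ) - 1) * f (r • x)) =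
      ENNReal.ofReal (rayMoment f n x) := by
    unfold rayMoment
    rw [ofReal_integral_eq_lintegral_ofReal (hf.integrableOn_rayMoment hm hx n)]
    · refine setLIntegral_congr_fun measurableSet_Ioi fun r hr => ?_
      obtain ⟨m, rfl⟩ := Nat.exists_eq_succ_of_ne_zero hn
      simp
    · filter_upwards [ae_restrict_mem measurableSet_Ioi] with r hr
      have hr' : (0 : ℝ) < r := hr
      exact mul_nonneg (by positivity) (hf.nonneg _)
  unfold ballBody
  rw [mem_ofPred_eq, hcongr, ENNReal.ofReal_le_ofReal_iff (hf.rayMoment_nonneg n x)]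

/-- On the degenerate ray the integrand is n r^{n-1} f(0), at least f(0) for r > 1, so the integral
is infinite. -/
theorem zero_mem_ballBody {n : ℕ} (hn : n ≠ 0) (hf0 : 0 < f 0) :
    (0 : EuclideanSpace ℝ (Fin d)) ∈ ballBody (n : ℝ) f := by
  unfold ballBody
  rw [mem_ofPred_eq]
  obtain ⟨m, rfl⟩ := Nat.exists_eq_succ_of_ne_zero hn
  have : ∫⁻ r in Ioi (1 : ℝ), ENNReal.ofReal (f 0) ≤ ∫⁻ r in Ioi (0 : ℝ),
      ENNReal.ofReal (((m.succ : ℕ) : ℝ) * r ^ (((m.succ : ℕ) : ℝ) - 1) * f (r • 0)) := by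
    refine (setLIntegral_mono' measurableSet_Ioi fun r hr => ?_).trans
      (lintegral_mono_set (Ioi_subset_Ioi zero_le_one))
    have hr' : (1 : ℝ) < r := hr
    apply ENNReal.ofReal_le_ofReal
    rw [smul_zero]
    have h1 : (1 : ℝ) ≤ r ^ m := one_le_pow₀ hr'.le
    have h2 : (((m.succ : ℕ) : ℝ) - 1) = m := by push_cast; ring
    rw [h2, Real.rpow_natCast]
    have h3 : (1 : ℝ) ≤ ((m.succ : ℕ) : ℝ) := by push_cast; linarith [Nat.cast_nonneg (α := ℝ) m]
    nlinarith [mul_le_mul h3 h1 zero_le_one (by positivity)]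
  refine le_trans ?_ this
  rw [setLIntegral_const, Real.volume_Ioi, ENNReal.mul_top (by simpa using hf0)]
  exact le_top

/-- Bathtub principle: in the integral of (r - R) r^{n-1} f(rx), replace f by M on (0, R], where r -
R ≤ 0, and discard the nonnegative part beyond R. -/
theorem rayMoment_succ_ge (hf : IsLogConcave f) (hm : HasPosMass f) (hx : x ≠ 0) {n : ℕ} (hn : n ≠ 0)
    {M R : ℝ} (hM : ∀ y, f y ≤ M) (hR : 0 < R) :
    R * (rayMoment f n x / n) - M * (R ^ (n + 1) / (n * (n + 1))) ≤
      rayMoment f (n + 1) x / ((n : ℝ) + 1) := by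
  obtain ⟨m, rfl⟩ := Nat.exists_eq_succ_of_ne_zero hn
  rw [rayMoment_eq, rayMoment_eq, Nat.succ_eq_add_one, Nat.add_sub_cancel, Nat.add_sub_cancel]
  have e1 : (((m + 1 : ℕ) : ℝ) * ∫ r in Ioi (0 : ℝ), r ^ m * f (r • x)) / ((m + 1 : ℕ) : ℝ) =
      ∫ r in Ioi (0 : ℝ), r ^ m * f (r • x) := by field_simp
  have e2 : (((m + 1 + 1 : ℕ) : ℝ) * ∫ r in Ioi (0 : ℝ), r ^ (m + 1) * f (r • x)) / (((m + 1 : ℕ) : ℝ) + 1) =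
      ∫ r in Ioi (0 : ℝ), r ^ (m + 1) * f (r • x) := by push_cast; field_simp
  rw [e1, e2]
  have i0 := hf.integrableOn_ray hm hx m
  have i1 := hf.integrableOn_ray hm hx (m + 1)
  have hI : IntegrableOn (fun r : ℝ => (r - R) * (r ^ m * f (r • x))) (Ioi 0) := by
    refine (i1.sub (i0.const_mul R)).congr (Filter.Eventually.of_forall fun r => ?_)
    simp only [Pi.sub_apply]; ring
  have h1 : ∫ r in Ioi (0 : ℝ), (r - R) * (r ^ m * f (r • x)) =
      (∫ r in Ioi (0 : ℝ), r ^ (m + 1) * f (r • x)) - R * ∫ r in Ioi (0 : ℝ), r ^ m * f (r • x) := by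
    rw [← integral_const_mul, ← integral_sub i1 (i0.const_mul R)]
    congr 1; ext r; ring
  have h2 : ∫ r in (0 : ℝ)..R, M * ((r - R) * r ^ m) = - (M * (R ^ (m + 1 + 1) / (((m + 1 : ℕ) : ℝ) * (((m + 1 : ℕ) : ℝ) + 1)))) := by
    have : ∀ r : ℝ, (r - R) * r ^ m = r ^ (m + 1) - R * r ^ m := fun r => by ring
    simp_rw [this]
    rw [intervalIntegral.integral_const_mul, intervalIntegral.integral_sub (by simp) (by simp),
      intervalIntegral.integral_const_mul, integral_pow, integral_pow]
    push_cast
    field_simp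
    ring
  have h3 : ∫ r in Ioc (0 : ℝ) R, M * ((r - R) * r ^ m) ≤ ∫ r in Ioi (0 : ℝ), (r - R) * (r ^ m * f (r • x)) := by
    have hsplit : Ioi (0 : ℝ) = Ioc 0 R ∪ Ioi R := (Ioc_union_Ioi_eq_Ioi hR.le).symm
    rw [hsplit, setIntegral_union (Ioc_disjoint_Ioi le_rfl) measurableSet_Ioi
      (hI.mono_set Ioc_subset_Ioi_self) (hI.mono_set (Ioi_subset_Ioi hR.le))]
    have hpos : 0 ≤ ∫ r in Ioi R, (r - R) * (r ^ m * f (r • x)) := by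
      refine setIntegral_nonneg measurableSet_Ioi fun r hr => ?_
      have hr' : R < r := hr
      have : 0 < r := hR.trans hr'
      exact mul_nonneg (by linarith) (mul_nonneg (by positivity) (hf.nonneg _))
    have hle : ∫ r in Ioc (0 : ℝ) R, M * ((r - R) * r ^ m) ≤ ∫ r in Ioc (0 : ℝ) R, (r - R) * (r ^ m * f (r • x)) := by
      refine setIntegral_mono_on ?_ (hI.mono_set Ioc_subset_Ioi_self) measurableSet_Ioc fun r hr => ?_
      · exact (Continuous.integrableOn_Icc (by fun_prop)).mono_set Ioc_subset_Icc_self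
      · have h5 := mul_le_mul_of_nonneg_left (hM (r • x))
          (mul_nonneg (sub_nonneg.2 hr.2) (pow_nonneg hr.1.le m))
        nlinarith
    linarith
  rw [← intervalIntegral.integral_of_le hR.le, h2, h1] at h3
  linarith

/-- Along the ray log f is concave and meets the line log f(0) - a r at r = 0, so the set where it
lies above the line is an initial interval. -/
theorem exp_neg_le_ray (hf : IsLogConcave f) (hf0 : 0 < f 0) {a r r' : ℝ}
    (hr : 0 ≤ r) (hrr : r ≤ r') (h : f 0 * Real.exp (-(a * r')) ≤ f (r' • x)) :
    f 0 * Real.exp (-(a * r)) ≤ f (r • x) := by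
  rcases hr.eq_or_lt with rfl | hr
  · simp
  have hr' : 0 < r' := hr.trans_le hrr
  set t := r / r' with ht
  have ht0 : 0 < t := by positivity
  have ht1 : t ≤ 1 := (div_le_one hr').2 hrr
  have h1 := hf.le_map 0 (r' • x) (1 - t) t (by linarith) ht0.le (by ring)
  have h2 : t * r' = r := by rw [ht]; field_simp
  rw [smul_zero, zero_add, smul_smul, h2] at h1
  refine le_trans ?_ h1
  have h3 := Real.rpow_le_rpow (by positivity) h ht0.le
  rw [Real.mul_rpow hf0.le (Real.exp_pos _).le, ← Real.exp_mul] at h3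
  have h4 : -(a * r') * t = -(a * r) := by rw [← h2]; ring
  rw [h4] at h3
  calc f 0 * Real.exp (-(a * r)) = f 0 ^ (1 - t) * (f 0 ^ t * Real.exp (-(a * r))) := by
        rw [← mul_assoc, ← Real.rpow_add hf0]; simp
    _ ≤ _ := by gcongr

/-- Comparison of consecutive moments of a log-concave function with those of an exponential. -/
theorem rayMoment_succ_le (hf : IsLogConcave f) (hm : HasPosMass f) (hf0 : 0 < f 0) (hx : x ≠ 0)
    {n : ℕ} (hn : n ≠ 0) {a : ℝ} (ha : 0 < a) (h : rayMoment f n x = f 0 * (n.factorial / a ^ n)) :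
    rayMoment f (n + 1) x ≤ f 0 * ((n + 1).factorial / a ^ (n + 1)) := by
  obtain ⟨m, rfl⟩ := Nat.exists_eq_succ_of_ne_zero hn
  rw [rayMoment_eq, Nat.succ_eq_add_one, Nat.add_sub_cancel] at h ⊢
  have i0 := hf.integrableOn_ray hm hx m
  have i1 := hf.integrableOn_ray hm hx (m + 1)
  have j0 := (integrableOn_pow_mul_exp_neg m ha).const_mul (f 0)
  have j1 := (integrableOn_pow_mul_exp_neg (m + 1) ha).const_mul (f 0)
  set D : ℝ → ℝ := fun r => f (r • x) - f 0 * Real.exp (-(a * r)) with hD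
  have k0 : IntegrableOn (fun r => r ^ m * D r) (Ioi 0) := by
    refine (i0.sub j0).congr (Filter.Eventually.of_forall fun r => ?_)
    simp only [Pi.sub_apply, hD]; ring
  have k1 : IntegrableOn (fun r => r ^ (m + 1) * D r) (Ioi 0) := by
    refine (i1.sub j1).congr (Filter.Eventually.of_forall fun r => ?_)
    simp only [Pi.sub_apply, hD]; ring
  have e0 : ∫ r in Ioi (0 : ℝ), r ^ m * D r = 0 := by
    have : ∫ r in Ioi (0 : ℝ), r ^ m * D r = (∫ r in Ioi (0 : ℝ), r ^ m * f (r • x)) -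
        f 0 * (m.factorial / a ^ (m + 1)) := by
      rw [← integral_pow_mul_exp_neg m ha, ← integral_const_mul, ← integral_sub i0 j0]
      congr 1; ext r; simp only [hD]; ring
    rw [this, sub_eq_zero]
    have hm1 : ((m + 1 : ℕ) : ℝ) ≠ 0 := by positivity
    apply mul_left_cancel₀ hm1
    rw [h, Nat.factorial_succ]
    push_cast; ring
  have e1 : ∫ r in Ioi (0 : ℝ), r ^ (m + 1) * D r = (∫ r in Ioi (0 : ℝ), r ^ (m + 1) * f (r • x)) -
        f 0 * ((m + 1).factorial / a ^ (m + 1 + 1)) := by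
    rw [← integral_pow_mul_exp_neg (m + 1) ha, ← integral_const_mul, ← integral_sub i1 j1]
    congr 1; ext r; simp only [hD]; ring
  -- Either `D` is nonnegative, hence zero a.e. by `e0`, or it changes sign once, from plus to
  -- minus, at `r₀`. Then (r - r₀) D(r) ≤ 0, and the `r₀` term integrates to 0 against r^m by `e0`.
  have hmain : ∫ r in Ioi (0 : ℝ), r ^ (m + 1) * D r ≤ 0 := by
    by_cases hall : ∀ r, 0 < r → 0 ≤ D r
    · have hz : (fun r => r ^ m * D r) =ᵐ[volume.restrict (Ioi 0)] 0 := by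
        refine (setIntegral_eq_zero_iff_of_nonneg_ae ?_ k0).1 e0
        filter_upwards [ae_restrict_mem measurableSet_Ioi] with r hr
        exact mul_nonneg (pow_nonneg (le_of_lt hr) m) (hall r hr)
      refine le_of_eq (integral_eq_zero_of_ae ?_)
      filter_upwards [hz] with r hr
      rw [pow_succ, mul_right_comm, hr]; simp
    · push Not at hall
      obtain ⟨r₁, hr₁, hD₁⟩ := hall
      set T : Set ℝ := {r | 0 ≤ r ∧ 0 ≤ D r} with hT
      have hmono : ∀ r r', 0 ≤ r → r ≤ r' → 0 ≤ D r' → 0 ≤ D r := by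
        intro r r' hr hrr h'
        exact sub_nonneg.2 (hf.exp_neg_le_ray hf0 hr hrr (sub_nonneg.1 h'))
      have hbdd : BddAbove T := by
        refine ⟨r₁, fun r hr => ?_⟩
        by_contra! hlt
        exact absurd (hmono r₁ r hr₁.le hlt.le hr.2) hD₁.not_ge
      have hne : T.Nonempty := ⟨0, le_rfl, by simp [hD]⟩
      set r₀ := sSup T with hr₀
      have hsign : ∀ r, 0 < r → (r - r₀) * D r ≤ 0 := by
        intro r hr
        rcases lt_trichotomy r r₀ with h' | h' | h'
        · obtain ⟨r', hr', hlt⟩ := exists_lt_of_lt_csSup hne h'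
          exact mul_nonpos_of_nonpos_of_nonneg (by linarith) (hmono r r' hr.le hlt.le hr'.2)
        · rw [h']; simp
        · refine mul_nonpos_of_nonneg_of_nonpos (by linarith) ?_
          by_contra! hpos
          exact absurd (le_csSup hbdd (show r ∈ T from ⟨hr.le, hpos.le⟩)) h'.not_ge
      have : ∫ r in Ioi (0 : ℝ), (r ^ (m + 1) * D r - r₀ * (r ^ m * D r)) ≤ 0 := by
        refine setIntegral_nonpos measurableSet_Ioi fun r hr => ?_
        have h5 := mul_nonpos_of_nonneg_of_nonpos (pow_nonneg (le_of_lt hr) m) (hsign r hr)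
        have h6 : r ^ (m + 1) * D r - r₀ * (r ^ m * D r) = r ^ m * ((r - r₀) * D r) := by ring
        rw [h6]; exact h5
      rw [integral_sub k1 (k0.const_mul r₀), integral_const_mul, e0] at this
      linarith
  rw [e1] at hmain
  rw [Nat.factorial_succ (m + 1)]
  have hm2 : (0 : ℝ) ≤ ((m + 1 + 1 : ℕ) : ℝ) := by positivity
  have := mul_le_mul_of_nonneg_left (sub_nonpos.1 hmain) hm2
  refine this.trans_eq ?_
  push_cast
  ring

theorem rayMoment_pos_of_succ (hf : IsLogConcave f) (hm : HasPosMass f) (hx : x ≠ 0) {n : ℕ}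
    (hn : n ≠ 0) (h : 0 < rayMoment f (n + 1) x) : 0 < rayMoment f n x := by
  refine (hf.rayMoment_nonneg n x).lt_of_ne fun h0 => h.ne' ?_
  obtain ⟨m, rfl⟩ := Nat.exists_eq_succ_of_ne_zero hn
  rw [rayMoment_eq, Nat.succ_eq_add_one, Nat.add_sub_cancel] at h0 ⊢
  have hz : ∫ r in Ioi (0 : ℝ), r ^ m * f (r • x) = 0 := by
    rcases mul_eq_zero.1 h0.symm with h1 | h1
    · exact absurd h1 (by positivity)
    · exact h1
  have hae := (setIntegral_eq_zero_iff_of_nonneg_ae (by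
    filter_upwards [ae_restrict_mem measurableSet_Ioi] with r hr
    exact mul_nonneg (pow_nonneg (le_of_lt hr) m) (hf.nonneg _)) (hf.integrableOn_ray hm hx m)).1 hz
  refine mul_eq_zero_of_right _ (integral_eq_zero_of_ae ?_)
  filter_upwards [hae] with r hr
  rw [pow_succ, mul_right_comm, hr]; simp

/-- Choose the rate a for which f(0) e^{-ar} has the same n-th moment. The assumption on the next
moment forces a^{n+1} ≤ (n+1)!, and the n-th moment f(0) n!/a^n is then bounded below. -/
theorem borellConst_pow_mul_le (hf : IsLogConcave f) (hm : HasPosMass f) (hf0 : 0 < f 0) (hx : x ≠ 0)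
    {n : ℕ} (hn : n ≠ 0) (h : f 0 ≤ rayMoment f (n + 1) x) :
    borellConst n ^ n * f 0 ≤ rayMoment f n x := by
  have hI := hf.rayMoment_pos_of_succ hm hx hn (hf0.trans_le h)
  set I := rayMoment f n x with hIdef
  have hn' : (n : ℝ) ≠ 0 := by exact_mod_cast hn
  set a : ℝ := (n.factorial * f 0 / I) ^ ((n : ℝ)⁻¹) with ha
  have ha0 : 0 < a := by positivity
  have han : a ^ n = n.factorial * f 0 / I := by
    rw [ha]; exact Real.rpow_inv_natCast_pow (by positivity) hn
  have h1 := hf.rayMoment_succ_le hm hf0 hx hn ha0 (by rw [han, ← hIdef]; field_simp)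
  have h2 : a ^ (n + 1) ≤ (n + 1).factorial := by
    have h3 := h.trans h1
    rw [mul_div_assoc', le_div_iff₀ (by positivity)] at h3
    exact le_of_mul_le_mul_left h3 hf0
  set b : ℝ := ((n + 1).factorial : ℝ) ^ (((n + 1 : ℕ) : ℝ)⁻¹) with hb
  have hb0 : 0 < b := by positivity
  have hbn : b ^ (n + 1) = (n + 1).factorial := Real.rpow_inv_natCast_pow (by positivity) (by simp)
  have hab : a ≤ b := by
    rw [← hbn] at h2
    exact le_of_pow_le_pow_left₀ (by simp) hb0.le h2
  have hk : borellConst n ^ n = n.factorial / b ^ n := by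
    unfold borellConst
    rw [div_pow, Real.rpow_inv_natCast_pow (by positivity) hn]
  rw [hk, div_mul_eq_mul_div, div_le_iff₀ (by positivity)]
  calc n.factorial * f 0 = I * a ^ n := by rw [han]; field_simp
    _ ≤ I * b ^ n := by gcongr

end IsLogConcave

/-- After raising to the power n(n+1) this is (n+1)^n ≤ 2^{n(n+1)} n!, a consequence of n + 1 ≤
2^{n+1}. -/
theorem half_le_borellConst {n : ℕ} (hn : n ≠ 0) : 1 / 2 ≤ borellConst n := by
  unfold borellConst
  set a : ℝ := (n.factorial : ℝ) ^ ((n : ℝ)⁻¹) with ha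
  set b : ℝ := ((n + 1).factorial : ℝ) ^ (((n + 1 : ℕ) : ℝ)⁻¹) with hb
  have ha0 : 0 < a := by positivity
  have hb0 : 0 < b := by positivity
  have han : a ^ n = n.factorial := Real.rpow_inv_natCast_pow (by positivity) hn
  have hbn : b ^ (n + 1) = (n + 1).factorial := Real.rpow_inv_natCast_pow (by positivity) (by simp)
  rw [div_le_div_iff₀ (by norm_num) hb0, one_mul]
  have hnn : n * (n + 1) ≠ 0 := by positivity
  refine le_of_pow_le_pow_left₀ hnn (by positivity) ?_
  rw [mul_comm n, pow_mul b, hbn, mul_comm (n + 1), pow_mul, mul_pow a 2, han]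
  have h1 : ((n + 1).factorial : ℝ) = (n + 1) * n.factorial := by
    rw [Nat.factorial_succ]; push_cast; ring
  have h2 : ((n : ℝ) + 1) ≤ 2 ^ (n + 1) := by
    have : n + 1 ≤ 2 ^ (n + 1) := Nat.lt_two_pow_self.le
    exact_mod_cast this
  have h3 : (1 : ℝ) ≤ n.factorial := by exact_mod_cast Nat.one_le_iff_ne_zero.2 (Nat.factorial_ne_zero n)
  have h4 : ((2 : ℝ) ^ (n + 1)) ^ n = (2 ^ n) ^ (n + 1) := by rw [← pow_mul, ← pow_mul, mul_comm]
  calc ((n + 1).factorial : ℝ) ^ n = (n + 1) ^ n * n.factorial ^ n := by rw [h1, mul_pow]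
    _ ≤ (2 ^ (n + 1)) ^ n * n.factorial ^ n := by gcongr
    _ ≤ (2 ^ (n + 1)) ^ n * n.factorial ^ (n + 1) := by
        refine mul_le_mul_of_nonneg_left ?_ (by positivity)
        exact pow_le_pow_right₀ h3 n.le_succ
    _ = (n.factorial * 2 ^ n) ^ (n + 1) := by rw [h4, mul_pow]; ring

namespace IsLogConcave

variable {d : ℕ} {f : EuclideanSpace ℝ (Fin d) → ℝ}

theorem apply_zero_pos (hf : IsLogConcave f) (hm : HasPosMass f) (hc : IsCentered f) : 0 < f 0 :=
  show (0 : EuclideanSpace ℝ (Fin d)) ∈ {x | 0 < f x} from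
    interior_subset (hf.zero_mem_interior_support hm hc)

theorem smul_ballBody_subset (hf : IsLogConcave f) (hm : HasPosMass f) (hf0 : 0 < f 0) {n : ℕ}
    (hn : n ≠ 0) {k : ℝ} (hk : 0 < k) (hkn : k ≤ borellConst n) :
    k • ballBody ((n + 1 : ℕ) : ℝ) f ⊆ ballBody (n : ℝ) f := by
  rintro _ ⟨x, hx, rfl⟩
  change k • x ∈ _
  rcases eq_or_ne x 0 with rfl | hx0
  · rw [smul_zero]; exact zero_mem_ballBody hn hf0
  rw [hf.mem_ballBody_iff hm (by simp) hx0] at hx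
  rw [hf.mem_ballBody_iff hm hn (smul_ne_zero hk.ne' hx0), rayMoment_smul f hn x hk,
    le_div_iff₀ (by positivity)]
  refine le_trans ?_ (hf.borellConst_pow_mul_le hm hf0 hx0 hn hx)
  rw [mul_comm]
  gcongr

/-- Use the bathtub bound with M = e^d f(0), where centering enters. The choice R = e^{-d/n} makes M
R^n = f(0), so the next moment is at least f(0) R, and `d ≤ n` gives R ≥ e⁻¹. -/
theorem ballBody_subset_smul (hf : IsLogConcave f) (hm : HasPosMass f) (hc : IsCentered f) {n : ℕ}
    (hn : n ≠ 0) (hdn : d ≤ n) :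
    ballBody (n : ℝ) f ⊆ Real.exp 1 • ballBody ((n + 1 : ℕ) : ℝ) f := by
  have hf0 := hf.apply_zero_pos hm hc
  intro x hx
  rw [mem_smul_set_iff_inv_smul_mem₀ (Real.exp_pos 1).ne']
  rcases eq_or_ne x 0 with rfl | hx0
  · rw [smul_zero]; exact zero_mem_ballBody (by simp) hf0
  rw [hf.mem_ballBody_iff hm hn hx0] at hx
  rw [hf.mem_ballBody_iff hm (by simp) (smul_ne_zero (inv_ne_zero (Real.exp_pos 1).ne') hx0),
    rayMoment_smul f (by simp) x (inv_pos.2 (Real.exp_pos 1)), le_div_iff₀ (by positivity)]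
  have hn0 : (0 : ℝ) < n := by positivity
  set R : ℝ := Real.exp (-(d / n)) with hR
  have h := hf.rayMoment_succ_ge hm hx0 hn (hf.le_exp_mul_apply_zero hm hc) (Real.exp_pos (-(d / n) : ℝ))
  rw [← hR] at h
  have hRn : Real.exp d * R ^ n = 1 := by
    rw [hR, ← Real.exp_nat_mul, ← Real.exp_add, Real.exp_eq_one_iff]; field_simp; ring
  have h2 : Real.exp d * f 0 * (R ^ (n + 1) / (n * (n + 1))) = f 0 * R / (n * (n + 1)) := by
    rw [pow_succ]
    calc _ = (Real.exp d * R ^ n) * (f 0 * R / (n * (n + 1))) := by ring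
      _ = _ := by rw [hRn, one_mul]
  rw [h2] at h
  have h3 : R * (f 0 / n) ≤ R * (rayMoment f n x / n) := by gcongr
  have h4 : f 0 * R ≤ rayMoment f (n + 1) x := by
    have h5 : R * (f 0 / n) - f 0 * R / (n * (n + 1)) = f 0 * R / (n + 1) := by
      field_simp; ring
    have h6 : f 0 * R / ((n : ℝ) + 1) ≤ rayMoment f (n + 1) x / ((n : ℝ) + 1) := by linarith
    exact (div_le_div_iff_of_pos_right (by positivity)).1 h6
  refine le_trans ?_ h4
  gcongr
  rw [hR, ← Real.exp_neg, ← Real.exp_nat_mul]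
  apply Real.exp_le_exp.2
  have : (d : ℝ) / n ≤ 1 := by rw [div_le_one hn0]; exact_mod_cast hdn
  have h7 : (0 : ℝ) ≤ n := hn0.le
  push_cast
  linarith

end IsLogConcave

theorem areBallBodyConstants_half_exp : AreBallBodyConstants (1 / 2) (Real.exp 1) := by
  refine ⟨by norm_num, by have := Real.add_one_le_exp (1 : ℝ); linarith, fun d hd f hf hm hc => ?_⟩
  have hf0 := hf.apply_zero_pos hm hc
  have hd0 : d ≠ 0 := by omega
  have e1 : (d : ℝ) + 1 = ((d + 1 : ℕ) : ℝ) := by push_cast; ring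
  have e2 : (d : ℝ) + 2 = ((d + 1 + 1 : ℕ) : ℝ) := by push_cast; ring
  rw [e1, e2]
  exact ⟨⟨hf.smul_ballBody_subset hm hf0 hd0 (by norm_num) (half_le_borellConst hd0),
      hf.ballBody_subset_smul hm hc hd0 le_rfl⟩,
    ⟨hf.smul_ballBody_subset hm hf0 (by simp) (by norm_num) (half_le_borellConst (by simp)),
      hf.ballBody_subset_smul hm hc (by simp) (by simp)⟩⟩

/-! ### The exponential of minus the norm as a test function. -/

section ExpNorm

variable (d : ℕ)

theorem isLogConcave_exp_neg_norm :
    IsLogConcave fun x : EuclideanSpace ℝ (Fin d) => Real.exp (-‖x‖) := by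
  refine ⟨fun x => (Real.exp_pos _).le, fun x y a b ha hb hab => ?_⟩
  rw [← Real.exp_mul, ← Real.exp_mul, ← Real.exp_add]
  apply Real.exp_le_exp.2
  have := norm_add_le (a • x) (b • y)
  rw [norm_smul, norm_smul, Real.norm_of_nonneg ha, Real.norm_of_nonneg hb] at this
  linarith

theorem hasPosMass_exp_neg_norm :
    HasPosMass fun x : EuclideanSpace ℝ (Fin d) => Real.exp (-‖x‖) := by
  have hint : Integrable fun x : EuclideanSpace ℝ (Fin d) => Real.exp (-‖x‖) := by
    have h0 : Integrable fun x : EuclideanSpace ℝ (Fin d) => (1 + ‖x‖) ^ (-((d : ℝ) + 1)) :=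
      integrable_one_add_norm (by simp)
    refine (h0.const_mul ((d + 1).factorial * Real.exp 1)).mono'
      (by fun_prop) (Filter.Eventually.of_forall fun x => ?_)
    rw [Real.norm_of_nonneg (Real.exp_pos _).le]
    have h5 : (1 + ‖x‖) ^ (-((d : ℝ) + 1)) = ((1 + ‖x‖) ^ (d + 1))⁻¹ := by
      rw [Real.rpow_neg (by positivity)]; congr 1
      exact_mod_cast Real.rpow_natCast (1 + ‖x‖) (d + 1)
    have h1 := Real.pow_div_factorial_le_exp (1 + ‖x‖) (by positivity) (d + 1)
    rw [Real.exp_add, div_le_iff₀ (by positivity)] at h1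
    rw [h5, ← div_eq_mul_inv, le_div_iff₀ (by positivity), Real.exp_neg,
      inv_mul_le_iff₀ (Real.exp_pos _)]
    linarith
  exact ⟨hint, integral_exp_pos hint⟩

theorem isCentered_exp_neg_norm :
    IsCentered fun x : EuclideanSpace ℝ (Fin d) => Real.exp (-‖x‖) := by
  unfold IsCentered
  have h := integral_neg_eq_self (fun x : EuclideanSpace ℝ (Fin d) => Real.exp (-‖x‖) • x) volume
  simp only [norm_neg, smul_neg, integral_neg] at h
  have h2 : (2 : ℝ) • ∫ x : EuclideanSpace ℝ (Fin d), Real.exp (-‖x‖) • x = 0 := by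
    rw [two_smul]; nth_rewrite 1 [← h]; exact neg_add_cancel _
  exact (smul_eq_zero.1 h2).resolve_left two_ne_zero

theorem rayMoment_exp_neg_norm {n : ℕ} (hn : n ≠ 0) {x : EuclideanSpace ℝ (Fin d)} (hx : x ≠ 0) :
    rayMoment (fun x : EuclideanSpace ℝ (Fin d) => Real.exp (-‖x‖)) n x = n.factorial / ‖x‖ ^ n := by
  obtain ⟨m, rfl⟩ := Nat.exists_eq_succ_of_ne_zero hn
  rw [IsLogConcave.rayMoment_eq, Nat.succ_eq_add_one, Nat.add_sub_cancel]
  have : ∫ r in Ioi (0 : ℝ), r ^ m * Real.exp (-‖r • x‖) =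
      ∫ r in Ioi (0 : ℝ), r ^ m * Real.exp (-(‖x‖ * r)) := by
    refine setIntegral_congr_fun measurableSet_Ioi fun r hr => ?_
    have hr' : (0 : ℝ) < r := hr
    simp only [norm_smul, Real.norm_of_nonneg hr'.le, mul_comm]
  rw [this, integral_pow_mul_exp_neg m (norm_pos_iff.2 hx), Nat.factorial_succ]
  push_cast; ring

end ExpNorm

/-- The exponential density on the line shows that `c₁ ≤ 1 / √2`. -/
theorem AreBallBodyConstants.sq_le_half {c₁ c₂ : ℝ} (h : AreBallBodyConstants c₁ c₂) :
    c₁ ^ 2 ≤ 1 / 2 := by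
  obtain ⟨h0, -, h⟩ := h
  have hs := (h 1 le_rfl _ (isLogConcave_exp_neg_norm 1) (hasPosMass_exp_neg_norm 1)
    (isCentered_exp_neg_norm 1)).1.1
  have e1 : ((1 : ℕ) : ℝ) + 1 = ((2 : ℕ) : ℝ) := by norm_num
  rw [e1] at hs
  -- For exp(-|x|) on the line the n-th moment is n!/|x|^n, so K_1 = [-1, 1] and K_2 = [-√2, √2];
  -- this is the endpoint of K_2.
  set x : EuclideanSpace ℝ (Fin 1) := EuclideanSpace.single 0 √2 with hx
  have hnx : ‖x‖ = √2 := by rw [hx, PiLp.norm_single]; simp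
  have hs2 : 0 < √2 := by positivity
  have hx0 : x ≠ 0 := norm_pos_iff.1 (by rw [hnx]; exact hs2)
  have hmem : x ∈ ballBody ((2 : ℕ) : ℝ)
      (fun x : EuclideanSpace ℝ (Fin 1) => Real.exp (-‖x‖)) := by
    rw [(isLogConcave_exp_neg_norm 1).mem_ballBody_iff (hasPosMass_exp_neg_norm 1) (by simp) hx0,
      rayMoment_exp_neg_norm 1 (by simp) hx0, hnx]
    simp
  have := hs (smul_mem_smul_set hmem)
  rw [(isLogConcave_exp_neg_norm 1).mem_ballBody_iff (hasPosMass_exp_neg_norm 1) (by simp)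
    (smul_ne_zero h0.ne' hx0), rayMoment_exp_neg_norm 1 (by simp) (smul_ne_zero h0.ne' hx0),
    norm_smul, hnx, Real.norm_of_nonneg h0.le, le_div_iff₀ (by positivity)] at this
  simp only [norm_zero, neg_zero, Real.exp_zero, one_mul, pow_one, Nat.factorial_one, Nat.cast_one] at this
  have h2 : (c₁ * √2) ^ 2 ≤ 1 := by
    have : 0 ≤ c₁ * √2 := by positivity
    nlinarith
  rw [mul_pow, Real.sq_sqrt (by norm_num)] at h2
  linarith

/-! ### Convexity of Ball's bodies. -/

theorem ENNReal.mul_ediam_add_le {S : Set ℝ} (hS : S.Nonempty) {a c V : ENNReal} (ha : a ≠ ⊤)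
    (h : ∀ u ∈ S, ∀ v ∈ S, a * edist u v + c ≤ V) : a * Metric.ediam S + c ≤ V := by
  obtain ⟨u, hu⟩ := hS
  have hc : c ≤ V := le_trans le_add_self (h u hu u hu)
  rcases eq_or_ne V ⊤ with rfl | hV
  · exact le_top
  have hc' : c ≠ ⊤ := ne_top_of_le_ne_top hV hc
  rcases eq_or_ne a 0 with rfl | ha0
  · simpa using hc
  have h2 : Metric.ediam S ≤ (V - c) / a := by
    refine Metric.ediam_le fun u hu v hv => ?_
    rw [ENNReal.le_div_iff_mul_le (Or.inl ha0) (Or.inl ha), mul_comm]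
    exact ENNReal.le_sub_of_add_le_right hc' (h u hu v hv)
  rw [ENNReal.le_div_iff_mul_le (Or.inl ha0) (Or.inl ha), mul_comm] at h2
  calc a * Metric.ediam S + c ≤ (V - c) + c := by gcongr
    _ = V := tsub_add_cancel_of_le hc

/-- The radial profile of `f` in the inverted radial variable. -/
noncomputable def invProfile {d : ℕ} (f : EuclideanSpace ℝ (Fin d) → ℝ) (n : ℕ)
    (x : EuclideanSpace ℝ (Fin d)) (q : ℝ) : ℝ :=
  if 0 < q then f (q⁻¹ • x) * q⁻¹ ^ (n + 1) else 0

namespace IsLogConcave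

variable {d : ℕ} {f : EuclideanSpace ℝ (Fin d) → ℝ} {n : ℕ} {x y : EuclideanSpace ℝ (Fin d)}

theorem invProfile_nonneg (hf : IsLogConcave f) (n : ℕ) (x : EuclideanSpace ℝ (Fin d)) (q : ℝ) :
    0 ≤ invProfile f n x q := by
  unfold invProfile
  split_ifs with h
  · exact mul_nonneg (hf.nonneg _) (by positivity)
  · exact le_rfl

theorem measurable_invProfile (hf : IsLogConcave f) (n : ℕ) (x : EuclideanSpace ℝ (Fin d)) :
    Measurable (invProfile f n x) := by
  unfold invProfile
  refine Measurable.ite measurableSet_Ioi ?_ measurable_const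
  exact ((hf.measurable_ray x).comp measurable_inv).mul (measurable_inv.pow_const _)

/-- With s = ap + bq, the point (ax + by)/s is the mean of x/p and y/q with weights α = ap/s and β =
bq/s. Weighted AM-GM gives p^{-α} q^{-β} ≤ 1/s, so the profile is quasi-concave jointly in the point
and the inverted radius. -/
theorem min_le_invProfile (hf : IsLogConcave f) (n : ℕ) (x y : EuclideanSpace ℝ (Fin d))
    {a b p q : ℝ} (ha : 0 ≤ a) (hb : 0 ≤ b) (hab : a + b = 1) :
    min (invProfile f n x p) (invProfile f n y q) ≤ invProfile f n (a • x + b • y) (a * p + b * q) := by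
  by_cases hp : 0 < p
  swap
  · refine (min_le_left _ _).trans (le_trans (le_of_eq ?_) (hf.invProfile_nonneg n _ _))
    simp [invProfile, hp]
  by_cases hq : 0 < q
  swap
  · refine (min_le_right _ _).trans (le_trans (le_of_eq ?_) (hf.invProfile_nonneg n _ _))
    simp [invProfile, hq]
  have hs : 0 < a * p + b * q := by
    rcases ha.eq_or_lt with rfl | ha
    · have : b = 1 := by linarith
      rw [this]; linarith
    · have : 0 ≤ b * q := by positivity
      have : 0 < a * p := by positivity
      linarith
  set s := a * p + b * q with hsdef
  set α := a * p / s with hα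
  set β := b * q / s with hβ
  have hα0 : 0 ≤ α := by positivity
  have hβ0 : 0 ≤ β := by positivity
  have hαβ : α + β = 1 := by rw [hα, hβ, ← add_div, ← hsdef, div_self hs.ne']
  have e1 : α * p⁻¹ = s⁻¹ * a := by rw [hα]; field_simp
  have e2 : β * q⁻¹ = s⁻¹ * b := by rw [hβ]; field_simp
  have h1 := hf.le_map (p⁻¹ • x) (q⁻¹ • y) α β hα0 hβ0 hαβ
  have e3 : α • p⁻¹ • x + β • q⁻¹ • y = s⁻¹ • (a • x + b • y) := by
    rw [smul_smul, smul_smul, e1, e2, smul_add, smul_smul, smul_smul]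
  rw [e3] at h1
  have h2 : p⁻¹ ^ α * q⁻¹ ^ β ≤ s⁻¹ := by
    refine (Real.geom_mean_le_arith_mean2_weighted hα0 hβ0 (inv_pos.2 hp).le (inv_pos.2 hq).le hαβ).trans_eq ?_
    rw [e1, e2, ← mul_add, hab, mul_one]
  simp only [invProfile, hp, hq, hs, if_true]
  set A := f (p⁻¹ • x)
  set B := f (q⁻¹ • y)
  have hA : 0 ≤ A := hf.nonneg _
  have hB : 0 ≤ B := hf.nonneg _
  have hm0 : 0 ≤ min (A * p⁻¹ ^ (n + 1)) (B * q⁻¹ ^ (n + 1)) := le_min (by positivity) (by positivity)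
  have hpow : ∀ {c : ℝ} {t : ℝ}, 0 ≤ c → (c ^ (n + 1)) ^ t = (c ^ t) ^ (n + 1) := by
    intro c t hc
    rw [← Real.rpow_natCast, ← Real.rpow_natCast, ← Real.rpow_mul hc, ← Real.rpow_mul hc, mul_comm]
  have h3 : min (A * p⁻¹ ^ (n + 1)) (B * q⁻¹ ^ (n + 1)) ≤
      (A * p⁻¹ ^ (n + 1)) ^ α * (B * q⁻¹ ^ (n + 1)) ^ β := by
    rcases hm0.eq_or_lt with h | h
    · rw [← h]; positivity
    calc min (A * p⁻¹ ^ (n + 1)) (B * q⁻¹ ^ (n + 1))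
        = min (A * p⁻¹ ^ (n + 1)) (B * q⁻¹ ^ (n + 1)) ^ α *
          min (A * p⁻¹ ^ (n + 1)) (B * q⁻¹ ^ (n + 1)) ^ β := by
          rw [← Real.rpow_add h, hαβ, Real.rpow_one]
      _ ≤ _ := mul_le_mul (Real.rpow_le_rpow hm0 (min_le_left _ _) hα0)
          (Real.rpow_le_rpow hm0 (min_le_right _ _) hβ0) (Real.rpow_nonneg hm0 _) (by positivity)
  refine h3.trans ?_
  rw [Real.mul_rpow hA (by positivity), Real.mul_rpow hB (by positivity),
    hpow (inv_pos.2 hp).le, hpow (inv_pos.2 hq).le]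
  calc A ^ α * (p⁻¹ ^ α) ^ (n + 1) * (B ^ β * (q⁻¹ ^ β) ^ (n + 1))
      = (A ^ α * B ^ β) * (p⁻¹ ^ α * q⁻¹ ^ β) ^ (n + 1) := by rw [mul_pow]; ring
    _ ≤ _ := by
        refine mul_le_mul h1 (pow_le_pow_left₀ (by positivity) h2 _) (by positivity) (hf.nonneg _)

/-- Under r = 1/q the measure r^{n-1} dr becomes q^{-(n+1)} dq, the weight in the profile. -/
theorem lintegral_invProfile (hf : IsLogConcave f) (hm : HasPosMass f) (hn : n ≠ 0) (hx : x ≠ 0) :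
    ∫⁻ q, ENNReal.ofReal (invProfile f n x q) = ENNReal.ofReal (rayMoment f n x / n) := by
  have hn' : (n : ℝ) ≠ 0 := by exact_mod_cast hn
  have hcongr : ∀ q ∈ Ioi (0 : ℝ), (|(-1 : ℝ)| * q ^ ((-1 : ℝ) - 1)) •
      ((q ^ (-1 : ℝ)) ^ (n - 1) * f ((q ^ (-1 : ℝ)) • x)) = invProfile f n x q := by
    intro q hq
    have hq' : (0 : ℝ) < q := hq
    obtain ⟨m, rfl⟩ := Nat.exists_eq_succ_of_ne_zero hn
    have : q ^ ((-1 : ℝ) - 1) = q⁻¹ ^ 2 := by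
      rw [show (-1 : ℝ) - 1 = -((2 : ℕ) : ℝ) by norm_num, Real.rpow_neg hq'.le, Real.rpow_natCast, inv_pow]
    rw [this, Real.rpow_neg_one]
    simp only [invProfile, hq', if_true, abs_neg, abs_one, one_mul, smul_eq_mul, Nat.succ_eq_add_one,
      Nat.add_sub_cancel]
    ring
  have hI := (integrableOn_Ioi_comp_rpow_iff (fun r : ℝ => r ^ (n - 1) * f (r • x))
    (p := -1) (by norm_num)).2 (hf.integrableOn_ray hm hx (n - 1))
  have hE := integral_comp_rpow_Ioi (fun r : ℝ => r ^ (n - 1) * f (r • x)) (p := -1) (by norm_num)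
  rw [setIntegral_congr_fun measurableSet_Ioi hcongr] at hE
  have hI2 : IntegrableOn (invProfile f n x) (Ioi 0) := hI.congr_fun hcongr measurableSet_Ioi
  have hz : ∀ q ∉ Ioi (0 : ℝ), invProfile f n x q = 0 := by
    intro q hq
    have : ¬ 0 < q := hq
    simp [invProfile, this]
  have hI3 : Integrable (invProfile f n x) := (integrableOn_iff_integrable_of_support_subset (by
    intro q hq; by_contra hcon; exact hq (hz q hcon))).1 hI2
  rw [← ofReal_integral_eq_lintegral_ofReal hI3 (Filter.Eventually.of_forall (hf.invProfile_nonneg n x)),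
    ← setIntegral_eq_integral_of_forall_compl_eq_zero hz, hE, rayMoment_eq, mul_div_cancel_left₀ _ hn']

theorem invProfile_bddAbove (hf : IsLogConcave f) (hm : HasPosMass f) (hx : x ≠ 0) :
    BddAbove (range (invProfile f n x)) := by
  obtain ⟨A, B, hA, hB, h⟩ := hf.exists_exp_decay hm
  have hx' : 0 < ‖x‖ := norm_pos_iff.2 hx
  refine ⟨A * ((n + 1).factorial / (B * ‖x‖) ^ (n + 1)), ?_⟩
  rintro _ ⟨q, rfl⟩
  unfold invProfile
  split_ifs with hq
  swap
  · positivity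
  have h1 := Real.pow_div_factorial_le_exp (B * ‖q⁻¹ • x‖) (by positivity) (n + 1)
  have h2 := h (q⁻¹ • x)
  rw [norm_smul, Real.norm_of_nonneg (inv_pos.2 hq).le] at h1 h2
  rw [div_le_iff₀ (by positivity)] at h1
  calc f (q⁻¹ • x) * q⁻¹ ^ (n + 1) ≤ A * Real.exp (-(B * (q⁻¹ * ‖x‖))) * q⁻¹ ^ (n + 1) := by gcongr
    _ ≤ _ := by
      rw [mul_assoc]
      gcongr
      rw [Real.exp_neg, le_div_iff₀ (by positivity), mul_assoc, inv_mul_le_iff₀ (Real.exp_pos _)]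
      refine le_trans (le_of_eq ?_) h1
      rw [← mul_pow]; congr 1; ring

/-- Replacing x by cx dilates the profile by c and divides its height by c^{n+1}. Equal suprema will
make superlevel sets of two profiles nonempty at the same levels. -/
theorem exists_smul_invProfile_sup_eq_one (hf : IsLogConcave f) (hm : HasPosMass f) (hn : n ≠ 0)
    (hx : x ≠ 0) (hpos : 0 < rayMoment f n x) :
    ∃ c : ℝ, 0 < c ∧ (∀ q, invProfile f n (c • x) q ≤ 1) ∧
      ∀ t < 1, ∃ q, t < invProfile f n (c • x) q := by
  set m := sSup (range (invProfile f n x)) with hm'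
  have hb := hf.invProfile_bddAbove (n := n) hm hx
  have hmpos : 0 < m := by
    by_contra! hle
    have hz : ∀ q, invProfile f n x q = 0 := fun q =>
      le_antisymm ((le_csSup hb ⟨q, rfl⟩).trans hle) (hf.invProfile_nonneg n x q)
    have := hf.lintegral_invProfile hm hn hx
    simp only [hz, ENNReal.ofReal_zero, lintegral_zero] at this
    have h2 : 0 < ENNReal.ofReal (rayMoment f n x / n) := ENNReal.ofReal_pos.2 (by positivity)
    exact h2.ne this
  set c := m ^ (((n + 1 : ℕ) : ℝ)⁻¹) with hc
  have hc0 : 0 < c := by positivity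
  have hcm : c ^ (n + 1) = m := Real.rpow_inv_natCast_pow hmpos.le (by simp)
  have hscale : ∀ q, invProfile f n (c • x) q = invProfile f n x (q / c) / m := by
    intro q
    unfold invProfile
    by_cases hq : 0 < q
    · have : 0 < q / c := by positivity
      simp only [hq, this, if_true]
      rw [smul_smul, inv_div, div_eq_mul_inv c q, mul_comm c, mul_pow, hcm]
      field_simp
    · have : ¬ 0 < q / c := by rw [div_pos_iff_of_pos_right hc0]; exact hq
      simp [hq, this]
  refine ⟨c, hc0, fun q => ?_, fun t ht => ?_⟩
  · rw [hscale, div_le_one hmpos]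
    exact le_csSup hb ⟨_, rfl⟩
  · have : t * m < m := by nlinarith
    obtain ⟨_, ⟨q, rfl⟩, hq⟩ := exists_lt_of_lt_csSup (range_nonempty _) this
    refine ⟨q * c, ?_⟩
    rw [hscale, mul_div_cancel_right₀ _ hc0.ne', lt_div_iff₀ hmpos]
    exact hq

/-- One-dimensional Brunn-Minkowski: by joint quasi-concavity, pairs u ≤ u' and v ≤ v' in the two
superlevel sets produce an interval of length a(u' - u) + b(v' - v) in the third, and volume is at
most diameter. -/
theorem volume_invProfile_add_le (hf : IsLogConcave f) {a b t : ℝ} (ha : 0 ≤ a) (hb : 0 ≤ b)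
    (hab : a + b = 1) (hx : {q | t < invProfile f n x q}.Nonempty)
    (hy : {q | t < invProfile f n y q}.Nonempty) :
    ENNReal.ofReal a * volume {q | t < invProfile f n x q} +
      ENNReal.ofReal b * volume {q | t < invProfile f n y q} ≤
      volume {q | t < invProfile f n (a • x + b • y) q} := by
  set z := a • x + b • y with hz
  have core : ∀ u ∈ {q | t < invProfile f n x q}, ∀ u' ∈ {q | t < invProfile f n x q},
      ∀ v ∈ {q | t < invProfile f n y q}, ∀ v' ∈ {q | t < invProfile f n y q}, u ≤ u' → v ≤ v' →
      ENNReal.ofReal a * edist u u' + ENNReal.ofReal b * edist v v' ≤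
        volume {q | t < invProfile f n z q} := by
    intro u hu u' hu' v hv v' hv' huu hvv
    have h1 : t < invProfile f n z (a * u + b * v) :=
      (lt_min hu hv).trans_le (hf.min_le_invProfile n x y ha hb hab)
    have h2 : t < invProfile f n z (a * u' + b * v') :=
      (lt_min hu' hv').trans_le (hf.min_le_invProfile n x y ha hb hab)
    have hsub : Icc (a * u + b * v) (a * u' + b * v') ⊆ {q | t < invProfile f n z q} := by
      intro w hw
      rw [← segment_eq_Icc (hw.1.trans hw.2)] at hw
      obtain ⟨α, β, hα, hβ, hαβ, rfl⟩ := hw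
      have h3 := hf.min_le_invProfile n z z (p := a * u + b * v) (q := a * u' + b * v') hα hβ hαβ
      rw [← add_smul, hαβ, one_smul] at h3
      exact (lt_min h1 h2).trans_le h3
    refine le_trans (le_of_eq ?_) (measure_mono hsub)
    rw [Real.volume_Icc, edist_dist, edist_dist, Real.dist_eq, Real.dist_eq, abs_sub_comm,
      abs_sub_comm v, abs_of_nonneg (by linarith), abs_of_nonneg (by linarith),
      ← ENNReal.ofReal_mul ha, ← ENNReal.ofReal_mul hb,
      ← ENNReal.ofReal_add (mul_nonneg ha (by linarith)) (mul_nonneg hb (by linarith))]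
    congr 1; ring
  have core2 : ∀ u ∈ {q | t < invProfile f n x q}, ∀ u' ∈ {q | t < invProfile f n x q},
      ∀ v ∈ {q | t < invProfile f n y q}, ∀ v' ∈ {q | t < invProfile f n y q},
      ENNReal.ofReal a * edist u u' + ENNReal.ofReal b * edist v v' ≤
        volume {q | t < invProfile f n z q} := by
    intro u hu u' hu' v hv v' hv'
    rcases le_total u u' with h | h <;> rcases le_total v v' with h' | h'
    · exact core u hu u' hu' v hv v' hv' h h'
    · rw [edist_comm v]; exact core u hu u' hu' v' hv' v hv h h'
    · rw [edist_comm u]; exact core u' hu' u hu v hv v' hv' h h'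
    · rw [edist_comm u, edist_comm v]; exact core u' hu' u hu v' hv' v hv h h'
  calc _ ≤ ENNReal.ofReal a * Metric.ediam {q | t < invProfile f n x q} +
      ENNReal.ofReal b * Metric.ediam {q | t < invProfile f n y q} := by
        gcongr <;> exact Real.volume_le_diam _
    _ ≤ _ := by
      -- The bound for pairs of points passes to the diameters one set at a time.
      refine ENNReal.mul_ediam_add_le hx ENNReal.ofReal_ne_top fun u hu u' hu' => ?_
      rw [add_comm]
      refine ENNReal.mul_ediam_add_le hy ENNReal.ofReal_ne_top fun v hv v' hv' => ?_
      rw [add_comm]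
      exact core2 u hu u' hu' v hv v' hv'

/-- Layer cake: with both suprema equal to 1, the two superlevel sets are nonempty for t < 1 and
empty for t ≥ 1, so the length inequality integrates over t. The conclusion is linear, not merely a
geometric mean. -/
theorem rayMoment_add_le (hf : IsLogConcave f) (hm : HasPosMass f) (hn : n ≠ 0) {a b : ℝ}
    (ha : 0 ≤ a) (hb : 0 ≤ b) (hab : a + b = 1) (hx : x ≠ 0) (hy : y ≠ 0) (hz : a • x + b • y ≠ 0)
    (hx1 : ∀ q, invProfile f n x q ≤ 1) (hx2 : ∀ t < 1, ∃ q, t < invProfile f n x q)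
    (hy1 : ∀ q, invProfile f n y q ≤ 1) (hy2 : ∀ t < 1, ∃ q, t < invProfile f n y q) :
    a * rayMoment f n x + b * rayMoment f n y ≤ rayMoment f n (a • x + b • y) := by
  have hlc : ∀ w, ∫⁻ q, ENNReal.ofReal (invProfile f n w q) =
      ∫⁻ t in Ioi (0 : ℝ), volume {q | t < invProfile f n w q} := fun w =>
    lintegral_eq_lintegral_meas_lt volume (Filter.Eventually.of_forall (hf.invProfile_nonneg n w))
      (hf.measurable_invProfile n w).aemeasurable
  have hmeas : ∀ w, Measurable fun t : ℝ => volume {q | t < invProfile f n w q} := by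
    intro w
    refine Antitone.measurable fun s t hst => measure_mono fun q hq => ?_
    exact lt_of_le_of_lt hst hq
  have h : ENNReal.ofReal a * (∫⁻ q, ENNReal.ofReal (invProfile f n x q)) +
      ENNReal.ofReal b * (∫⁻ q, ENNReal.ofReal (invProfile f n y q)) ≤
      ∫⁻ q, ENNReal.ofReal (invProfile f n (a • x + b • y) q) := by
    rw [hlc, hlc, hlc, ← lintegral_const_mul _ (hmeas x), ← lintegral_const_mul _ (hmeas y),
      ← lintegral_add_left ((hmeas x).const_mul _)]
    refine lintegral_mono fun t => ?_
    rcases lt_or_ge t 1 with ht | ht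
    · exact hf.volume_invProfile_add_le ha hb hab (hx2 t ht) (hy2 t ht)
    · have e : ∀ w, (∀ q, invProfile f n w q ≤ 1) → {q | t < invProfile f n w q} = ∅ := fun w hw =>
        eq_empty_of_forall_notMem fun q hq => absurd (hw q) (not_le.2 (lt_of_le_of_lt ht hq))
      simp [e x hx1, e y hy1]
  have hn' : (0 : ℝ) < n := by positivity
  have hx0 := hf.rayMoment_nonneg n x
  have hy0 := hf.rayMoment_nonneg n y
  rw [hf.lintegral_invProfile hm hn hx, hf.lintegral_invProfile hm hn hy, hf.lintegral_invProfile hm hn hz,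
    ← ENNReal.ofReal_mul ha, ← ENNReal.ofReal_mul hb, ← ENNReal.ofReal_add (by positivity) (by positivity),
    ENNReal.ofReal_le_ofReal_iff (div_nonneg (hf.rayMoment_nonneg n _) hn'.le), mul_div_assoc',
    mul_div_assoc', ← add_div, div_le_div_iff_of_pos_right hn'] at h
  exact h

theorem smul_mem_ballBody (hf : IsLogConcave f) (hm : HasPosMass f) (hf0 : 0 < f 0) (hn : n ≠ 0)
    (hx : x ∈ ballBody (n : ℝ) f) {c : ℝ} (hc : 0 ≤ c) (hc1 : c ≤ 1) : c • x ∈ ballBody (n : ℝ) f := by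
  rcases hc.eq_or_lt with rfl | hc
  · rw [zero_smul]; exact zero_mem_ballBody hn hf0
  rcases eq_or_ne x 0 with rfl | hx0
  · rw [smul_zero]; exact zero_mem_ballBody hn hf0
  rw [hf.mem_ballBody_iff hm hn hx0] at hx
  rw [hf.mem_ballBody_iff hm hn (smul_ne_zero hc.ne' hx0), rayMoment_smul f hn x hc,
    le_div_iff₀ (by positivity)]
  have : c ^ n ≤ 1 := pow_le_one₀ hc.le hc1
  nlinarith

/-- Ball's theorem: the bodies `K_n(f)` are convex. -/
theorem convex_ballBody (hf : IsLogConcave f) (hm : HasPosMass f) (hf0 : 0 < f 0) (hn : n ≠ 0) :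
    Convex ℝ (ballBody (n : ℝ) f) := by
  intro x hx y hy μ ν hμ hν hμν
  rcases eq_or_ne x 0 with rfl | hx0
  · rw [smul_zero, zero_add]; exact hf.smul_mem_ballBody hm hf0 hn hy hν (by linarith)
  rcases eq_or_ne y 0 with rfl | hy0
  · rw [smul_zero, add_zero]; exact hf.smul_mem_ballBody hm hf0 hn hx hμ (by linarith)
  rcases eq_or_ne (μ • x + ν • y) 0 with hz | hz
  · rw [hz]; exact zero_mem_ballBody hn hf0
  rw [hf.mem_ballBody_iff hm hn hx0] at hx
  rw [hf.mem_ballBody_iff hm hn hy0] at hy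
  rw [hf.mem_ballBody_iff hm hn hz]
  obtain ⟨c, hc, hc1, hc2⟩ := hf.exists_smul_invProfile_sup_eq_one hm hn hx0 (hf0.trans_le hx)
  obtain ⟨e, he, he1, he2⟩ := hf.exists_smul_invProfile_sup_eq_one hm hn hy0 (hf0.trans_le hy)
  -- Weights proportional to μ/c and ν/e undo the normalization: the corresponding mean of cx and ey
  -- is (μx + νy)/κ.
  set κ := μ * c⁻¹ + ν * e⁻¹ with hκ
  have hκ0 : 0 < κ := by
    rcases hμ.eq_or_lt with rfl | hμ
    · have : ν = 1 := by linarith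
      rw [hκ, this]; simp [he]
    · have : 0 ≤ ν * e⁻¹ := by positivity
      have : 0 < μ * c⁻¹ := by positivity
      linarith
  have hsum : μ * c⁻¹ / κ + ν * e⁻¹ / κ = 1 := by rw [← add_div, ← hκ, div_self hκ0.ne']
  have hpt : (μ * c⁻¹ / κ) • c • x + (ν * e⁻¹ / κ) • e • y = κ⁻¹ • (μ • x + ν • y) := by
    rw [smul_smul, smul_smul, smul_add, smul_smul, smul_smul]
    congr 2 <;> field_simp
  have h := hf.rayMoment_add_le hm hn (a := μ * c⁻¹ / κ) (b := ν * e⁻¹ / κ) (by positivity) (by positivity)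
    hsum (smul_ne_zero hc.ne' hx0) (smul_ne_zero he.ne' hy0)
    (by rw [hpt]; exact smul_ne_zero (inv_ne_zero hκ0.ne') hz) hc1 hc2 he1 he2
  rw [hpt, rayMoment_smul f hn _ hc, rayMoment_smul f hn _ he, rayMoment_smul f hn _ (inv_pos.2 hκ0),
    inv_pow, div_inv_eq_mul] at h
  -- Convexity of t^{n+1} at 1/c and 1/e compensates for the unequal normalizations.
  have hconv := (convexOn_pow (n + 1)).2 (x := c⁻¹) (inv_pos.2 hc).le (y := e⁻¹) (inv_pos.2 he).le hμ hν hμν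
  simp only [smul_eq_mul, ← hκ] at hconv
  have h2 : κ ^ n * f 0 ≤ κ ^ n * rayMoment f n (μ • x + ν • y) := by
    calc κ ^ n * f 0 = κ ^ (n + 1) / κ * f 0 := by rw [pow_succ, mul_div_cancel_right₀ _ hκ0.ne']
      _ ≤ (μ * c⁻¹ ^ (n + 1) + ν * e⁻¹ ^ (n + 1)) / κ * f 0 := by gcongr
      _ = μ * c⁻¹ / κ * (f 0 / c ^ n) + ν * e⁻¹ / κ * (f 0 / e ^ n) := by
        rw [pow_succ, pow_succ, inv_pow, inv_pow]; field_simp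
      _ ≤ μ * c⁻¹ / κ * (rayMoment f n x / c ^ n) + ν * e⁻¹ / κ * (rayMoment f n y / e ^ n) := by gcongr
      _ ≤ _ := by rw [mul_comm]; linarith
  exact le_of_mul_le_mul_left h2 (by positivity)

end IsLogConcave

/-! ### Polar coordinates and integrals over Ball's bodies. -/

/-- Polar coordinates for the Lebesgue integral of an `[0, ∞]`-valued function. -/
theorem lintegral_eq_lintegral_toSphere {d : ℕ} (hd : d ≠ 0) {G : EuclideanSpace ℝ (Fin d) → ENNReal}
    (hG : AEMeasurable G) :
    ∫⁻ x, G x = ∫⁻ θ : Metric.sphere (0 : EuclideanSpace ℝ (Fin d)) 1,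
      (∫⁻ r in Ioi (0 : ℝ), ENNReal.ofReal (r ^ (d - 1)) * G (r • (θ : EuclideanSpace ℝ (Fin d))))
        ∂(volume : Measure (EuclideanSpace ℝ (Fin d))).toSphere := by
  have : Nonempty (Fin d) := ⟨⟨0, Nat.pos_of_ne_zero hd⟩⟩
  set μ : Measure (EuclideanSpace ℝ (Fin d)) := volume with hμ
  have hmp := μ.measurePreserving_homeomorphUnitSphereProd
  have hemb := (homeomorphUnitSphereProd (EuclideanSpace ℝ (Fin d))).measurableEmbedding
  rw [finrank_euclideanSpace_fin] at hmp
  set g : Metric.sphere (0 : EuclideanSpace ℝ (Fin d)) 1 × Ioi (0 : ℝ) → ENNReal :=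
    fun p => G ((p.2 : ℝ) • (p.1 : EuclideanSpace ℝ (Fin d))) with hg
  have hgc : ∀ x : ({0}ᶜ : Set (EuclideanSpace ℝ (Fin d))),
      g (homeomorphUnitSphereProd _ x) = G x := by
    intro x
    have hx : ‖(x : EuclideanSpace ℝ (Fin d))‖ ≠ 0 := norm_ne_zero_iff.2 x.2
    simp only [hg, homeomorphUnitSphereProd_apply_snd_coe, homeomorphUnitSphereProd_apply_fst_coe]
    rw [smul_inv_smul₀ hx]
  have hgm : AEMeasurable g (μ.toSphere.prod (Measure.volumeIoiPow (d - 1))) := by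
    rw [← hmp.aemeasurable_comp_iff hemb]
    have : g ∘ homeomorphUnitSphereProd (EuclideanSpace ℝ (Fin d)) = G ∘ Subtype.val := funext hgc
    rw [this, ← (MeasurableEmbedding.subtype_coe (measurableSet_singleton 0).compl).aemeasurable_map_iff,
      map_comap_subtype_coe (measurableSet_singleton _).compl]
    exact hG.restrict
  have h1 : ∫⁻ x, G x ∂μ = ∫⁻ p, g p ∂(μ.toSphere.prod (Measure.volumeIoiPow (d - 1))) := by
    rw [← hmp.lintegral_comp_emb hemb]
    simp_rw [hgc]
    rw [lintegral_subtype_comap (measurableSet_singleton _).compl, restrict_compl_singleton]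
  rw [h1, lintegral_prod _ hgm]
  refine lintegral_congr fun θ => ?_
  rw [Measure.volumeIoiPow, lintegral_withDensity_eq_lintegral_mul_non_measurable₀ _
    (by fun_prop) (Filter.Eventually.of_forall fun _ => ENNReal.ofReal_lt_top)]
  exact lintegral_subtype_comap measurableSet_Ioi
    (fun r : ℝ => ENNReal.ofReal (r ^ (d - 1)) * G (r • (θ : EuclideanSpace ℝ (Fin d))))

theorem setIntegral_smul_of_homogeneous {d : ℕ} {h : EuclideanSpace ℝ (Fin d) → ℝ} {k : ℕ}
    (hh : ∀ r : ℝ, 0 < r → ∀ x, h (r • x) = r ^ k * h x) {c : ℝ} (hc : 0 < c)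
    (K : Set (EuclideanSpace ℝ (Fin d))) : ∫ x in c • K, h x = c ^ (d + k) * ∫ x in K, h x := by
  have h1 := Measure.setIntegral_comp_smul_of_pos (volume : Measure (EuclideanSpace ℝ (Fin d))) h K hc
  simp_rw [hh c hc] at h1
  rw [integral_const_mul, finrank_euclideanSpace_fin, smul_eq_mul] at h1
  rw [pow_add, mul_assoc, h1, mul_inv_cancel_left₀ (by positivity)]

namespace IsLogConcave

variable {d : ℕ} {f : EuclideanSpace ℝ (Fin d) → ℝ} {n : ℕ} {x : EuclideanSpace ℝ (Fin d)}

theorem smul_mem_ballBody_iff (hf : IsLogConcave f) (hm : HasPosMass f) (hf0 : 0 < f 0) (hn : n ≠ 0)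
    (hx : x ≠ 0) {r : ℝ} (hr : 0 < r) :
    r • x ∈ ballBody (n : ℝ) f ↔ r ≤ (rayMoment f n x / f 0) ^ ((n : ℝ)⁻¹) := by
  rw [hf.mem_ballBody_iff hm hn (smul_ne_zero hr.ne' hx), rayMoment_smul f hn x hr,
    le_div_iff₀ (by positivity)]
  have h0 : 0 ≤ rayMoment f n x / f 0 := div_nonneg (hf.rayMoment_nonneg n x) hf0.le
  rw [← pow_le_pow_iff_left₀ hr.le (Real.rpow_nonneg h0 _) hn,
    Real.rpow_inv_natCast_pow h0 hn, le_div_iff₀ hf0, mul_comm]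

/-- The body meets the open ray in 0 < r ≤ ρ, where f(0) ρ^n is the ray moment; both sides equal
that moment divided by n. -/
theorem lintegral_ballBody_ray (hf : IsLogConcave f) (hm : HasPosMass f) (hf0 : 0 < f 0) (hn : n ≠ 0)
    (hx : x ≠ 0) :
    ∫⁻ r in Ioi (0 : ℝ), ENNReal.ofReal (r ^ (n - 1)) *
        (ballBody (n : ℝ) f).indicator (fun _ => ENNReal.ofReal (f 0)) (r • x) =
      ∫⁻ r in Ioi (0 : ℝ), ENNReal.ofReal (r ^ (n - 1)) * ENNReal.ofReal (f (r • x)) := by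
  have hn' : (n : ℝ) ≠ 0 := by exact_mod_cast hn
  have h0 : 0 ≤ rayMoment f n x / f 0 := div_nonneg (hf.rayMoment_nonneg n x) hf0.le
  set ρ := (rayMoment f n x / f 0) ^ ((n : ℝ)⁻¹) with hρ
  have hρ0 : 0 ≤ ρ := Real.rpow_nonneg h0 _
  have hρn : ρ ^ n = rayMoment f n x / f 0 := Real.rpow_inv_natCast_pow h0 hn
  have hR : ∫⁻ r in Ioi (0 : ℝ), ENNReal.ofReal (r ^ (n - 1)) * ENNReal.ofReal (f (r • x)) =
      ENNReal.ofReal (rayMoment f n x / n) := by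
    rw [rayMoment_eq, mul_div_cancel_left₀ _ hn',
      ofReal_integral_eq_lintegral_ofReal (hf.integrableOn_ray hm hx (n - 1))]
    · refine setLIntegral_congr_fun measurableSet_Ioi fun r hr => ?_
      exact (ENNReal.ofReal_mul (pow_nonneg (le_of_lt hr) _)).symm
    · filter_upwards [ae_restrict_mem measurableSet_Ioi] with r hr
      exact mul_nonneg (pow_nonneg (le_of_lt hr) _) (hf.nonneg _)
  have hL : ∫⁻ r in Ioi (0 : ℝ), ENNReal.ofReal (r ^ (n - 1)) *
        (ballBody (n : ℝ) f).indicator (fun _ => ENNReal.ofReal (f 0)) (r • x) =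
      ∫⁻ r in Ioc (0 : ℝ) ρ, ENNReal.ofReal (r ^ (n - 1) * f 0) := by
    have : Ioc (0 : ℝ) ρ = Iic ρ ∩ Ioi 0 := by ext; simp [and_comm]
    rw [this, ← setLIntegral_indicator measurableSet_Iic]
    refine setLIntegral_congr_fun measurableSet_Ioi fun r hr => ?_
    have hiff := hf.smul_mem_ballBody_iff hm hf0 hn hx hr
    rw [← hρ] at hiff
    by_cases hle : r ≤ ρ
    · rw [indicator_of_mem (hiff.2 hle), indicator_of_mem (show r ∈ Iic ρ from hle),
        ENNReal.ofReal_mul (pow_nonneg (le_of_lt hr) _)]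
    · rw [indicator_of_notMem (fun h => hle (hiff.1 h)), indicator_of_notMem (show r ∉ Iic ρ from hle),
        mul_zero]
  rw [hR, hL, ← ofReal_integral_eq_lintegral_ofReal]
  · rw [← intervalIntegral.integral_of_le hρ0, intervalIntegral.integral_mul_const, integral_pow]
    obtain ⟨m, rfl⟩ := Nat.exists_eq_succ_of_ne_zero hn
    rw [Nat.succ_eq_add_one, Nat.add_sub_cancel, zero_pow (by simp), sub_zero, ← Nat.succ_eq_add_one, hρn]
    congr 1
    push_cast
    field_simp
  · exact (Continuous.integrableOn_Icc (by fun_prop)).mono_set Ioc_subset_Icc_self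
  · filter_upwards [ae_restrict_mem measurableSet_Ioc] with r hr
    exact mul_nonneg (pow_nonneg hr.1.le _) hf0.le

/-- Homogeneous functions have the same integral over `K_{d+k}(f)` as against `f / f(0)`. -/
theorem mul_setIntegral_ballBody (hf : IsLogConcave f) (hm : HasPosMass f) (hf0 : 0 < f 0) (hd : d ≠ 0)
    {h : EuclideanSpace ℝ (Fin d) → ℝ} (hcont : Continuous h) (hnn : ∀ x, 0 ≤ h x) {k : ℕ}
    (hh : ∀ r : ℝ, 0 < r → ∀ x, h (r • x) = r ^ k * h x) :
    f 0 * ∫ x in ballBody ((d + k : ℕ) : ℝ) f, h x = ∫ x, h x * f x := by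
  have hn : d + k ≠ 0 := by omega
  set K := ballBody ((d + k : ℕ) : ℝ) f with hK
  have hKm : NullMeasurableSet K := (hf.convex_ballBody hm hf0 hn).nullMeasurableSet volume
  -- The Jacobian and the homogeneity combine to the weight that defines the body of index d + k.
  have hpow : ∀ r : ℝ, r ^ (d - 1) * r ^ k = r ^ (d + k - 1) := fun r => by
    rw [← pow_add]; congr 1; omega
  have key : ∫⁻ x, ENNReal.ofReal (h x) * K.indicator (fun _ => ENNReal.ofReal (f 0)) x =
      ∫⁻ x, ENNReal.ofReal (h x) * ENNReal.ofReal (f x) := by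
    have hhm : AEMeasurable fun x => ENNReal.ofReal (h x) := by fun_prop
    have hK2 : AEMeasurable (K.indicator fun _ => ENNReal.ofReal (f 0)) :=
      aemeasurable_const.indicator₀ hKm
    rw [lintegral_eq_lintegral_toSphere hd
        (G := fun x => ENNReal.ofReal (h x) * K.indicator (fun _ => ENNReal.ofReal (f 0)) x) (hhm.mul hK2),
      lintegral_eq_lintegral_toSphere hd (G := fun x => ENNReal.ofReal (h x) * ENNReal.ofReal (f x))
        (hhm.mul hm.1.1.aemeasurable.ennreal_ofReal)]
    refine lintegral_congr fun θ => ?_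
    have hθ : (θ : EuclideanSpace ℝ (Fin d)) ≠ 0 := ne_zero_of_mem_unit_sphere θ
    have e : ∀ F : ℝ → ENNReal, ∫⁻ r in Ioi (0 : ℝ), ENNReal.ofReal (r ^ (d - 1)) *
        (ENNReal.ofReal (h (r • (θ : EuclideanSpace ℝ (Fin d)))) * F r) =
        ENNReal.ofReal (h θ) * ∫⁻ r in Ioi (0 : ℝ), ENNReal.ofReal (r ^ (d + k - 1)) * F r := by
      intro F
      rw [← lintegral_const_mul' _ _ ENNReal.ofReal_ne_top]
      refine setLIntegral_congr_fun measurableSet_Ioi fun r hr => ?_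
      have hr' : (0 : ℝ) < r := hr
      rw [hh r hr', ENNReal.ofReal_mul (by positivity), ← hpow, ENNReal.ofReal_mul (by positivity)]
      ring
    rw [e, e, hf.lintegral_ballBody_ray hm hf0 hn hθ]
  have hl : f 0 * ∫ x in K, h x = (∫⁻ x, ENNReal.ofReal (h x) * K.indicator (fun _ => ENNReal.ofReal (f 0)) x).toReal := by
    rw [integral_eq_lintegral_of_nonneg_ae (Filter.Eventually.of_forall hnn) hcont.aestronglyMeasurable,
      ← ENNReal.toReal_ofReal hf0.le, ← ENNReal.toReal_mul, ENNReal.toReal_ofReal hf0.le,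
      ← lintegral_const_mul' _ _ ENNReal.ofReal_ne_top, ← lintegral_indicator₀ hKm]
    congr 1
    refine lintegral_congr fun x => ?_
    by_cases hx : x ∈ K
    · simp [hx, mul_comm]
    · simp [hx]
  rw [hl, key, integral_eq_lintegral_of_nonneg_ae
    (Filter.Eventually.of_forall fun x => mul_nonneg (hnn x) (hf.nonneg x))
    (hcont.aestronglyMeasurable.mul hm.1.1)]
  congr 1
  exact lintegral_congr fun x => (ENNReal.ofReal_mul (hnn x)).symm

theorem exists_norm_le_of_mem_ballBody (hf : IsLogConcave f) (hm : HasPosMass f) (hf0 : 0 < f 0)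
    (hn : n ≠ 0) : ∃ R : ℝ, 0 < R ∧ ballBody (n : ℝ) f ⊆ Metric.closedBall 0 R := by
  obtain ⟨A, B, hA, hB, h⟩ := hf.exists_exp_decay hm
  set C := A * (n.factorial / B ^ n) / f 0 with hC
  have hC0 : 0 < C := by positivity
  refine ⟨C ^ ((n : ℝ)⁻¹), by positivity, fun x hx => ?_⟩
  rw [mem_closedBall_zero_iff]
  rcases eq_or_ne x 0 with rfl | hx0
  · rw [norm_zero]; positivity
  have hx' : 0 < ‖x‖ := norm_pos_iff.2 hx0
  rw [hf.mem_ballBody_iff hm hn hx0] at hx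
  have h1 : rayMoment f n x ≤ A * (n.factorial / (B * ‖x‖) ^ n) := by
    obtain ⟨m, rfl⟩ := Nat.exists_eq_succ_of_ne_zero hn
    rw [rayMoment_eq, Nat.succ_eq_add_one, Nat.add_sub_cancel]
    have h2 : ∫ r in Ioi (0 : ℝ), r ^ m * f (r • x) ≤
        ∫ r in Ioi (0 : ℝ), A * (r ^ m * Real.exp (-(B * ‖x‖ * r))) := by
      refine setIntegral_mono_on (hf.integrableOn_ray hm hx0 m)
        ((integrableOn_pow_mul_exp_neg m (by positivity)).const_mul A) measurableSet_Ioi fun r hr => ?_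
      have hr' : (0 : ℝ) < r := hr
      have h3 := h (r • x)
      rw [norm_smul, Real.norm_of_nonneg hr'.le] at h3
      calc r ^ m * f (r • x) ≤ r ^ m * (A * Real.exp (-(B * (r * ‖x‖)))) := by gcongr
        _ = A * (r ^ m * Real.exp (-(B * ‖x‖ * r))) := by
          rw [show B * (r * ‖x‖) = B * ‖x‖ * r by ring]; ring
    rw [integral_const_mul, integral_pow_mul_exp_neg m (by positivity)] at h2
    rw [Nat.factorial_succ]
    refine (mul_le_mul_of_nonneg_left h2 (by positivity)).trans_eq ?_
    push_cast; ring
  have h2 : ‖x‖ ^ n ≤ C := by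
    have h3 := hx.trans h1
    rw [mul_pow, mul_div_assoc', le_div_iff₀ (by positivity)] at h3
    rw [hC, mul_div_assoc', le_div_iff₀ hf0, le_div_iff₀ (by positivity)]
    linarith
  rw [← Real.rpow_inv_natCast_pow hC0.le hn] at h2
  exact le_of_pow_le_pow_left₀ hn (by positivity) h2

theorem exists_ball_half_le (hf : IsLogConcave f)
    (h0 : (0 : EuclideanSpace ℝ (Fin d)) ∈ interior {x | 0 < f x}) :
    ∃ ε > 0, ∀ x : EuclideanSpace ℝ (Fin d), ‖x‖ < ε → f 0 / 2 ≤ f x := by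
  set U := interior {x | 0 < f x} with hU
  have hUpos : ∀ x ∈ U, 0 < f x := fun x hx => show x ∈ {x | 0 < f x} from interior_subset hx
  have hconc : ConcaveOn ℝ U fun x => Real.log (f x) := by
    refine ⟨(hf.convex_lt 0).interior, fun x hx y hy a b ha hb hab => ?_⟩
    have hx' := hUpos x hx
    have hy' := hUpos y hy
    rw [smul_eq_mul, smul_eq_mul, ← Real.log_rpow hx', ← Real.log_rpow hy',
      ← Real.log_mul (by positivity) (by positivity)]
    exact Real.log_le_log (by positivity) (hf.le_map x y a b ha hb hab)
  have hcont := (hconc.continuousOn isOpen_interior).continuousAt (isOpen_interior.mem_nhds h0)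
  have hf0 := hUpos 0 h0
  have hev : ∀ᶠ x in nhds (0 : EuclideanSpace ℝ (Fin d)), Real.log (f 0 / 2) < Real.log (f x) ∧ x ∈ U :=
    (hcont.eventually (lt_mem_nhds (Real.log_lt_log (by positivity) (by linarith)))).and
      (isOpen_interior.mem_nhds h0)
  obtain ⟨ε, hε, h⟩ := Metric.eventually_nhds_iff.1 hev
  refine ⟨ε, hε, fun x hx => ?_⟩
  obtain ⟨h1, h2⟩ := h (y := x) (by simpa using hx)
  exact ((Real.log_lt_log_iff (by positivity) (hUpos x h2)).1 h1).le

theorem zero_mem_interior_ballBody (hf : IsLogConcave f) (hm : HasPosMass f) (hc : IsCentered f)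
    (hn : n ≠ 0) : (0 : EuclideanSpace ℝ (Fin d)) ∈ interior (ballBody (n : ℝ) f) := by
  have hf0 := hf.apply_zero_pos hm hc
  obtain ⟨ε, hε, h⟩ := hf.exists_ball_half_le (hf.zero_mem_interior_support hm hc)
  rw [mem_interior_iff_mem_nhds]
  refine Filter.mem_of_superset (Metric.ball_mem_nhds 0 (half_pos hε)) fun x hx => ?_
  rw [mem_ball_zero_iff] at hx
  rcases eq_or_ne x 0 with rfl | hx0
  · exact zero_mem_ballBody hn hf0
  have hx' : 0 < ‖x‖ := norm_pos_iff.2 hx0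
  rw [hf.mem_ballBody_iff hm hn hx0]
  have hint := hf.integrableOn_rayMoment hm hx0 n
  -- For ‖x‖ < ε/2 the points rx with r ≤ 2 stay where f ≥ f(0)/2, and 2^n f(0)/2 ≥ f(0) because n ≥
  -- 1.
  have h1 : ∫ r in Ioc (0 : ℝ) 2, n * r ^ (n - 1) * (f 0 / 2) ≤ rayMoment f n x := by
    refine le_trans ?_ (setIntegral_mono_set hint ?_ (show Ioc (0 : ℝ) 2 ⊆ Ioi 0 from Ioc_subset_Ioi_self).eventuallyLE)
    · refine setIntegral_mono_on ?_ (hint.mono_set Ioc_subset_Ioi_self) measurableSet_Ioc fun r hr => ?_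
      · exact (Continuous.integrableOn_Icc (by fun_prop)).mono_set Ioc_subset_Icc_self
      · have hr1 := hr.1
        refine mul_le_mul_of_nonneg_left (h _ ?_) (by positivity)
        rw [norm_smul, Real.norm_of_nonneg hr.1.le]
        calc r * ‖x‖ ≤ 2 * ‖x‖ := by gcongr; exact hr.2
          _ < ε := by linarith
    · filter_upwards [ae_restrict_mem measurableSet_Ioi] with r hr
      have hr' : (0 : ℝ) < r := hr
      exact mul_nonneg (by positivity) (hf.nonneg _)
  refine le_trans ?_ h1
  obtain ⟨m, rfl⟩ := Nat.exists_eq_succ_of_ne_zero hn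
  rw [← intervalIntegral.integral_of_le (by norm_num), intervalIntegral.integral_mul_const,
    intervalIntegral.integral_const_mul, integral_pow, Nat.succ_eq_add_one, Nat.add_sub_cancel,
    zero_pow (by simp), sub_zero]
  have h2 : (1 : ℝ) ≤ 2 ^ m := one_le_pow₀ (by norm_num)
  have h3 : (((m + 1 : ℕ) : ℝ) * (2 ^ (m + 1) / ((m : ℝ) + 1))) * (f 0 / 2) = 2 ^ m * f 0 := by
    push_cast; field_simp; ring
  rw [h3]
  nlinarith

end IsLogConcave

/-! ### Moment inequalities for convex bodies. -/

theorem nonneg_of_hasDerivAt_of_le_left {P : ℝ → ℝ} {P' a : ℝ} (hP : HasDerivAt P P' a) {b : ℝ}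
    (hb : b < a) (h : ∀ s ∈ Ioo b a, P s ≤ P a) : 0 ≤ P' := by
  have ht := (hasDerivAt_iff_tendsto_slope.1 hP).mono_left
    (nhdsWithin_mono a fun s (hs : s ∈ Iio a) => ne_of_lt hs)
  refine ge_of_tendsto ht ?_
  filter_upwards [Ioo_mem_nhdsLT hb] with s hs
  rw [slope_def_field]
  exact div_nonneg_of_nonpos (by linarith [h s hs]) (by linarith [hs.2])

section ConvexBody

variable {d : ℕ} {K : Set (EuclideanSpace ℝ (Fin d))} {R : ℝ}

theorem Continuous.integrableOn_of_subset_closedBall {q : EuclideanSpace ℝ (Fin d) → ℝ}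
    (hq : Continuous q) (hb : K ⊆ Metric.closedBall 0 R) : IntegrableOn q K :=
  (hq.continuousOn.integrableOn_compact (isCompact_closedBall 0 R)).mono_set hb

/-- Contracting a convex body towards one of its points decreases integrals of nonnegative
functions; this is the infinitesimal form for quadratic functions of a linear functional. -/
theorem Convex.moment_inequality (hK : Convex ℝ K) (hb : K ⊆ Metric.closedBall 0 R)
    {x : EuclideanSpace ℝ (Fin d)} (hx : x ∈ K) (l : EuclideanSpace ℝ (Fin d) →L[ℝ] ℝ) {α β γ : ℝ}
    (hQ : ∀ y ∈ K, 0 ≤ α + β * l y + γ * l y ^ 2) :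
    0 ≤ d * (α * (∫ _ in K, (1 : ℝ)) + β * (∫ y in K, l y) + γ * ∫ y in K, l y ^ 2) +
      β * ((∫ y in K, l y) - l x * ∫ _ in K, (1 : ℝ)) +
      2 * γ * ((∫ y in K, l y ^ 2) - l x * ∫ y in K, l y) := by
  have i0 : IntegrableOn (fun _ => (1 : ℝ)) K := continuous_const.integrableOn_of_subset_closedBall hb
  have i1 : IntegrableOn (fun y => l y) K := l.continuous.integrableOn_of_subset_closedBall hb
  have i2 : IntegrableOn (fun y => l y ^ 2) K :=
    (l.continuous.pow 2).integrableOn_of_subset_closedBall hb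
  have hKm : NullMeasurableSet K := hK.nullMeasurableSet volume
  set V := ∫ _ in K, (1 : ℝ)
  set m1 := ∫ y in K, l y
  set m2 := ∫ y in K, l y ^ 2
  have hquad : ∀ A B C : ℝ, ∫ y in K, (A + B * l y + C * l y ^ 2) = A * V + B * m1 + C * m2 := by
    intro A B C
    have e : ∀ y, A + B * l y + C * l y ^ 2 = A * 1 + B * l y + C * l y ^ 2 := fun y => by ring
    simp_rw [e]
    have i01 : IntegrableOn (fun y => A * 1 + B * l y) K := (i0.const_mul A).add (i1.const_mul B)
    rw [integral_add i01 (i2.const_mul C), integral_add (i0.const_mul A) (i1.const_mul B), integral_const_mul, integral_const_mul,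
      integral_const_mul]
  set h := l x
  -- For 0 < s ≤ 1, `P s` is the integral of α + β l + γ l² over the contracted body (1-s)x + sK. It
  -- is at most `P 1`, so the derivative at 1 is nonnegative.
  set P : ℝ → ℝ := fun s => s ^ d * ((α + β * ((1 - s) * h) + γ * ((1 - s) * h) ^ 2) * V +
    (β * s + 2 * γ * (s * ((1 - s) * h))) * m1 + γ * s ^ 2 * m2) with hP
  have hle : ∀ s ∈ Ioo (0 : ℝ) 1, P s ≤ P 1 := by
    intro s hs
    set F : EuclideanSpace ℝ (Fin d) → ℝ := K.indicator fun y => α + β * l y + γ * l y ^ 2 with hF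
    have hFnn : ∀ y, 0 ≤ F y := fun y => indicator_nonneg hQ y
    have hFi : Integrable F := by
      exact (Continuous.integrableOn_of_subset_closedBall (by fun_prop) hb).integrable_indicator₀ hKm
    have h1 := IsLogConcave.integral_smul_comp F ((1 - s) • x) hs.1
    have h2 : ∫ y, F y = α * V + β * m1 + γ * m2 := by
      rw [hF, integral_indicator₀ hKm, hquad]
    have h3 : ∫ y in K, ((α + β * ((1 - s) * h) + γ * ((1 - s) * h) ^ 2) +
        (β * s + 2 * γ * (s * ((1 - s) * h))) * l y + γ * s ^ 2 * l y ^ 2) ≤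
        ∫ y, F ((1 - s) • x + s • y) := by
      rw [← integral_indicator₀ hKm]
      refine integral_mono ?_ ((hFi.comp_add_left ((1 - s) • x)).comp_smul hs.1.ne') fun y => ?_
      · exact (Continuous.integrableOn_of_subset_closedBall (by fun_prop) hb).integrable_indicator₀ hKm
      · by_cases hy : y ∈ K
        · have hmem : (1 - s) • x + s • y ∈ K :=
            hK hx hy (by linarith [hs.2]) hs.1.le (by ring)
          rw [indicator_of_mem hy]
          simp only [hF]
          rw [indicator_of_mem hmem, map_add, map_smul, map_smul, smul_eq_mul, smul_eq_mul]
          apply le_of_eq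
          ring
        · rw [indicator_of_notMem hy]
          exact hFnn _
    rw [hquad] at h3
    have h4 := mul_le_mul_of_nonneg_left h3 (pow_nonneg hs.1.le d)
    rw [h1, h2] at h4
    refine h4.trans_eq ?_
    simp only [hP]
    ring
  have hder : HasDerivAt P (d * (α * V + β * m1 + γ * m2) + β * (m1 - h * V) + 2 * γ * (m2 - h * m1)) 1 := by
    have hs : HasDerivAt (fun s : ℝ => s) 1 1 := hasDerivAt_id 1
    have hu : HasDerivAt (fun s : ℝ => (1 - s) * h) (-h) 1 := by
      simpa using (hs.const_sub 1).mul_const h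
    have hA := (((hu.const_mul β).const_add α).add ((hu.pow 2).const_mul γ)).mul_const V
    have hB := ((hs.const_mul β).add ((hs.mul hu).const_mul (2 * γ))).mul_const m1
    have hC := ((hs.pow 2).const_mul γ).mul_const m2
    have := (hs.pow d).mul ((hA.add hB).add hC)
    refine HasDerivAt.congr_deriv (f := P) this ?_
    simp
    ring
  exact nonneg_of_hasDerivAt_of_le_left hder zero_lt_one hle

/-- Apply the moment inequality to (l + t)². The shift t = l(x)/d is optimal and yields the constant
d(d+2) ≤ (d+1)². -/
theorem Convex.sq_mul_volume_le (hd : d ≠ 0) (hK : Convex ℝ K) (hb : K ⊆ Metric.closedBall 0 R)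
    {x : EuclideanSpace ℝ (Fin d)} (hx : x ∈ K) (l : EuclideanSpace ℝ (Fin d) →L[ℝ] ℝ)
    (hm : ∫ y in K, l y = 0) :
    l x ^ 2 * (∫ _ in K, (1 : ℝ)) ≤ ((d : ℝ) + 1) ^ 2 * ∫ y in K, l y ^ 2 := by
  have hd' : (0 : ℝ) < d := by positivity
  have h := hK.moment_inequality hb hx l (α := (l x / d) ^ 2) (β := 2 * (l x / d)) (γ := 1)
    fun y _ => by nlinarith [sq_nonneg (l y + l x / d)]
  have hm2 : 0 ≤ ∫ y in K, l y ^ 2 := integral_nonneg fun y => sq_nonneg _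
  rw [hm] at h
  set V := ∫ _ in K, (1 : ℝ)
  set m2 := ∫ y in K, l y ^ 2
  have e : (d : ℝ) * ((l x / d) ^ 2 * V + 2 * (l x / d) * 0 + 1 * m2) + 2 * (l x / d) * (0 - l x * V) +
      2 * 1 * (m2 - l x * 0) = (d + 2) * m2 - l x ^ 2 * V / d := by field_simp; ring
  rw [e, sub_nonneg, div_le_iff₀ hd'] at h
  nlinarith

/-- The moment inequality for h - l gives l ≥ -dh on K. Then (h - l)(l + dh) ≥ 0 is integrated, and
its linear term vanishes. -/
theorem Convex.second_moment_le (hK : Convex ℝ K) (hb : K ⊆ Metric.closedBall 0 R)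
    (hV : 0 < ∫ _ in K, (1 : ℝ)) (l : EuclideanSpace ℝ (Fin d) →L[ℝ] ℝ)
    (hm : ∫ y in K, l y = 0) {h : ℝ} (hh : ∀ y ∈ K, l y ≤ h) :
    ∫ y in K, l y ^ 2 ≤ d * h ^ 2 * ∫ _ in K, (1 : ℝ) := by
  have hlow : ∀ y ∈ K, -(d * h) ≤ l y := by
    intro y hy
    have := hK.moment_inequality hb hy l (α := h) (β := -1) (γ := 0) fun y hy => by linarith [hh y hy]
    rw [hm] at this
    have h2 : 0 ≤ (d * h + l y) * ∫ _ in K, (1 : ℝ) := by linarith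
    have := nonneg_of_mul_nonneg_left h2 hV
    linarith
  have i0 : IntegrableOn (fun _ => (1 : ℝ)) K := continuous_const.integrableOn_of_subset_closedBall hb
  have i1 : IntegrableOn (fun y => l y) K := l.continuous.integrableOn_of_subset_closedBall hb
  have i2 : IntegrableOn (fun y => l y ^ 2) K :=
    (l.continuous.pow 2).integrableOn_of_subset_closedBall hb
  have hKm : NullMeasurableSet K := hK.nullMeasurableSet volume
  have h0 : 0 ≤ ∫ y in K, (d * h ^ 2 * 1 + ((1 - d) * h * l y - l y ^ 2)) := by
    rw [← integral_indicator₀ hKm]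
    refine integral_nonneg fun y => indicator_nonneg (fun y hy => ?_) y
    have := mul_nonneg (sub_nonneg.2 (hh y hy)) (by linarith [hlow y hy] : 0 ≤ l y + d * h)
    nlinarith
  have i12 : IntegrableOn (fun y => (1 - d) * h * l y - l y ^ 2) K := (i1.const_mul _).sub i2
  rw [integral_add (i0.const_mul _) i12, integral_sub (i1.const_mul _) i2,
    integral_const_mul, integral_const_mul, hm] at h0
  linarith

end ConvexBody

/-! ### Covariance of the density and moments of the bodies. -/

namespace IsLogConcave

variable {d : ℕ} {f : EuclideanSpace ℝ (Fin d) → ℝ}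

theorem integrable_coord_mul_coord (hf : IsLogConcave f) (hm : HasPosMass f) (i j : Fin d) :
    Integrable fun x : EuclideanSpace ℝ (Fin d) => x i * x j * f x := by
  refine hf.integrable_mul_of_norm_le hm 2 (C := 1) (by fun_prop) fun x => ?_
  rw [abs_mul, one_mul, pow_two]
  have h1 : |x i| ≤ ‖x‖ := PiLp.norm_apply_le x i
  have h2 : |x j| ≤ ‖x‖ := PiLp.norm_apply_le x j
  gcongr

theorem integrable_coord_mul (hf : IsLogConcave f) (hm : HasPosMass f) (i : Fin d) :
    Integrable fun x : EuclideanSpace ℝ (Fin d) => x i * f x := by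
  refine hf.integrable_mul_of_norm_le hm 1 (C := 1) (by fun_prop) fun x => ?_
  rw [one_mul, pow_one]
  exact PiLp.norm_apply_le x i

theorem integral_coord_mul_eq_zero (hf : IsLogConcave f) (hm : HasPosMass f) (hc : IsCentered f)
    (i : Fin d) : ∫ x : EuclideanSpace ℝ (Fin d), x i * f x = 0 := by
  have := hf.integral_linear_mul hm (EuclideanSpace.proj i)
  rw [show ∫ x, f x • x = 0 from hc, map_zero] at this
  exact this

theorem integral_inner_sq_mul (hf : IsLogConcave f) (hm : HasPosMass f) (v : EuclideanSpace ℝ (Fin d)) :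
    ∫ x, inner ℝ v x ^ 2 * f x = ∑ i, ∑ j, v i * v j * ∫ x : EuclideanSpace ℝ (Fin d), x i * x j * f x := by
  have e : ∀ x : EuclideanSpace ℝ (Fin d), inner ℝ v x ^ 2 * f x =
      ∑ i, ∑ j, v i * v j * (x i * x j * f x) := by
    intro x
    rw [PiLp.inner_apply, pow_two, Finset.sum_mul_sum, Finset.sum_mul]
    refine Finset.sum_congr rfl fun i _ => ?_
    rw [Finset.sum_mul]
    refine Finset.sum_congr rfl fun j _ => ?_
    simp only [RCLike.inner_apply, conj_trivial]
    ring
  simp_rw [e]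
  rw [integral_finsetSum _ fun i _ => integrable_finsetSum _ fun j _ =>
    (hf.integrable_coord_mul_coord hm i j).const_mul _]
  refine Finset.sum_congr rfl fun i _ => ?_
  rw [integral_finsetSum _ fun j _ => (hf.integrable_coord_mul_coord hm i j).const_mul _]
  refine Finset.sum_congr rfl fun j _ => ?_
  rw [integral_const_mul]

theorem integral_inner_sq_mul_of_isotropic (hf : IsLogConcave f) (hm : HasPosMass f)
    (hc : IsCentered f) (h1 : ∫ x, f x = 1) {σ : ℝ}
    (hσ : covMatrix f = σ ^ 2 • (1 : Matrix (Fin d) (Fin d) ℝ)) (v : EuclideanSpace ℝ (Fin d)) :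
    ∫ x, inner ℝ v x ^ 2 * f x = σ ^ 2 * ‖v‖ ^ 2 := by
  have hij : ∀ i j, ∫ x : EuclideanSpace ℝ (Fin d), x i * x j * f x = if i = j then σ ^ 2 else 0 := by
    intro i j
    have := congrFun (congrFun hσ i) j
    simp only [covMatrix, Matrix.of_apply, h1, hf.integral_coord_mul_eq_zero hm hc, Matrix.smul_apply,
      Matrix.one_apply] at this
    simpa using this
  rw [hf.integral_inner_sq_mul hm]
  simp_rw [hij]
  simp only [mul_ite, mul_zero, Finset.sum_ite_eq, Finset.mem_univ, if_true]
  rw [EuclideanSpace.norm_sq_eq, Finset.mul_sum]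
  refine Finset.sum_congr rfl fun i _ => ?_
  rw [Real.norm_eq_abs, sq_abs]; ring

theorem volume_ballBody (hf : IsLogConcave f) (hm : HasPosMass f) (hf0 : 0 < f 0) (hd : d ≠ 0) :
    f 0 * ∫ _ in ballBody (d : ℝ) f, (1 : ℝ) = ∫ x, f x := by
  have := hf.mul_setIntegral_ballBody hm hf0 hd (h := fun _ => 1) continuous_const
    (fun _ => zero_le_one) (k := 0) (by simp)
  simpa using this

/-- The transfer identity is for nonnegative functions, so `l` is split into the positive parts of
`l` and `-l`, both homogeneous of degree 1. -/
theorem integral_ballBody_linear (hf : IsLogConcave f) (hm : HasPosMass f) (hc : IsCentered f)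
    (hd : d ≠ 0) (l : EuclideanSpace ℝ (Fin d) →L[ℝ] ℝ) :
    ∫ y in ballBody ((d + 1 : ℕ) : ℝ) f, l y = 0 := by
  have hf0 := hf.apply_zero_pos hm hc
  obtain ⟨R, -, hR⟩ := hf.exists_norm_le_of_mem_ballBody hm hf0 (n := d + 1) (by simp)
  have h1 : ∀ l : EuclideanSpace ℝ (Fin d) →L[ℝ] ℝ,
      f 0 * ∫ y in ballBody ((d + 1 : ℕ) : ℝ) f, max (l y) 0 = ∫ x, max (l x) 0 * f x := by
    intro l
    refine hf.mul_setIntegral_ballBody hm hf0 hd (by fun_prop) (fun x => le_max_right _ _) (k := 1) ?_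
    intro r hr x
    rw [map_smul, smul_eq_mul, pow_one, mul_max_of_nonneg _ _ hr.le, mul_zero]
  have hdecomp : ∀ y, l y = max (l y) 0 - max ((-l) y) 0 := by
    intro y
    rw [show (-l) y = -(l y) from rfl]
    rcases le_total 0 (l y) with h | h
    · rw [max_eq_left h, max_eq_right (by linarith), sub_zero]
    · rw [max_eq_right h, max_eq_left (by linarith)]; ring
  have hint : ∀ l : EuclideanSpace ℝ (Fin d) →L[ℝ] ℝ, Integrable fun x => max (l x) 0 * f x := fun l =>
    hf.integrable_mul_of_norm_le hm 1 (C := ‖l‖) (by fun_prop) fun x => by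
      rw [pow_one]
      refine le_trans ?_ (l.le_opNorm x)
      rw [Real.norm_eq_abs, abs_of_nonneg (le_max_right _ _)]
      exact max_le (le_abs_self _) (abs_nonneg _)
  have hlin := hf.integral_linear_mul hm l
  rw [show ∫ x, f x • x = 0 from hc, map_zero] at hlin
  have h2 : f 0 * ∫ y in ballBody ((d + 1 : ℕ) : ℝ) f, l y = 0 := by
    calc f 0 * ∫ y in ballBody ((d + 1 : ℕ) : ℝ) f, l y
        = f 0 * ((∫ y in ballBody ((d + 1 : ℕ) : ℝ) f, max (l y) 0) -
            ∫ y in ballBody ((d + 1 : ℕ) : ℝ) f, max ((-l) y) 0) := by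
          rw [← integral_sub (Continuous.integrableOn_of_subset_closedBall (by fun_prop) hR)
            (Continuous.integrableOn_of_subset_closedBall (by fun_prop) hR)]
          simp_rw [← hdecomp]
      _ = ∫ x, l x * f x := by
          rw [mul_sub, h1, h1, ← integral_sub (hint l) (hint (-l))]
          simp_rw [← sub_mul, ← hdecomp]
      _ = 0 := hlin
  exact (mul_eq_zero.1 h2).resolve_left hf0.ne'

theorem integral_ballBody_inner_sq (hf : IsLogConcave f) (hm : HasPosMass f) (hf0 : 0 < f 0)
    (hd : d ≠ 0) (v : EuclideanSpace ℝ (Fin d)) :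
    f 0 * ∫ y in ballBody ((d + 2 : ℕ) : ℝ) f, inner ℝ v y ^ 2 = ∫ x, inner ℝ v x ^ 2 * f x := by
  refine hf.mul_setIntegral_ballBody hm hf0 hd (by fun_prop) (fun x => sq_nonneg _) (k := 2) ?_
  intro r hr x
  rw [inner_smul_right, mul_pow]

/-- Monotonicity of integrals of homogeneous functions under scaled inclusions. -/
theorem setIntegral_le_of_subset_smul {h : EuclideanSpace ℝ (Fin d) → ℝ} (hcont : Continuous h)
    (hnn : ∀ x, 0 ≤ h x) {k : ℕ} (hh : ∀ r : ℝ, 0 < r → ∀ x, h (r • x) = r ^ k * h x)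
    {K K' : Set (EuclideanSpace ℝ (Fin d))} {R c : ℝ} (hc : 0 < c)
    (hb : K' ⊆ Metric.closedBall 0 R) (hsub : K ⊆ c • K') :
    ∫ x in K, h x ≤ c ^ (d + k) * ∫ x in K', h x := by
  rw [← setIntegral_smul_of_homogeneous hh hc]
  have hb' : c • K' ⊆ Metric.closedBall 0 (c * R) := by
    rintro _ ⟨y, hy, rfl⟩
    have := mem_closedBall_zero_iff.1 (hb hy)
    rw [mem_closedBall_zero_iff]
    change ‖c • y‖ ≤ _
    rw [norm_smul, Real.norm_of_nonneg hc.le]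
    gcongr
  exact setIntegral_mono_set (hcont.integrableOn_of_subset_closedBall hb')
    (Filter.Eventually.of_forall fun x => hnn x) hsub.eventuallyLE

end IsLogConcave

/-! ### Factorial estimates. -/

theorem two_pow_le_factorial_sq {d : ℕ} (hd : 2 ≤ d) : 2 ^ d ≤ d.factorial ^ 2 := by
  induction d, hd using Nat.le_induction with
  | base => decide
  | succ n hn ih =>
    rw [Nat.factorial_succ, mul_pow, pow_succ]
    calc 2 ^ n * 2 ≤ n.factorial ^ 2 * 2 := by gcongr
      _ ≤ n.factorial ^ 2 * (n + 1) ^ 2 := by gcongr; nlinarith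
      _ = _ := mul_comm _ _

theorem mul_mul_le_two_pow {d : ℕ} (hd : 2 ≤ d) : d * (d + 1) * (d + 2) ≤ 2 ^ (d + 3) := by
  induction d, hd using Nat.le_induction with
  | base => decide
  | succ n hn ih =>
    rcases hn.eq_or_lt with rfl | hn
    · decide
    · rw [show n + 1 + 3 = (n + 3) + 1 from rfl, pow_succ]
      nlinarith [Nat.mul_le_mul_right ((n + 1) * (n + 2)) (show n + 3 ≤ 2 * n by omega)]

/-- The product telescopes, and its power is (d!)^{2/d} / ((d+1)(d+2)). This absorbs the factor d of
`Convex.second_moment_le`. -/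
theorem borellConst_mul_pow_ge {d : ℕ} (hd : d ≠ 0) :
    (d : ℝ) ≤ 2 ^ (d + 2) * (borellConst d * borellConst (d + 1)) ^ (d + 2) := by
  set a : ℝ := (d.factorial : ℝ) ^ ((d : ℝ)⁻¹) with ha
  set b : ℝ := ((d + 2).factorial : ℝ) ^ (((d + 2 : ℕ) : ℝ)⁻¹) with hb
  have ha0 : 0 < a := by positivity
  have hb0 : 0 < b := by positivity
  have had : a ^ d = d.factorial := Real.rpow_inv_natCast_pow (by positivity) hd
  have hbd : b ^ (d + 2) = (d + 2).factorial := Real.rpow_inv_natCast_pow (by positivity) (by simp)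
  have hprod : borellConst d * borellConst (d + 1) = a / b := by
    unfold borellConst
    rw [div_mul_div_cancel₀ (by positivity)]
  have hfac : ((d + 2).factorial : ℝ) = (d + 2) * (d + 1) * d.factorial := by
    rw [Nat.factorial_succ, Nat.factorial_succ]; push_cast; ring
  have hf0 : (0 : ℝ) < d.factorial := by positivity
  have hpow : (a / b) ^ (d + 2) = a ^ 2 / ((d + 2) * (d + 1)) := by
    rw [div_pow, hbd, pow_add, had, hfac]; field_simp
  rw [hprod, hpow, mul_div_assoc', le_div_iff₀ (by positivity)]
  -- The estimate (d!)^{2/d} ≥ 2 fails at d = 1, which is computed directly.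
  rcases Nat.lt_or_ge d 2 with h | h
  · have : d = 1 := by omega
    subst this
    simp [ha]
    norm_num
  · have h1 : (d : ℝ) * (d + 1) * (d + 2) ≤ 2 ^ (d + 3) := by exact_mod_cast mul_mul_le_two_pow h
    have h2 : (2 : ℝ) ≤ a ^ 2 := by
      refine le_of_pow_le_pow_left₀ hd (by positivity) ?_
      rw [← pow_mul, mul_comm, pow_mul, had]
      exact_mod_cast two_pow_le_factorial_sq h
    calc (d : ℝ) * ((d + 2) * (d + 1)) = d * (d + 1) * (d + 2) := by ring
      _ ≤ 2 ^ (d + 3) := h1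
      _ = 2 ^ (d + 2) * 2 := by rw [pow_succ]
      _ ≤ _ := by gcongr

/-! ### Outer radius, inner radius and the entropy bound. -/

namespace IsLogConcave

variable {d : ℕ} {f : EuclideanSpace ℝ (Fin d) → ℝ} {σ : ℝ} {x : EuclideanSpace ℝ (Fin d)}

theorem setIntegral_one_ballBody_pos (hf : IsLogConcave f) (hm : HasPosMass f) (hc : IsCentered f)
    {n : ℕ} (hn : n ≠ 0) : 0 < ∫ _ in ballBody (n : ℝ) f, (1 : ℝ) := by
  have hf0 := hf.apply_zero_pos hm hc
  obtain ⟨R, -, hR⟩ := hf.exists_norm_le_of_mem_ballBody hm hf0 hn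
  rw [setIntegral_const, smul_eq_mul, mul_one]
  refine ENNReal.toReal_pos ?_ ((measure_mono hR).trans_lt measure_closedBall_lt_top).ne
  have hne : (interior (ballBody (n : ℝ) f)).Nonempty := ⟨0, hf.zero_mem_interior_ballBody hm hc hn⟩
  exact ((isOpen_interior.measure_pos volume hne).trans_le (measure_mono interior_subset)).ne'

/-- Take l = ⟨x, ·⟩ in `Convex.sq_mul_volume_le`. Through K_d the volume of K_{d+1} is at least
c^{-d}/f(0), and through K_{d+2} its second moment along x is at most c^{d+2} σ² ‖x‖²/f(0). -/
theorem norm_le_of_mem_ballBody_succ (hf : IsLogConcave f) (hm : HasPosMass f) (hc : IsCentered f)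
    (h1 : ∫ x, f x = 1) (hd : d ≠ 0) (hσ0 : 0 < σ)
    (hσ : covMatrix f = σ ^ 2 • (1 : Matrix (Fin d) (Fin d) ℝ)) {c : ℝ} (hc0 : 0 < c)
    (hsub1 : ballBody (d : ℝ) f ⊆ c • ballBody ((d + 1 : ℕ) : ℝ) f)
    (hsub2 : ballBody ((d + 1 : ℕ) : ℝ) f ⊆ c • ballBody ((d + 2 : ℕ) : ℝ) f)
    (hx : x ∈ ballBody ((d + 1 : ℕ) : ℝ) f) : ‖x‖ ≤ ((d : ℝ) + 1) * c ^ (d + 1) * σ := by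
  have hf0 := hf.apply_zero_pos hm hc
  rcases eq_or_ne x 0 with rfl | hx0
  · rw [norm_zero]; positivity
  have hx' : 0 < ‖x‖ := norm_pos_iff.2 hx0
  obtain ⟨R₁, -, hR₁⟩ := hf.exists_norm_le_of_mem_ballBody hm hf0 (n := d + 1) (by simp)
  obtain ⟨R₂, -, hR₂⟩ := hf.exists_norm_le_of_mem_ballBody hm hf0 (n := d + 2) (by simp)
  have hK := hf.convex_ballBody hm hf0 (n := d + 1) (by simp)
  have hkls := hK.sq_mul_volume_le hd hR₁ hx (innerSL ℝ x) (hf.integral_ballBody_linear hm hc hd _)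
  simp only [innerSL_apply_apply, real_inner_self_eq_norm_sq] at hkls
  have hvol := hf.volume_ballBody hm hf0 hd
  have hm2 := hf.integral_ballBody_inner_sq hm hf0 hd x
  rw [hf.integral_inner_sq_mul_of_isotropic hm hc h1 hσ] at hm2
  have hV := setIntegral_le_of_subset_smul (h := fun _ => 1) continuous_const (fun _ => zero_le_one)
    (k := 0) (by simp) hc0 hR₁ hsub1
  have hM := setIntegral_le_of_subset_smul (h := fun y => inner ℝ x y ^ 2) (by fun_prop)
    (fun _ => sq_nonneg _) (k := 2) (fun r hr y => by rw [inner_smul_right, mul_pow]) hc0 hR₂ hsub2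
  set V := ∫ _ in ballBody ((d + 1 : ℕ) : ℝ) f, (1 : ℝ)
  set m2 := ∫ y in ballBody ((d + 1 : ℕ) : ℝ) f, inner ℝ x y ^ 2
  rw [h1] at hvol
  have hV' : 1 ≤ c ^ d * (f 0 * V) := by
    rw [← hvol]
    calc _ ≤ f 0 * (c ^ (d + 0) * V) := by gcongr
      _ = _ := by rw [add_zero]; ring
  have hM' : f 0 * m2 ≤ c ^ (d + 2) * (σ ^ 2 * ‖x‖ ^ 2) := by
    rw [← hm2]
    calc _ ≤ f 0 * (c ^ (d + 2) * _) := by gcongr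
      _ = _ := by ring
  have h4 : ‖x‖ ^ 2 * ‖x‖ ^ 2 ≤ ‖x‖ ^ 2 * (((d : ℝ) + 1) * c ^ (d + 1) * σ) ^ 2 := by
    calc ‖x‖ ^ 2 * ‖x‖ ^ 2 ≤ ‖x‖ ^ 2 * ‖x‖ ^ 2 * (c ^ d * (f 0 * V)) :=
          le_mul_of_one_le_right (by positivity) hV'
      _ = c ^ d * f 0 * ((‖x‖ ^ 2) ^ 2 * V) := by ring
      _ ≤ c ^ d * f 0 * (((d : ℝ) + 1) ^ 2 * m2) := by gcongr
      _ = c ^ d * ((d : ℝ) + 1) ^ 2 * (f 0 * m2) := by ring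
      _ ≤ c ^ d * ((d : ℝ) + 1) ^ 2 * (c ^ (d + 2) * (σ ^ 2 * ‖x‖ ^ 2)) := by gcongr
      _ = _ := by ring
  exact le_of_pow_le_pow_left₀ two_ne_zero (by positivity) (le_of_mul_le_mul_left h4 (by positivity))

/-- A functional separating x from the body bounds its height by ‖v‖ ‖x‖, hence its second moment by
`Convex.second_moment_le`. The volume and second moment are again read off K_d and K_{d+2}, now with
the sharp constants. -/
theorem sq_le_of_notMem_ballBody_succ (hf : IsLogConcave f) (hm : HasPosMass f) (hc : IsCentered f)
    (h1 : ∫ x, f x = 1) (hd : d ≠ 0)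
    (hσ : covMatrix f = σ ^ 2 • (1 : Matrix (Fin d) (Fin d) ℝ))
    (hx : x ∉ ballBody ((d + 1 : ℕ) : ℝ) f) :
    borellConst (d + 1) ^ (d + 2) * borellConst d ^ d * σ ^ 2 ≤ d * ‖x‖ ^ 2 := by
  have hf0 := hf.apply_zero_pos hm hc
  obtain ⟨R₀, -, hR₀⟩ := hf.exists_norm_le_of_mem_ballBody hm hf0 hd
  obtain ⟨R₁, -, hR₁⟩ := hf.exists_norm_le_of_mem_ballBody hm hf0 (n := d + 1) (by simp)
  obtain ⟨R₂, -, hR₂⟩ := hf.exists_norm_le_of_mem_ballBody hm hf0 (n := d + 2) (by simp)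
  have hK := hf.convex_ballBody hm hf0 (n := d + 1) (by simp)
  have h0 := hf.zero_mem_interior_ballBody hm hc (n := d + 1) (by simp)
  set K := ballBody ((d + 1 : ℕ) : ℝ) f with hKdef
  obtain ⟨g, hg⟩ := geometric_hahn_banach_open_point hK.interior isOpen_interior
    (fun h => hx (interior_subset h))
  have hgx : 0 < g x := by simpa using hg 0 h0
  have hgK : ∀ y ∈ K, g y ≤ g x := by
    intro y hy
    have hcl : K ⊆ closure (interior K) := by
      rw [hK.closure_interior_eq_closure_of_nonempty_interior ⟨0, h0⟩]; exact subset_closure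
    exact closure_minimal (fun z hz => (hg z hz).le) (isClosed_le g.continuous continuous_const) (hcl hy)
  set v := (InnerProductSpace.toDual ℝ (EuclideanSpace ℝ (Fin d))).symm g with hv
  have hgv : ∀ y, g y = inner ℝ v y := fun y => by
    rw [hv, InnerProductSpace.toDual_symm_apply]
  have hVpos := hf.setIntegral_one_ballBody_pos hm hc (n := d + 1) (by simp)
  have hkls := hK.second_moment_le hR₁ hVpos g (hf.integral_ballBody_linear hm hc hd g) hgK
  have hv0 : 0 < ‖v‖ := by
    rw [norm_pos_iff]
    intro h
    rw [hgv, h, inner_zero_left] at hgx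
    exact lt_irrefl _ hgx
  have hcs : g x ≤ ‖v‖ * ‖x‖ := by rw [hgv]; exact real_inner_le_norm v x
  simp only [hgv] at hkls
  rw [← hgv] at hkls
  have hvol := hf.volume_ballBody hm hf0 hd
  have hm2 := hf.integral_ballBody_inner_sq hm hf0 hd v
  rw [hf.integral_inner_sq_mul_of_isotropic hm hc h1 hσ] at hm2
  rw [h1] at hvol
  have hk0 := borellConst_pos d
  have hk1 := borellConst_pos (d + 1)
  have hincl : ∀ {n : ℕ}, n ≠ 0 → ballBody ((n + 1 : ℕ) : ℝ) f ⊆ (borellConst n)⁻¹ • ballBody (n : ℝ) f := by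
    intro n hn y hy
    rw [mem_smul_set_iff_inv_smul_mem₀ (inv_ne_zero (borellConst_pos n).ne'), inv_inv]
    exact hf.smul_ballBody_subset hm hf0 hn (borellConst_pos n) le_rfl (smul_mem_smul_set hy)
  have hV := setIntegral_le_of_subset_smul (h := fun _ => 1) continuous_const (fun _ => zero_le_one)
    (k := 0) (by simp) (inv_pos.2 hk0) hR₀ (hincl hd)
  have hM := setIntegral_le_of_subset_smul (h := fun y => inner ℝ v y ^ 2) (by fun_prop)
    (fun _ => sq_nonneg _) (k := 2) (fun r hr y => by rw [inner_smul_right, mul_pow])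
    (inv_pos.2 hk1) hR₁ (hincl (n := d + 1) (by simp))
  set V := ∫ _ in K, (1 : ℝ)
  set m2 := ∫ y in K, inner ℝ v y ^ 2
  have hV' : borellConst d ^ d * (f 0 * V) ≤ 1 := by
    rw [add_zero, inv_pow, ← div_eq_inv_mul, le_div_iff₀ (by positivity)] at hV
    rw [← hvol]
    calc _ = f 0 * (V * borellConst d ^ d) := by ring
      _ ≤ _ := by gcongr
  have hM' : borellConst (d + 1) ^ (d + 2) * (σ ^ 2 * ‖v‖ ^ 2) ≤ f 0 * m2 := by
    rw [← hm2]
    rw [inv_pow, ← div_eq_inv_mul, le_div_iff₀ (by positivity)] at hM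
    calc _ = f 0 * (_ * borellConst (d + 1) ^ (d + 2)) := by ring
      _ ≤ _ := mul_le_mul_of_nonneg_left hM hf0.le
  have h4 : ‖v‖ ^ 2 * (borellConst (d + 1) ^ (d + 2) * borellConst d ^ d * σ ^ 2) ≤
      ‖v‖ ^ 2 * (d * ‖x‖ ^ 2) := by
    calc _ = borellConst d ^ d * (borellConst (d + 1) ^ (d + 2) * (σ ^ 2 * ‖v‖ ^ 2)) := by ring
      _ ≤ borellConst d ^ d * (f 0 * (d * g x ^ 2 * V)) := by
          refine mul_le_mul_of_nonneg_left (hM'.trans ?_) (by positivity)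
          gcongr
      _ = d * g x ^ 2 * (borellConst d ^ d * (f 0 * V)) := by ring
      _ ≤ d * g x ^ 2 * 1 := by gcongr
      _ ≤ d * (‖v‖ * ‖x‖) ^ 2 * 1 := by gcongr
      _ = _ := by ring
  exact le_of_mul_le_mul_left h4 (by positivity)

/-- `K_d(f)` contains a ball of radius proportional to `σ`. -/
theorem sq_le_of_notMem_ballBody (hf : IsLogConcave f) (hm : HasPosMass f) (hc : IsCentered f)
    (h1 : ∫ x, f x = 1) (hd : d ≠ 0)
    (hσ : covMatrix f = σ ^ 2 • (1 : Matrix (Fin d) (Fin d) ℝ))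
    (hx : x ∉ ballBody (d : ℝ) f) : σ ^ 2 ≤ 2 ^ (d + 2) * ‖x‖ ^ 2 := by
  have hf0 := hf.apply_zero_pos hm hc
  have hk := borellConst_pos d
  have hx2 : (borellConst d)⁻¹ • x ∉ ballBody ((d + 1 : ℕ) : ℝ) f := by
    intro h
    have := hf.smul_ballBody_subset hm hf0 hd hk le_rfl (smul_mem_smul_set h)
    rw [smul_inv_smul₀ hk.ne'] at this
    exact hx this
  have h := hf.sq_le_of_notMem_ballBody_succ hm hc h1 hd hσ hx2
  rw [norm_smul, norm_inv, Real.norm_of_nonneg hk.le, mul_pow, inv_pow, mul_left_comm,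
    ← div_eq_inv_mul, le_div_iff₀ (by positivity)] at h
  have h2 : (borellConst d * borellConst (d + 1)) ^ (d + 2) * σ ^ 2 ≤ d * ‖x‖ ^ 2 := by
    refine le_trans (le_of_eq ?_) h
    rw [mul_pow, pow_add (borellConst d)]; ring
  have hd' : (0 : ℝ) < d := by positivity
  have h3 : d * σ ^ 2 ≤ d * (2 ^ (d + 2) * ‖x‖ ^ 2) := by
    calc d * σ ^ 2 ≤ 2 ^ (d + 2) * (borellConst d * borellConst (d + 1)) ^ (d + 2) * σ ^ 2 := by
          gcongr; exact borellConst_mul_pow_ge hd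
      _ = 2 ^ (d + 2) * ((borellConst d * borellConst (d + 1)) ^ (d + 2) * σ ^ 2) := by ring
      _ ≤ 2 ^ (d + 2) * (d * ‖x‖ ^ 2) := by gcongr
      _ = _ := by ring
  exact le_of_mul_le_mul_left h3 hd'

theorem integral_norm_sq_mul_of_isotropic (hf : IsLogConcave f) (hm : HasPosMass f)
    (hc : IsCentered f) (h1 : ∫ x, f x = 1)
    (hσ : covMatrix f = σ ^ 2 • (1 : Matrix (Fin d) (Fin d) ℝ)) :
    ∫ x, ‖x‖ ^ 2 * f x = d * σ ^ 2 := by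
  have e : ∀ x : EuclideanSpace ℝ (Fin d), ‖x‖ ^ 2 * f x = ∑ i, x i * x i * f x := by
    intro x
    rw [EuclideanSpace.norm_sq_eq, Finset.sum_mul]
    refine Finset.sum_congr rfl fun i _ => ?_
    rw [Real.norm_eq_abs, sq_abs]; ring
  simp_rw [e]
  rw [integral_finsetSum _ fun i _ => hf.integrable_coord_mul_coord hm i i]
  have hi : ∀ i, ∫ x : EuclideanSpace ℝ (Fin d), x i * x i * f x = σ ^ 2 := by
    intro i
    have := congrFun (congrFun hσ i) i
    simp only [covMatrix, Matrix.of_apply, h1, hf.integral_coord_mul_eq_zero hm hc, Matrix.smul_apply,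
      Matrix.one_apply] at this
    simpa using this
  simp [hi]

/-- Among densities of given variance the Gaussian has the least entropic supremum bound:
`M^{1/d} σ ≥ 1 / √(2πe)`. -/
theorem one_le_sup_rpow_mul (hf : IsLogConcave f) (hm : HasPosMass f) (hc : IsCentered f)
    (h1 : ∫ x, f x = 1) (hd : d ≠ 0) (hσ0 : 0 < σ)
    (hσ : covMatrix f = σ ^ 2 • (1 : Matrix (Fin d) (Fin d) ℝ)) {M : ℝ} (hM : ∀ x, f x ≤ M) :
    1 ≤ M ^ (1 / (d : ℝ)) * σ * (√(2 * Real.pi) * Real.exp (1 / 2)) := by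
  have hf0 := hf.apply_zero_pos hm hc
  have hM0 : 0 < M := hf0.trans_le (hM 0)
  have hd' : (0 : ℝ) < d := by positivity
  set b : ℝ := 1 / (2 * σ ^ 2) with hb
  have hb0 : 0 < b := by positivity
  have hG := GaussianFourier.integral_rexp_neg_mul_sq_norm (V := EuclideanSpace ℝ (Fin d)) hb0
  rw [finrank_euclideanSpace_fin] at hG
  set Z : ℝ := (Real.pi / b) ^ ((d : ℝ) / 2) with hZ
  have hZ0 : 0 < Z := by positivity
  have hGi : Integrable fun x : EuclideanSpace ℝ (Fin d) => Real.exp (-b * ‖x‖ ^ 2) :=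
    Integrable.of_integral_ne_zero (by rw [hG]; exact hZ0.ne')
  -- With g the Gaussian density of covariance σ² I, this is f log(g/f) ≤ g - f combined with log f
  -- ≤ log M. Integrated, it reads 0 ≤ log M + log Z + d/2.
  have hpt : ∀ x, f x - Z⁻¹ * Real.exp (-b * ‖x‖ ^ 2) ≤
      (Real.log M + Real.log Z) * f x + b * (‖x‖ ^ 2 * f x) := by
    intro x
    set g := Z⁻¹ * Real.exp (-b * ‖x‖ ^ 2) with hg
    have hg0 : 0 < g := by positivity
    have hlg : Real.log g = -Real.log Z - b * ‖x‖ ^ 2 := by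
      rw [hg, Real.log_mul (by positivity) (by positivity), Real.log_inv, Real.log_exp]; ring
    rcases (hf.nonneg x).eq_or_lt with h | h
    · rw [← h]; simp; exact hg0.le
    have h2 : Real.log g - Real.log (f x) ≤ g / f x - 1 := by
      rw [← Real.log_div hg0.ne' h.ne']
      exact Real.log_le_sub_one_of_pos (by positivity)
    have h3 : Real.log (f x) ≤ Real.log M := Real.log_le_log h (hM x)
    have h4 : (Real.log g - Real.log M) * f x ≤ (g / f x - 1) * f x :=
      mul_le_mul_of_nonneg_right (by linarith) h.le
    rw [sub_mul (g / f x), div_mul_cancel₀ _ h.ne', hlg] at h4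
    linarith
  have i2 := (hf.integrable_pow_mul hm 2).const_mul b
  have hint := integral_mono (hm.1.sub (hGi.const_mul Z⁻¹)) ((hm.1.const_mul (Real.log M + Real.log Z)).add i2) hpt
  simp only [Pi.add_apply, Pi.sub_apply] at hint
  rw [integral_sub hm.1 (hGi.const_mul _), integral_add (hm.1.const_mul _) i2, integral_const_mul,
    integral_const_mul, integral_const_mul, hG, h1, hf.integral_norm_sq_mul_of_isotropic hm hc h1 hσ,
    inv_mul_cancel₀ hZ0.ne', sub_self, mul_one] at hint
  have e1 : b * (d * σ ^ 2) = d / 2 := by rw [hb]; field_simp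
  have e2 : Real.log Z = d * (Real.log √(2 * Real.pi) + Real.log σ) := by
    have : Real.pi / b = (√(2 * Real.pi) * σ) ^ 2 := by
      rw [mul_pow, Real.sq_sqrt (by positivity), hb]; field_simp
    rw [hZ, Real.log_rpow (by positivity), this, Real.log_pow, Real.log_mul (by positivity) (by positivity)]
    push_cast; ring
  rw [e1, e2] at hint
  have h5 : 0 ≤ Real.log (M ^ (1 / (d : ℝ)) * σ * (√(2 * Real.pi) * Real.exp (1 / 2))) := by
    rw [Real.log_mul (by positivity) (by positivity), Real.log_mul (by positivity) (by positivity),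
      Real.log_mul (by positivity) (by positivity), Real.log_rpow hM0, Real.log_exp]
    have h6 : 0 ≤ (Real.log M + d * (Real.log √(2 * Real.pi) + Real.log σ) + d / 2) / d := by positivity
    have h7 : (Real.log M + d * (Real.log √(2 * Real.pi) + Real.log σ) + d / 2) / d =
      1 / d * Real.log M + (Real.log √(2 * Real.pi) + Real.log σ) + 1 / 2 := by field_simp
    linarith
  have := Real.exp_le_exp.2 h5
  rwa [Real.exp_zero, Real.exp_log (by positivity)] at this

end IsLogConcave

/-! ### Reduction to centered isotropic densities. -/

theorem iSup_const_mul_comp {E : Type*} {f : E → ℝ} {T : E → E} (hT : Function.Surjective T) {c : ℝ}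
    (hc : 0 ≤ c) : ⨆ x, c * f (T x) = c * ⨆ x, f x := by
  rw [Real.mul_iSup_of_nonneg hc]
  exact hT.iSup_comp fun x => c * f x

open scoped MatrixOrder in
theorem Matrix.PosDef.exists_eq_mul_transpose {n : Type*} [Fintype n] [DecidableEq n]
    {S : Matrix n n ℝ} (hS : S.PosDef) : ∃ A : Matrix n n ℝ, S = A * A.transpose := by
  obtain ⟨B, hB⟩ := CStarAlgebra.nonneg_iff_eq_star_mul_self.mp hS.posSemidef.nonneg
  refine ⟨B.transpose, ?_⟩
  rw [hB, Matrix.transpose_transpose, Matrix.star_eq_conjTranspose,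
    Matrix.conjTranspose_eq_transpose_of_trivial]

namespace IsLogConcave

variable {d : ℕ} {f : EuclideanSpace ℝ (Fin d) → ℝ}

theorem hasPosMass_of_integral_eq_one (hi : Integrable f) (h : ∫ x, f x = 1) : HasPosMass f :=
  ⟨hi, by rw [h]; exact one_pos⟩

theorem covMatrix_of_centered (hf : IsLogConcave f) (hm : HasPosMass f) (hc : IsCentered f)
    (h1 : ∫ x, f x = 1) (i j : Fin d) :
    covMatrix f i j = ∫ x : EuclideanSpace ℝ (Fin d), x i * x j * f x := by
  simp [covMatrix, h1, hf.integral_coord_mul_eq_zero hm hc]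

/-- Translation to the barycenter and normalization preserve the isotropic constant. -/
theorem exists_centered (hf : IsLogConcave f) (hm : HasPosMass f) :
    ∃ g : EuclideanSpace ℝ (Fin d) → ℝ, IsLogConcave g ∧ HasPosMass g ∧ ∫ x, g x = 1 ∧ IsCentered g ∧
      isotropicConstant g = isotropicConstant f := by
  set I := ∫ x, f x with hI
  have hI0 : 0 < I := hm.2
  set b : EuclideanSpace ℝ (Fin d) := I⁻¹ • ∫ x, f x • x with hb
  set g : EuclideanSpace ℝ (Fin d) → ℝ := fun x => I⁻¹ * f (x + b) with hg
  have hgl : IsLogConcave g := (hf.comp_affine LinearMap.id b).const_mul (inv_pos.2 hI0)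
  have hgi : Integrable g := (hm.1.comp_add_right b).const_mul _
  have hshift : ∀ F : EuclideanSpace ℝ (Fin d) → ℝ, ∫ x, F (x + b) = ∫ x, F x := fun F =>
    integral_add_right_eq_self F b
  have hg1 : ∫ x, g x = 1 := by
    rw [hg, integral_const_mul, hshift, ← hI, inv_mul_cancel₀ hI0.ne']
  have hgm := hasPosMass_of_integral_eq_one hgi hg1
  have hbi : ∀ i, I * b i = ∫ x : EuclideanSpace ℝ (Fin d), x i * f x := by
    intro i
    have := hf.integral_linear_mul hm (EuclideanSpace.proj i)
    change ∫ x : EuclideanSpace ℝ (Fin d), x i * f x = (∫ x, f x • x) i at this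
    rw [this, hb, PiLp.smul_apply, smul_eq_mul, mul_inv_cancel_left₀ hI0.ne']
  have hgc : IsCentered g := by
    have h1 : ∫ x, g x • (x + b) = b := by
      have := integral_add_right_eq_self (fun x => (I⁻¹ * f x) • x) b (μ := volume)
      rw [hg, this]
      simp_rw [mul_smul]
      rw [integral_smul]
    have h2 : ∫ x, g x • (x + b) = (∫ x, g x • x) + ∫ x, g x • b := by
      simp_rw [smul_add]
      exact integral_add (hgl.integrable_smul_self hgm) (hgi.smul_const b)
    rw [integral_smul_const, hg1, one_smul, h1] at h2
    exact left_eq_add.1 (by rw [add_comm]; exact h2)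
  refine ⟨g, hgl, hgm, hg1, hgc, ?_⟩
  have hcov : covMatrix g = covMatrix f := by
    ext i j
    rw [hgl.covMatrix_of_centered hgm hgc hg1]
    set q : EuclideanSpace ℝ (Fin d) → ℝ := fun y => I⁻¹ * ((y i - b i) * (y j - b j) * f y) with hq
    have e : ∀ x : EuclideanSpace ℝ (Fin d), x i * x j * g x = q (x + b) := by
      intro x
      simp only [hg, hq, PiLp.add_apply, add_sub_cancel_right]; ring
    refine ((integral_congr_ae (Filter.Eventually.of_forall e)).trans (hshift q)).trans ?_
    rw [hq, integral_const_mul]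
    have e2 : ∀ y : EuclideanSpace ℝ (Fin d), (y i - b i) * (y j - b j) * f y =
        (y i * y j * f y - b i * (y j * f y)) - (b j * (y i * f y) - b i * b j * f y) := fun y => by ring
    simp_rw [e2]
    have i1 := hf.integrable_coord_mul_coord hm i j
    have i2 := (hf.integrable_coord_mul hm j).const_mul (b i)
    have i3 := (hf.integrable_coord_mul hm i).const_mul (b j)
    have i4 := hm.1.const_mul (b i * b j)
    have i12 : Integrable fun x : EuclideanSpace ℝ (Fin d) => x i * x j * f x - b i * (x j * f x) :=
      i1.sub i2
    have i34 : Integrable fun x : EuclideanSpace ℝ (Fin d) => b j * (x i * f x) - b i * b j * f x :=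
      i3.sub i4
    rw [integral_sub i12 i34, integral_sub i1 i2, integral_sub i3 i4,
      integral_const_mul, integral_const_mul, integral_const_mul, ← hbi, ← hbi, ← hI]
    simp only [covMatrix, Matrix.of_apply]
    rw [← hbi, ← hbi, ← hI]
    field_simp
    ring
  have hsup : ⨆ x, g x = I⁻¹ * ⨆ x, f x :=
    iSup_const_mul_comp (add_right_surjective b) (inv_pos.2 hI0).le
  unfold isotropicConstant
  rw [hcov, hsup, hg1, ← hI, div_one, inv_mul_eq_div]

/-- The support has positive volume, while the hyperplane orthogonal to v is null. -/
theorem integral_inner_sq_pos (hf : IsLogConcave f) (hm : HasPosMass f)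
    {v : EuclideanSpace ℝ (Fin d)} (hv : v ≠ 0) : 0 < ∫ x, inner ℝ v x ^ 2 * f x := by
  have hnn : ∀ x, 0 ≤ inner ℝ v x ^ 2 * f x := fun x => mul_nonneg (sq_nonneg _) (hf.nonneg x)
  have hint : Integrable fun x => inner ℝ v x ^ 2 * f x := by
    refine hf.integrable_mul_of_norm_le hm 2 (C := ‖v‖ ^ 2) (by fun_prop) fun x => ?_
    rw [abs_pow, ← mul_pow]
    gcongr
    exact abs_real_inner_le_norm v x
  rw [integral_pos_iff_support_of_nonneg hnn hint]
  set H : Submodule ℝ (EuclideanSpace ℝ (Fin d)) := (innerSL ℝ v).toLinearMap.ker with hH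
  have hHne : H ≠ ⊤ := by
    intro h
    have : v ∈ H := by rw [h]; trivial
    rw [hH, LinearMap.mem_ker] at this
    simp at this
    exact hv this
  have hH0 : volume (H : Set (EuclideanSpace ℝ (Fin d))) = 0 := Measure.addHaar_submodule volume H hHne
  have hsub : {x | 0 < f x} ⊆ Function.support (fun x => inner ℝ v x ^ 2 * f x) ∪ H := by
    intro x hx
    have hx' : 0 < f x := hx
    by_cases h : inner ℝ v x = 0
    · right
      simpa [hH] using h
    · left
      exact (mul_pos (by positivity) hx').ne'
  have h1 := hf.volume_support_pos hm
  have h2 := (measure_mono (μ := volume) hsub).trans (measure_union_le _ _)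
  rw [hH0, add_zero] at h2
  exact h1.trans_le h2

theorem integral_comp_matrix (A : Matrix (Fin d) (Fin d) ℝ) (hA : A.det ≠ 0)
    {F : Type*} [NormedAddCommGroup F] [NormedSpace ℝ F] (q : EuclideanSpace ℝ (Fin d) → F) :
    |A.det| • ∫ x, q (Matrix.toEuclideanLin A x) = ∫ x, q x := by
  have hdet : LinearMap.det (Matrix.toEuclideanLin A) = A.det := LinearMap.det_toLpLin 2 A
  have hne : LinearMap.det (Matrix.toEuclideanLin A) ≠ 0 := by rw [hdet]; exact hA
  set L := ((Matrix.toEuclideanLin A).equivOfDetNeZero hne).toContinuousLinearEquiv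
  have hmap := Measure.map_linearMap_addHaar_eq_smul_addHaar
    (volume : Measure (EuclideanSpace ℝ (Fin d))) hne
  have h := L.toHomeomorph.measurableEmbedding.integral_map (μ := volume) q
  change ∫ y, q y ∂(Measure.map (Matrix.toEuclideanLin A) volume) =
    ∫ x, q (Matrix.toEuclideanLin A x) at h
  rw [← h, hmap, integral_smul_measure, hdet, ENNReal.toReal_ofReal (abs_nonneg _), smul_smul, abs_inv,
    mul_inv_cancel₀ (abs_ne_zero.2 hA), one_smul]

/-- Every centered density has an isotropic linear image with the same isotropic constant. -/
theorem exists_isotropic (hf : IsLogConcave f) (hm : HasPosMass f) (h1 : ∫ x, f x = 1)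
    (hc : IsCentered f) (hd : d ≠ 0) :
    ∃ g : EuclideanSpace ℝ (Fin d) → ℝ, IsLogConcave g ∧ HasPosMass g ∧ ∫ x, g x = 1 ∧ IsCentered g ∧
      covMatrix g = (1 : ℝ) ^ 2 • (1 : Matrix (Fin d) (Fin d) ℝ) ∧
      isotropicConstant g = isotropicConstant f := by
  set S := covMatrix f with hS
  have hSij : ∀ i j, S i j = ∫ x : EuclideanSpace ℝ (Fin d), x i * x j * f x :=
    hf.covMatrix_of_centered hm hc h1
  have hpd : S.PosDef := by
    refine Matrix.PosDef.of_dotProduct_mulVec_pos ?_ fun v hv => ?_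
    · ext i j
      rw [Matrix.conjTranspose_apply, star_trivial, hSij, hSij]
      simp_rw [mul_comm]
    · have h2 := hf.integral_inner_sq_pos hm (v := WithLp.toLp 2 v) (by simpa using hv)
      rw [hf.integral_inner_sq_mul hm] at h2
      refine h2.trans_eq ?_
      simp only [dotProduct, Matrix.mulVec, star_trivial, Finset.mul_sum]
      refine Finset.sum_congr rfl fun i _ => Finset.sum_congr rfl fun j _ => ?_
      rw [hSij]
      ring
  -- With S = A Aᵀ, the density |det A| f(Ax) has covariance A⁻¹ S A⁻ᵀ = I. The factor |det A|^{1/d}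
  -- gained by the supremum is the lost det(S)^{1/(2d)}.
  obtain ⟨A, hSA⟩ := hpd.exists_eq_mul_transpose
  have hdetS : S.det = A.det ^ 2 := by rw [hSA, Matrix.det_mul, Matrix.det_transpose, pow_two]
  have hA : A.det ≠ 0 := by
    intro h
    have := hpd.det_pos
    rw [hdetS, h] at this
    simp at this
  have hA' : 0 < |A.det| := abs_pos.2 hA
  set T := Matrix.toEuclideanLin A with hT
  set g : EuclideanSpace ℝ (Fin d) → ℝ := fun x => |A.det| * f (T x) with hg
  have hgl : IsLogConcave g := by
    have := (hf.comp_affine T 0).const_mul hA'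
    simpa using this
  have hTsurj : Function.Surjective T := by
    have hdet : LinearMap.det T ≠ 0 := by rw [hT, LinearMap.det_toLpLin 2 A]; exact hA
    exact (T.equivOfDetNeZero hdet).surjective
  have hTinj : Function.Injective T := LinearMap.injective_iff_surjective.2 hTsurj
  have hg1 : ∫ x, g x = 1 := by
    rw [hg, integral_const_mul, ← smul_eq_mul, integral_comp_matrix A hA f, h1]
  -- A non-integrable function has Bochner integral 0, so integral 1 implies integrability.
  have hgi : Integrable g := Integrable.of_integral_ne_zero (by rw [hg1]; exact one_ne_zero)
  have hgm := hasPosMass_of_integral_eq_one hgi hg1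
  have hgc : IsCentered g := by
    have h2 := integral_comp_matrix A hA fun x => f x • x
    rw [show ∫ x, f x • x = 0 from hc, ← integral_smul] at h2
    have h3 : ∀ x, |A.det| • f (T x) • T x = T.toContinuousLinearMap (g x • x) := by
      intro x
      rw [map_smul, smul_smul]; rfl
    have h4 : ∫ x, T.toContinuousLinearMap (g x • x) = 0 := by
      rw [← h2]; exact integral_congr_ae (Filter.Eventually.of_forall fun x => (h3 x).symm)
    rw [ContinuousLinearMap.integral_comp_comm _ (hgl.integrable_smul_self hgm)] at h4
    exact hTinj (h4.trans (map_zero T).symm)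
  have hTi : ∀ x i, T x i = ∑ k, A i k * x k := fun x i => rfl
  have hcov : covMatrix g = 1 := by
    have h2 : S = A * covMatrix g * A.transpose := by
      ext i j
      rw [hSij, ← integral_comp_matrix A hA, smul_eq_mul, ← integral_const_mul]
      have e : ∀ x : EuclideanSpace ℝ (Fin d), |A.det| * (T x i * T x j * f (T x)) =
          ∑ l, ∑ k, A i k * A j l * (x k * x l * g x) := by
        intro x
        rw [hTi, hTi, Finset.sum_mul_sum, Finset.sum_mul, Finset.mul_sum, Finset.sum_comm]
        refine Finset.sum_congr rfl fun k _ => ?_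
        rw [Finset.sum_mul, Finset.mul_sum]
        refine Finset.sum_congr rfl fun l _ => ?_
        simp only [hg]; ring
      have hI : ∀ k l, Integrable fun x : EuclideanSpace ℝ (Fin d) =>
          A i k * A j l * (x k * x l * g x) := fun k l =>
        (hgl.integrable_coord_mul_coord hgm k l).const_mul _
      have e2 : ∫ x : EuclideanSpace ℝ (Fin d), ∑ l, ∑ k, A i k * A j l * (x k * x l * g x) =
          ∑ l, ∑ k, A i k * A j l * covMatrix g k l := by
        rw [integral_finsetSum _ fun l _ => integrable_finsetSum _ fun k _ => hI k l]
        refine Finset.sum_congr rfl fun l _ => ?_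
        rw [integral_finsetSum _ fun k _ => hI k l]
        refine Finset.sum_congr rfl fun k _ => ?_
        rw [integral_const_mul, hgl.covMatrix_of_centered hgm hgc hg1]
      refine ((integral_congr_ae (Filter.Eventually.of_forall e)).trans e2).trans ?_
      rw [Matrix.mul_apply]
      refine Finset.sum_congr rfl fun l _ => ?_
      rw [Matrix.mul_apply, Finset.sum_mul]
      refine Finset.sum_congr rfl fun k _ => ?_
      rw [Matrix.transpose_apply]
      ring
    have hu : IsUnit A := (Matrix.isUnit_iff_isUnit_det A).2 (isUnit_iff_ne_zero.2 hA)
    have hut : IsUnit A.transpose := (Matrix.isUnit_iff_isUnit_det _).2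
      (by rw [Matrix.det_transpose]; exact isUnit_iff_ne_zero.2 hA)
    rw [hSA, ← sub_eq_zero, ← sub_mul] at h2
    have h3 : A - A * covMatrix g = 0 := by
      have := congrArg (· * (A.transpose)⁻¹) h2
      simpa [Matrix.mul_assoc, Matrix.mul_nonsing_inv _ ((Matrix.isUnit_iff_isUnit_det _).1 hut)] using this
    have h4 : A * covMatrix g = A * 1 := by rw [mul_one]; exact (sub_eq_zero.1 h3).symm
    exact hu.mul_left_cancel h4
  refine ⟨g, hgl, hgm, hg1, hgc, by rw [hcov]; simp, ?_⟩
  have hsup : ⨆ x, g x = |A.det| * ⨆ x, f x := iSup_const_mul_comp hTsurj hA'.le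
  have hM0 : 0 ≤ ⨆ x, f x := Real.iSup_nonneg hf.nonneg
  have hd' : (d : ℝ) ≠ 0 := by exact_mod_cast hd
  unfold isotropicConstant
  rw [hsup, hg1, h1, hcov, Matrix.det_one, Real.one_rpow, div_one, div_one, mul_one, ← hS, hdetS,
    Real.mul_rpow hA'.le hM0, mul_comm]
  congr 1
  rw [← sq_abs, ← Real.rpow_natCast, ← Real.rpow_mul hA'.le]
  congr 1
  push_cast
  field_simp

end IsLogConcave

/-! ### Finiteness of L_d and comparison of the constants. -/

namespace IsLogConcave

variable {d : ℕ} {f : EuclideanSpace ℝ (Fin d) → ℝ} {σ : ℝ}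

theorem isotropicConstant_eq (h1 : ∫ x, f x = 1) (hd : d ≠ 0) (hσ0 : 0 < σ)
    (hσ : covMatrix f = σ ^ 2 • (1 : Matrix (Fin d) (Fin d) ℝ)) :
    isotropicConstant f = (⨆ x, f x) ^ (1 / (d : ℝ)) * σ := by
  have hd' : (d : ℝ) ≠ 0 := by exact_mod_cast hd
  unfold isotropicConstant
  rw [h1, div_one, hσ, Matrix.det_smul, Matrix.det_one, mul_one, Fintype.card_fin, ← pow_mul]
  congr 1
  rw [← Real.rpow_natCast, ← Real.rpow_mul hσ0.le]
  have : ((2 * d : ℕ) : ℝ) * (1 / (2 * (d : ℝ))) = 1 := by push_cast; field_simp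
  rw [this, Real.rpow_one]

/-- K_d has volume 1/f(0) and contains the open ball of radius σ/√(2^{d+2}), which bounds f(0) σ^d.
Passing from f(0) to sup f costs e^d, that is, e after the d-th root. -/
theorem isotropicConstant_le (hf : IsLogConcave f) (hm : HasPosMass f) (hc : IsCentered f)
    (h1 : ∫ x, f x = 1) (hd : d ≠ 0) (hσ0 : 0 < σ)
    (hσ : covMatrix f = σ ^ 2 • (1 : Matrix (Fin d) (Fin d) ℝ)) :
    isotropicConstant f ≤ Real.exp 1 * √(2 ^ (d + 2)) /
      (∫ _ in Metric.ball (0 : EuclideanSpace ℝ (Fin d)) 1, (1 : ℝ)) ^ (1 / (d : ℝ)) := by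
  have hf0 := hf.apply_zero_pos hm hc
  set ω := ∫ _ in Metric.ball (0 : EuclideanSpace ℝ (Fin d)) 1, (1 : ℝ) with hω
  have hω0 : 0 < ω := by
    rw [hω, setIntegral_const, smul_eq_mul, mul_one]
    exact ENNReal.toReal_pos (Metric.measure_ball_pos _ _ one_pos).ne' measure_ball_lt_top.ne
  set s : ℝ := √(2 ^ (d + 2)) with hs
  have hs0 : 0 < s := by positivity
  have hs2 : s ^ 2 = 2 ^ (d + 2) := Real.sq_sqrt (by positivity)
  set r := σ / s with hr
  have hr0 : 0 < r := by positivity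
  have hsub : r • Metric.ball (0 : EuclideanSpace ℝ (Fin d)) 1 ⊆ ballBody (d : ℝ) f := by
    rintro _ ⟨y, hy, rfl⟩
    by_contra hcon
    have h := hf.sq_le_of_notMem_ballBody hm hc h1 hd hσ hcon
    rw [mem_ball_zero_iff] at hy
    change σ ^ 2 ≤ 2 ^ (d + 2) * ‖r • y‖ ^ 2 at h
    rw [norm_smul, Real.norm_of_nonneg hr0.le, ← hs2, ← mul_pow, ← mul_assoc, hr,
      mul_div_cancel₀ _ hs0.ne'] at h
    have h2 : σ ≤ σ * ‖y‖ := le_of_pow_le_pow_left₀ two_ne_zero (by positivity) h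
    nlinarith
  obtain ⟨R, -, hR⟩ := hf.exists_norm_le_of_mem_ballBody hm hf0 hd
  have hvol : f 0 * (r ^ d * ω) ≤ 1 := by
    rw [← h1, ← hf.volume_ballBody hm hf0 hd]
    have e := setIntegral_smul_of_homogeneous (d := d) (h := fun _ => 1) (k := 0) (by simp) hr0
      (Metric.ball (0 : EuclideanSpace ℝ (Fin d)) 1)
    rw [add_zero, ← hω] at e
    rw [← e]
    refine mul_le_mul_of_nonneg_left ?_ hf0.le
    exact setIntegral_mono_set (continuous_const.integrableOn_of_subset_closedBall hR)
      (Filter.Eventually.of_forall fun _ => zero_le_one) hsub.eventuallyLE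
  rw [isotropicConstant_eq h1 hd hσ0 hσ]
  set M := ⨆ x, f x with hM
  have hM0 : 0 ≤ M := Real.iSup_nonneg hf.nonneg
  have hMle : M ≤ Real.exp d * f 0 := ciSup_le (hf.le_exp_mul_apply_zero hm hc)
  simp only [one_div]
  set u := M ^ ((d : ℝ)⁻¹) with hu
  have hu0 : 0 ≤ u := by positivity
  have hud : u ^ d = M := Real.rpow_inv_natCast_pow hM0 hd
  set w := ω ^ ((d : ℝ)⁻¹) with hw
  have hw0 : 0 < w := by positivity
  have hwd : w ^ d = ω := Real.rpow_inv_natCast_pow hω0.le hd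
  have h3 : (u * r * w) ^ d ≤ Real.exp 1 ^ d := by
    rw [← Real.exp_nat_mul, mul_one, mul_pow, mul_pow, hud, hwd]
    calc M * r ^ d * ω ≤ Real.exp d * f 0 * r ^ d * ω := by gcongr
      _ = Real.exp d * (f 0 * (r ^ d * ω)) := by ring
      _ ≤ Real.exp d * 1 := by gcongr
      _ = _ := mul_one _
  have h4 : u * r * w ≤ Real.exp 1 := le_of_pow_le_pow_left₀ hd (Real.exp_pos 1).le h3
  have h5 : σ = r * s := by rw [hr]; field_simp
  rw [h5, le_div_iff₀ hw0]
  calc u * (r * s) * w = u * r * w * s := by ring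
    _ ≤ _ := by gcongr

/-- Every isotropic constant is attained by a centered density with identity covariance. -/
theorem exists_normalized (hf : IsLogConcave f) (hm : HasPosMass f) (hd : d ≠ 0) :
    ∃ g : EuclideanSpace ℝ (Fin d) → ℝ, IsLogConcave g ∧ HasPosMass g ∧ ∫ x, g x = 1 ∧ IsCentered g ∧
      covMatrix g = (1 : ℝ) ^ 2 • (1 : Matrix (Fin d) (Fin d) ℝ) ∧
      isotropicConstant g = isotropicConstant f := by
  obtain ⟨g, hg, hgm, hg1, hgc, hgL⟩ := hf.exists_centered hm
  obtain ⟨k, hk, hkm, hk1, hkc, hkσ, hkL⟩ := hg.exists_isotropic hgm hg1 hgc hd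
  exact ⟨k, hk, hkm, hk1, hkc, hkσ, hkL.trans hgL⟩

end IsLogConcave

theorem bddAbove_isotropicConstants {d : ℕ} (hd : d ≠ 0) : BddAbove (isotropicConstants d) := by
  refine ⟨Real.exp 1 * √(2 ^ (d + 2)) /
    (∫ _ in Metric.ball (0 : EuclideanSpace ℝ (Fin d)) 1, (1 : ℝ)) ^ (1 / (d : ℝ)), ?_⟩
  rintro _ ⟨f, hf, hm, rfl⟩
  obtain ⟨g, hg, hgm, hg1, hgc, hgσ, hgL⟩ := hf.exists_normalized hm hd
  rw [← hgL]
  exact hg.isotropicConstant_le hgm hgc hg1 hd one_pos hgσ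

/-- The entropy bound holds for every normalized density, so one example suffices. -/
theorem one_le_maxIsotropicConstant_mul {d : ℕ} (hd : d ≠ 0) :
    1 ≤ maxIsotropicConstant d * (√(2 * Real.pi) * Real.exp (1 / 2)) := by
  obtain ⟨g, hg, hgm, hg1, hgc, hgσ, hgL⟩ :=
    (isLogConcave_exp_neg_norm d).exists_normalized (hasPosMass_exp_neg_norm d) hd
  have h := hg.one_le_sup_rpow_mul hgm hgc hg1 hd one_pos hgσ
    (M := ⨆ x, g x) fun x => le_ciSup (hg.bddAbove_range hgm) x
  rw [← IsLogConcave.isotropicConstant_eq hg1 hd one_pos hgσ] at h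
  refine h.trans ?_
  gcongr
  exact le_csSup (bddAbove_isotropicConstants hd) ⟨g, hg, hgm, rfl⟩

theorem exp_three_halves : Real.exp (3 / 2) = Real.exp 1 * Real.exp (1 / 2) := by
  rw [← Real.exp_add]; norm_num

theorem lowerRadialConstant_pos {c₁ : ℝ} (h : 0 < c₁) (d : ℕ) : 0 < lowerRadialConstant c₁ d := by
  unfold lowerRadialConstant
  positivity

theorem lowerRadialConstant_lt_upperRadialConstant {c₁ c₂ : ℝ} (h0 : 0 < c₁) (h : c₁ < c₂) {d : ℕ}
    (hd : d ≠ 0) : lowerRadialConstant c₁ d < upperRadialConstant c₂ d := by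
  unfold lowerRadialConstant upperRadialConstant
  have hL := one_le_maxIsotropicConstant_mul hd
  set S := √(2 * Real.pi) * Real.exp (1 / 2) with hS
  have hS0 : 0 < S := by positivity
  have hL0 : 0 < maxIsotropicConstant d := by
    by_contra! hcon
    have : maxIsotropicConstant d * S ≤ 0 := mul_nonpos_of_nonpos_of_nonneg hcon hS0.le
    linarith
  have he : 1 ≤ Real.exp 1 := Real.one_le_exp zero_le_one
  have hc2 : 0 < c₂ := h0.trans h
  rw [exp_three_halves, div_lt_iff₀ (by positivity)]
  calc c₁ ^ (d + 2) < c₂ ^ (d + 2) := pow_lt_pow_left₀ h h0.le (by simp)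
    _ ≤ c₂ ^ (d + 2) * (maxIsotropicConstant d * S) := le_mul_of_one_le_right (by positivity) hL
    _ ≤ c₂ ^ (d + 2) * (maxIsotropicConstant d * S) * (((d : ℝ) + 1) * Real.exp 1) := by
        refine le_mul_of_one_le_right (by positivity) ?_
        have : (0 : ℝ) ≤ d := by positivity
        nlinarith
    _ = _ := by rw [hS]; ring

theorem setIntegral_Ioc_pow_mul {n : ℕ} (hn : n ≠ 0) {R : ℝ} (hR : 0 ≤ R) (a : ℝ) :
    ∫ r in Ioc (0 : ℝ) R, n * r ^ (n - 1) * a = R ^ n * a := by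
  obtain ⟨m, rfl⟩ := Nat.exists_eq_succ_of_ne_zero hn
  rw [← intervalIntegral.integral_of_le hR, intervalIntegral.integral_mul_const,
    intervalIntegral.integral_const_mul, integral_pow, Nat.succ_eq_add_one, Nat.add_sub_cancel,
    zero_pow (by simp), sub_zero]
  push_cast
  field_simp

/-! ### Radial bounds and the concentration estimate. -/

namespace IsLogConcave

variable {d : ℕ} {f : EuclideanSpace ℝ (Fin d) → ℝ} {σ c₁ c₂ : ℝ}

theorem rayMoment_rpow_eq (hf : IsLogConcave f) (hf0 : 0 < f 0) (x : EuclideanSpace ℝ (Fin d)) :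
    rayMoment f d x ^ (1 / (d : ℝ)) =
      f 0 ^ (1 / (d : ℝ)) * (rayMoment f d x / f 0) ^ ((d : ℝ)⁻¹) := by
  rw [one_div, ← Real.mul_rpow hf0.le (div_nonneg (hf.rayMoment_nonneg d x) hf0.le),
    mul_div_cancel₀ _ hf0.ne']

theorem pow_mul_le_radius (hf : IsLogConcave f) (hm : HasPosMass f) (hc : IsCentered f)
    (h1 : ∫ x, f x = 1) (hd : d ≠ 0) (hσ0 : 0 < σ)
    (hσ : covMatrix f = σ ^ 2 • (1 : Matrix (Fin d) (Fin d) ℝ)) (hc₁ : 0 < c₁) (hc₁' : c₁ ^ 2 ≤ 1 / 2)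
    {θ : EuclideanSpace ℝ (Fin d)} (hθ : ‖θ‖ = 1) :
    c₁ ^ (d + 2) * σ ≤ (rayMoment f d θ / f 0) ^ ((d : ℝ)⁻¹) := by
  have hf0 := hf.apply_zero_pos hm hc
  have hθ0 : θ ≠ 0 := norm_ne_zero_iff.1 (by rw [hθ]; exact one_ne_zero)
  have hρ0 : 0 ≤ (rayMoment f d θ / f 0) ^ ((d : ℝ)⁻¹) :=
    Real.rpow_nonneg (div_nonneg (hf.rayMoment_nonneg d θ) hf0.le) _
  -- The inner radius estimate applies to points outside K_d, hence to every r beyond the radius;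
  -- the bound then passes to the infimum.
  refine le_of_forall_gt_imp_ge_of_dense fun r hr => ?_
  have hr0 : 0 < r := hρ0.trans_lt hr
  have hnot : r • θ ∉ ballBody (d : ℝ) f := by
    rw [hf.smul_mem_ballBody_iff hm hf0 hd hθ0 hr0]; exact hr.not_ge
  have h := hf.sq_le_of_notMem_ballBody hm hc h1 hd hσ hnot
  rw [norm_smul, hθ, mul_one, Real.norm_of_nonneg hr0.le] at h
  refine le_of_pow_le_pow_left₀ two_ne_zero hr0.le ?_
  calc (c₁ ^ (d + 2) * σ) ^ 2 = (c₁ ^ 2) ^ (d + 2) * σ ^ 2 := by ring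
    _ ≤ (1 / 2) ^ (d + 2) * (2 ^ (d + 2) * r ^ 2) := by gcongr
    _ = r ^ 2 := by rw [← mul_assoc, ← mul_pow]; norm_num

/-- Entropy accounts for e^{1/2}; the other factor e is the d-th root of e^d in sup f ≤ e^d f(0). -/
theorem one_le_apply_zero_rpow_mul (hf : IsLogConcave f) (hm : HasPosMass f) (hc : IsCentered f)
    (h1 : ∫ x, f x = 1) (hd : d ≠ 0) (hσ0 : 0 < σ)
    (hσ : covMatrix f = σ ^ 2 • (1 : Matrix (Fin d) (Fin d) ℝ)) :
    1 ≤ f 0 ^ (1 / (d : ℝ)) * σ * (√(2 * Real.pi) * Real.exp (3 / 2)) := by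
  have hf0 := hf.apply_zero_pos hm hc
  have hd' : (d : ℝ) ≠ 0 := by exact_mod_cast hd
  have h := hf.one_le_sup_rpow_mul hm hc h1 hd hσ0 hσ (hf.le_exp_mul_apply_zero hm hc)
  rw [Real.mul_rpow (Real.exp_pos _).le hf0.le, ← Real.exp_mul, mul_one_div_cancel hd'] at h
  rw [exp_three_halves]
  linarith

theorem apply_zero_rpow_mul_le (hf : IsLogConcave f) (hm : HasPosMass f)
    (h1 : ∫ x, f x = 1) (hd : d ≠ 0) (hσ0 : 0 < σ)
    (hσ : covMatrix f = σ ^ 2 • (1 : Matrix (Fin d) (Fin d) ℝ)) :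
    f 0 ^ (1 / (d : ℝ)) * σ ≤ maxIsotropicConstant d := by
  refine le_trans ?_ (le_csSup (bddAbove_isotropicConstants hd) ⟨f, hf, hm, rfl⟩)
  rw [isotropicConstant_eq h1 hd hσ0 hσ]
  gcongr
  · exact hf.nonneg 0
  · exact le_ciSup (hf.bddAbove_range hm) 0

theorem lowerRadialConstant_le (hf : IsLogConcave f) (hm : HasPosMass f) (hc : IsCentered f)
    (h1 : ∫ x, f x = 1) (hd : d ≠ 0) (hσ0 : 0 < σ)
    (hσ : covMatrix f = σ ^ 2 • (1 : Matrix (Fin d) (Fin d) ℝ)) (hc₁ : 0 < c₁) (hc₁' : c₁ ^ 2 ≤ 1 / 2)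
    {θ : EuclideanSpace ℝ (Fin d)} (hθ : ‖θ‖ = 1) :
    lowerRadialConstant c₁ d ≤ rayMoment f d θ ^ (1 / (d : ℝ)) := by
  have hf0 := hf.apply_zero_pos hm hc
  rw [hf.rayMoment_rpow_eq hf0]
  unfold lowerRadialConstant
  rw [div_le_iff₀ (by positivity)]
  have hu0 : 0 < f 0 ^ (1 / (d : ℝ)) := by positivity
  calc c₁ ^ (d + 2) ≤ c₁ ^ (d + 2) * (f 0 ^ (1 / (d : ℝ)) * σ * (√(2 * Real.pi) * Real.exp (3 / 2))) :=
        le_mul_of_one_le_right (by positivity) (hf.one_le_apply_zero_rpow_mul hm hc h1 hd hσ0 hσ)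
    _ = f 0 ^ (1 / (d : ℝ)) * (c₁ ^ (d + 2) * σ) * (√(2 * Real.pi) * Real.exp (3 / 2)) := by ring
    _ ≤ _ := by
      gcongr
      exact hf.pow_mul_le_radius hm hc h1 hd hσ0 hσ hc₁ hc₁' hθ

theorem le_upperRadialConstant (hf : IsLogConcave f) (hm : HasPosMass f) (hc : IsCentered f)
    (h1 : ∫ x, f x = 1) (hd : d ≠ 0) (hσ0 : 0 < σ)
    (hσ : covMatrix f = σ ^ 2 • (1 : Matrix (Fin d) (Fin d) ℝ)) (hC : AreBallBodyConstants c₁ c₂)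
    {θ : EuclideanSpace ℝ (Fin d)} (hθ : ‖θ‖ = 1) :
    rayMoment f d θ ^ (1 / (d : ℝ)) ≤ upperRadialConstant c₂ d := by
  have hf0 := hf.apply_zero_pos hm hc
  have hθ0 : θ ≠ 0 := norm_ne_zero_iff.1 (by rw [hθ]; exact one_ne_zero)
  -- Serves only to make the radius ρ positive, so that ρθ can be tested for membership in K_d.
  have hlow := hf.pow_mul_le_radius hm hc h1 hd hσ0 hσ hC.1 hC.sq_le_half hθ
  have hc₁ := hC.1
  have hc₂ : 0 < c₂ := hC.1.trans hC.2.1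
  rw [hf.rayMoment_rpow_eq hf0]
  set ρ := (rayMoment f d θ / f 0) ^ ((d : ℝ)⁻¹) with hρ
  have hρ0 : 0 < ρ := lt_of_lt_of_le (by positivity) hlow
  obtain ⟨⟨-, hs1⟩, -, hs2⟩ := hC.2.2 d (Nat.one_le_iff_ne_zero.2 hd) f hf hm hc
  have e1 : (d : ℝ) + 1 = ((d + 1 : ℕ) : ℝ) := by push_cast; ring
  have e2 : (d : ℝ) + 2 = ((d + 2 : ℕ) : ℝ) := by push_cast; ring
  rw [e1] at hs1
  rw [e1, e2] at hs2
  have hmem : ρ • θ ∈ ballBody (d : ℝ) f := (hf.smul_mem_ballBody_iff hm hf0 hd hθ0 hρ0).2 le_rfl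
  have hmem2 : c₂⁻¹ • ρ • θ ∈ ballBody ((d + 1 : ℕ) : ℝ) f :=
    (mem_smul_set_iff_inv_smul_mem₀ hc₂.ne' _ _).1 (hs1 hmem)
  have h := hf.norm_le_of_mem_ballBody_succ hm hc h1 hd hσ0 hσ hc₂ hs1 hs2 hmem2
  rw [norm_smul, norm_smul, hθ, mul_one, Real.norm_of_nonneg hρ0.le, Real.norm_of_nonneg (by positivity),
    inv_mul_le_iff₀ hc₂] at h
  unfold upperRadialConstant
  calc f 0 ^ (1 / (d : ℝ)) * ρ ≤ f 0 ^ (1 / (d : ℝ)) * (c₂ * (((d : ℝ) + 1) * c₂ ^ (d + 1) * σ)) := by gcongr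
    _ = ((d : ℝ) + 1) * c₂ ^ (d + 2) * (f 0 ^ (1 / (d : ℝ)) * σ) := by ring
    _ ≤ _ := by
      gcongr
      exact hf.apply_zero_rpow_mul_le hm h1 hd hσ0 hσ

/-- A radial moment bound forces exponential decay beyond the corresponding scale. -/
theorem le_mul_two_rpow_of_rayMoment_le (hf : IsLogConcave f) (hm : HasPosMass f) (hf0 : 0 < f 0)
    (hd : d ≠ 0) {C : ℝ} (hC : 0 < C)
    (hray : ∀ θ : EuclideanSpace ℝ (Fin d), ‖θ‖ = 1 → rayMoment f d θ ^ (1 / (d : ℝ)) ≤ C)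
    {x : EuclideanSpace ℝ (Fin d)} (hx : (3 : ℝ) ^ (1 / (d : ℝ)) * C / f 0 ^ (1 / (d : ℝ)) ≤ ‖x‖) :
    f x ≤ f 0 * (2 : ℝ) ^ (-(‖x‖ * f 0 ^ (1 / (d : ℝ)) / ((3 : ℝ) ^ (1 / (d : ℝ)) * C))) := by
  have hd' : (d : ℝ) ≠ 0 := by exact_mod_cast hd
  set u := f 0 ^ (1 / (d : ℝ)) with hu
  have hu0 : 0 < u := by positivity
  have hud : u ^ d = f 0 := by rw [hu, one_div]; exact Real.rpow_inv_natCast_pow hf0.le hd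
  set k := (3 : ℝ) ^ (1 / (d : ℝ)) with hk
  have hk0 : 0 < k := by positivity
  have hkd : k ^ d = 3 := by rw [hk, one_div]; exact Real.rpow_inv_natCast_pow (by norm_num) hd
  set R := k * C / u with hR
  have hR0 : 0 < R := by positivity
  have hx0 : 0 < ‖x‖ := hR0.trans_le hx
  set θ := ‖x‖⁻¹ • x with hθ
  have hθ1 : ‖θ‖ = 1 := by
    rw [hθ, norm_smul, norm_inv, norm_norm, inv_mul_cancel₀ hx0.ne']
  have hθ0 : θ ≠ 0 := norm_ne_zero_iff.1 (by rw [hθ1]; exact one_ne_zero)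
  -- Otherwise f ≥ f(0)/2 on the whole segment up to Rθ, and the ray moment is at least R^d f(0)/2 =
  -- (3/2) C^d > C^d. The 3 in the constant only has to exceed 2.
  have hhalf : f (R • θ) ≤ f 0 / 2 := by
    by_contra! hcon
    have hint := hf.integrableOn_rayMoment hm hθ0 d
    have hlow : ∫ r in Ioc (0 : ℝ) R, d * r ^ (d - 1) * (f 0 / 2) ≤ rayMoment f d θ := by
      refine le_trans ?_ (setIntegral_mono_set hint ?_ (show Ioc 0 R ⊆ Ioi 0 from Ioc_subset_Ioi_self).eventuallyLE)
      · refine setIntegral_mono_on ?_ (hint.mono_set Ioc_subset_Ioi_self) measurableSet_Ioc fun r hr => ?_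
        · exact (Continuous.integrableOn_Icc (by fun_prop)).mono_set Ioc_subset_Icc_self
        · have hr1 := hr.1
          refine mul_le_mul_of_nonneg_left ?_ (by positivity)
          refine le_trans (le_min ?_ hcon.le) (hf.min_le_ray θ hr.1.le hr.2)
          rw [zero_smul]; linarith
      · filter_upwards [ae_restrict_mem measurableSet_Ioi] with r hr
        have hr' : (0 : ℝ) < r := hr
        exact mul_nonneg (by positivity) (hf.nonneg _)
    have hval : ∫ r in Ioc (0 : ℝ) R, d * r ^ (d - 1) * (f 0 / 2) = R ^ d * (f 0 / 2) :=
      setIntegral_Ioc_pow_mul hd hR0.le _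
    have hup : rayMoment f d θ ≤ C ^ d := by
      have h := pow_le_pow_left₀ (Real.rpow_nonneg (hf.rayMoment_nonneg d θ) _) (hray θ hθ1) d
      rwa [one_div, Real.rpow_inv_natCast_pow (hf.rayMoment_nonneg d θ) hd] at h
    have hRd : R ^ d * (f 0 / 2) = 3 / 2 * C ^ d := by
      rw [hR, div_pow, mul_pow, hkd, hud]; field_simp
    have hCd : 0 < C ^ d := by positivity
    rw [hval, hRd] at hlow
    linarith
  set t := R / ‖x‖ with ht
  have ht0 : 0 < t := by positivity
  have ht1 : t ≤ 1 := (div_le_one hx0).2 hx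
  have hpt : R • θ = t • x := by rw [hθ, smul_smul, ht, div_eq_mul_inv]
  -- Rθ = tx divides the segment from 0 to x, so one halving at Rθ becomes 1/t halvings at x.
  have h := hf.le_map 0 x (1 - t) t (by linarith) ht0.le (by ring)
  rw [smul_zero, zero_add, ← hpt] at h
  rcases (hf.nonneg x).eq_or_lt with hfx | hfx
  · rw [← hfx]; positivity
  have h2 := Real.log_le_log (by positivity) (h.trans hhalf)
  rw [Real.log_mul (by positivity) (by positivity), Real.log_rpow hf0, Real.log_rpow hfx,
    Real.log_div hf0.ne' (by norm_num)] at h2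
  have hexp : ‖x‖ * u / (k * C) = t⁻¹ := by rw [ht, hR]; field_simp
  rw [hexp, ← Real.log_le_log_iff hfx (by positivity), Real.log_mul hf0.ne' (by positivity),
    Real.log_rpow (by norm_num)]
  have h3 : t * Real.log (f x) ≤ t * (Real.log (f 0) + -t⁻¹ * Real.log 2) := by
    have : t * (Real.log (f 0) + -t⁻¹ * Real.log 2) = t * Real.log (f 0) - Real.log 2 := by
      field_simp; ring
    rw [this]; linarith
  exact le_of_mul_le_mul_left h3 ht0

end IsLogConcave

theorem mainTheorem9 :
    (∃ c₁ c₂ : ℝ, AreBallBodyConstants c₁ c₂) ∧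
    ∀ c₁ c₂ : ℝ, AreBallBodyConstants c₁ c₂ → ∀ d : ℕ, 1 ≤ d →
      BddAbove (isotropicConstants d) ∧
      0 < lowerRadialConstant c₁ d ∧
      lowerRadialConstant c₁ d < upperRadialConstant c₂ d ∧
      ∀ f : EuclideanSpace ℝ (Fin d) → ℝ,
        IsLogConcave f → IsDensity f → IsCentered f → IsIsotropic f →
          (∀ θ : EuclideanSpace ℝ (Fin d), ‖θ‖ = 1 →
            IntegrableOn (fun r : ℝ => (d : ℝ) * r ^ (d - 1) * f (r • θ)) (Set.Ioi 0) ∧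
            lowerRadialConstant c₁ d
              ≤ (∫ r in Set.Ioi (0 : ℝ), (d : ℝ) * r ^ (d - 1) * f (r • θ)) ^ (1 / (d : ℝ)) ∧
            (∫ r in Set.Ioi (0 : ℝ), (d : ℝ) * r ^ (d - 1) * f (r • θ)) ^ (1 / (d : ℝ))
              ≤ upperRadialConstant c₂ d) ∧
          0 < f 0 ∧
          ∀ x : EuclideanSpace ℝ (Fin d),
            concentrationConstant c₂ d / f 0 ^ (1 / (d : ℝ)) ≤ ‖x‖ →
              f x ≤ f 0 *
                (2 : ℝ) ^ (-(‖x‖ * f 0 ^ (1 / (d : ℝ)) / concentrationConstant c₂ d)) := by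
  refine ⟨⟨_, _, areBallBodyConstants_half_exp⟩, fun c₁ c₂ hC d hd1 => ?_⟩
  have hd : d ≠ 0 := Nat.one_le_iff_ne_zero.1 hd1
  have hlow := lowerRadialConstant_pos hC.1 d
  have hlt := lowerRadialConstant_lt_upperRadialConstant hC.1 hC.2.1 hd
  refine ⟨bddAbove_isotropicConstants hd, hlow, hlt, ?_⟩
  rintro f hf ⟨hfi, h1⟩ hc ⟨σ, hσ0, hσ⟩
  have hm := IsLogConcave.hasPosMass_of_integral_eq_one hfi h1
  have hf0 := hf.apply_zero_pos hm hc
  refine ⟨fun θ hθ => ⟨?_, ?_, ?_⟩, hf0, fun x hx => ?_⟩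
  · exact hf.integrableOn_rayMoment hm (norm_ne_zero_iff.1 (by rw [hθ]; exact one_ne_zero)) d
  · exact hf.lowerRadialConstant_le hm hc h1 hd hσ0 hσ hC.1 hC.sq_le_half hθ
  · exact hf.le_upperRadialConstant hm hc h1 hd hσ0 hσ hC hθ
  · exact hf.le_mul_two_rpow_of_rayMoment_le hm hf0 hd (hlow.trans hlt)
      (fun θ hθ => hf.le_upperRadialConstant hm hc h1 hd hσ0 hσ hC hθ) hx
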